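/- **Setting.** Let $n$ be divisible by $4$ and let $V$ be a set of $n$ jobs with a strict partial order $<_0$ (precedence constraints) and pairwise different lengths $t(v)\ge 0$, taken from a linearly ordered abelian group (for example $\mathbb R$, or $\mathbb R^2$ with the lexicographic order). An ordering is a bijection $\sigma:V\to\{1,\dots,n\}$; its cost is the total completion time $T(\sigma)=\sum_{v}\sum_{u:\sigma(u)\le\sigma(v)}t(u)$. Fix an inclusion-maximal matching $\mathcal M$ of the comparability graph of $<_0$, and two different jobs $v_{begin}$, $v_{end}$ that are minimal, respectively maximal, for $<_0$. Let $<$ be $<_0$ together with the constraints $v_{begin}<v$ for all $v\neq v_{begin}$ and $v<v_{end}$ for all $v\ne v_{end}$. Let $M$ consist of the endpoints of $\mathcal M$ and of $v_{begin},v_{end}$, and let $I_1=V\setminus M$. Let $A,B,C,D$ be the four consecutive quarters of $\{1,\dots,n\}$. Suppose that each $w\in M$ is assigned to a quarter; let $M^\Gamma$ be the set of jobs of $M$ assigned to $\Gamma$. Put $$W^{AB}=\{v\in I_1:\exists w\in M^A\cup M^B,\ v<w\},\qquad W^{CD}=\{v\in I_1:\exists w\in M^C\cup M^D,\ w<v\},$$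 $W=W^{AB}\cup W^{CD}$ and $I_2=I_1\setminus W$, and suppose that each job of $W$ is assigned to a quarter, too. Put $$P^{\neg A}=\{v\in I_2:\exists w\in M^B,\ w<v\},\quad P^A=I_2\setminus P^{\neg A},\quad P^{\neg D}=\{v\in I_2:\exists w\in M^C,\ v<w\},\quad P^D=I_2\setminus P^{\neg D}.$$ The *branch* is the set of all orderings $\sigma$ that satisfy the precedence constraints ($u<v\Rightarrow\sigma(u)<\sigma(v)$) and place each job of $M\cup W$ in the quarter to which it is assigned. For $(\Gamma,\Delta)\in\{(A,A),(B,\neg A),(C,\neg D),(D,D)\}$ and an ordering $\sigma$ let $p^\Gamma(\sigma)=|\sigma(P^\Delta)\cap\Gamma|$. **Machine.** Algorithms are programs of a random access machine (initially zero memory; addition, truncated subtraction, multiplication and integer division of natural numbers, every number that is handled being charged one plus its bit length; lengths of jobs can be copied, added and compared at unit cost). **Statement.** There are one such program and a constant $k$ such that the following holds for every instance and branch as above, every real $\varepsilon_1\le 1/4$ with $|\mathcal M|<\varepsilon_1n$, every pair $(\Gamma,\Delta)\in\{(A,A),(B,\neg A),(C,\neg D),(D,D)\}$ and every natural number $p<|P^\Delta|/2$.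 Started with $<_0$, $t$, $v_{begin}$, $v_{end}$, $M$, the assigned quarters, $\Gamma$ and $p$ as its input, the program halts after a computation of cost at most $$2^{\,n-|P^\Delta|}\binom{|P^\Delta|}{p}\binom{n}{|M|}\,n^{k},$$ and it outputs an ordering of minimum cost among the orderings $\sigma$ of the branch with $p^\Gamma(\sigma)=p$, or reports that there is none. In particular, if $p=p^\Gamma(\sigma_{opt})$ for an ordering $\sigma_{opt}$ of minimum cost in the branch, then the output is an ordering of minimum cost in the branch. -/

import Mathlib

/-!
Single-machine scheduling with precedence constraints, total completion time objective:
the situation that remains after a matching of the comparability graph, the first and the last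
job, and the quarters of the important jobs have been fixed; and a random access machine
(structured programs, logarithmic cost for integers) that receives such a situation as its input.
-/

namespace Sched

/-! ### The machine

Memory consists of finitely many named arrays of natural numbers (those mentioned by the program)
and finitely many named arrays of elements of an ordered group `R` (the weights); an array name
is a constant of the program, an index is computed.  Weights can only be copied, added and
compared, each at unit cost.  Natural numbers are charged by their bit lengths. -/

/-- A memory state: `nat a i` is cell `i` of the integer array `a`,
`grp a i` is cell `i` of the weight array `a`. -/
structure State (R : Type) where
  nat : ℕ → ℕ → ℕ
  grp : ℕ → ℕ → R

/-- Integer expressions; subtraction is truncated and division rounds down. -/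
inductive Exp where
  | lit (c : ℕ)
  | read (a : ℕ) (i : Exp)
  | add (e₁ e₂ : Exp)
  | sub (e₁ e₂ : Exp)
  | mul (e₁ e₂ : Exp)
  | div (e₁ e₂ : Exp)

/-- Weight expressions. -/
inductive GExp where
  | zero
  | read (a : ℕ) (i : Exp)
  | add (g₁ g₂ : GExp)

/-- Tests. -/
inductive Test where
  | le (e₁ e₂ : Exp)
  | gle (g₁ g₂ : GExp)
  | not (b : Test)
  | and (b₁ b₂ : Test)

/-- Programs. -/
inductive Prog where
  | skip
  | write (a : ℕ) (i e : Exp)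
  | gwrite (a : ℕ) (i : Exp) (g : GExp)
  | seq (p₁ p₂ : Prog)
  | ite (b : Test) (p₁ p₂ : Prog)
  | loop (b : Test) (p : Prog)

section Semantics

variable {R : Type}

/-- Value of an integer expression. -/
def Exp.eval (s : State R) : Exp → ℕ
  | .lit c => c
  | .read a i => s.nat a (i.eval s)
  | .add e₁ e₂ => e₁.eval s + e₂.eval s
  | .sub e₁ e₂ => e₁.eval s - e₂.eval s
  | .mul e₁ e₂ => e₁.eval s * e₂.eval s
  | .div e₁ e₂ => e₁.eval s / e₂.eval s

/-- Cost of an integer expression: every value that occurs in its evaluation (literals, indices,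
contents of cells, intermediate results) is charged one plus its bit length. -/
def Exp.cost (s : State R) : Exp → ℕ
  | .lit c => 1 + Nat.size c
  | .read a i => i.cost s + (1 + Nat.size (Exp.eval s (.read a i)))
  | .add e₁ e₂ => e₁.cost s + e₂.cost s + (1 + Nat.size (Exp.eval s (.add e₁ e₂)))
  | .sub e₁ e₂ => e₁.cost s + e₂.cost s + (1 + Nat.size (Exp.eval s (.sub e₁ e₂)))
  | .mul e₁ e₂ => e₁.cost s + e₂.cost s + (1 + Nat.size (Exp.eval s (.mul e₁ e₂)))
  | .div e₁ e₂ => e₁.cost s + e₂.cost s + (1 + Nat.size (Exp.eval s (.div e₁ e₂)))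

/-- Value of a weight expression. -/
def GExp.eval [AddCommGroup R] (s : State R) : GExp → R
  | .zero => 0
  | .read a i => s.grp a (i.eval s)
  | .add g₁ g₂ => g₁.eval s + g₂.eval s

/-- Cost of a weight expression: one per operation, plus the cost of the indices. -/
def GExp.cost (s : State R) : GExp → ℕ
  | .zero => 1
  | .read _ i => i.cost s + 1
  | .add g₁ g₂ => g₁.cost s + g₂.cost s + 1

/-- Truth of a test. -/
def Test.Holds [AddCommGroup R] [LinearOrder R] (s : State R) : Test → Prop
  | .le e₁ e₂ => e₁.eval s ≤ e₂.eval s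
  | .gle g₁ g₂ => g₁.eval s ≤ g₂.eval s
  | .not b => ¬ b.Holds s
  | .and b₁ b₂ => b₁.Holds s ∧ b₂.Holds s

/-- Cost of a test. -/
def Test.cost (s : State R) : Test → ℕ
  | .le e₁ e₂ => e₁.cost s + e₂.cost s + 1
  | .gle g₁ g₂ => g₁.cost s + g₂.cost s + 1
  | .not b => b.cost s + 1
  | .and b₁ b₂ => b₁.cost s + b₂.cost s + 1

/-- Overwrite one integer cell. -/
def State.setNat (s : State R) (a i x : ℕ) : State R :=
  { s with nat := Function.update s.nat a (Function.update (s.nat a) i x) }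

/-- Overwrite one weight cell. -/
def State.setGrp (s : State R) (a i : ℕ) (x : R) : State R :=
  { s with grp := Function.update s.grp a (Function.update (s.grp a) i x) }

/-- `Runs p s s' c`: started in the state `s`, the program `p` halts in the state `s'`
after a computation of cost `c`. -/
inductive Runs [AddCommGroup R] [LinearOrder R] : Prog → State R → State R → ℕ → Prop where
  | skip (s : State R) : Runs .skip s s 1
  | write (s : State R) (a : ℕ) (i e : Exp) :
      Runs (.write a i e) s (s.setNat a (i.eval s) (e.eval s)) (i.cost s + e.cost s + 1)
  | gwrite (s : State R) (a : ℕ) (i : Exp) (g : GExp) :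
      Runs (.gwrite a i g) s (s.setGrp a (i.eval s) (g.eval s)) (i.cost s + g.cost s + 1)
  | seq {p₁ p₂ : Prog} {s s₁ s₂ : State R} {c₁ c₂ : ℕ}
      (h₁ : Runs p₁ s s₁ c₁) (h₂ : Runs p₂ s₁ s₂ c₂) : Runs (.seq p₁ p₂) s s₂ (c₁ + c₂)
  | iteTrue {b : Test} {p₁ p₂ : Prog} {s s₁ : State R} {c : ℕ}
      (hb : b.Holds s) (h : Runs p₁ s s₁ c) : Runs (.ite b p₁ p₂) s s₁ (b.cost s + c + 1)
  | iteFalse {b : Test} {p₁ p₂ : Prog} {s s₁ : State R} {c : ℕ}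
      (hb : ¬ b.Holds s) (h : Runs p₂ s s₁ c) : Runs (.ite b p₁ p₂) s s₁ (b.cost s + c + 1)
  | loopStop {b : Test} {p : Prog} {s : State R}
      (hb : ¬ b.Holds s) : Runs (.loop b p) s s (b.cost s + 1)
  | loopStep {b : Test} {p : Prog} {s s₁ s₂ : State R} {c₁ c₂ : ℕ}
      (hb : b.Holds s) (h₁ : Runs p s s₁ c₁) (h₂ : Runs (.loop b p) s₁ s₂ c₂) :
      Runs (.loop b p) s s₂ (b.cost s + c₁ + c₂ + 1)

end Semantics

/-! ### Positions -/

/-- The four quarters of the set of positions. -/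
inductive Quarter where
  | A | B | C | D

/-- The positions `1, …, n` that belong to a quarter (used for `4 ∣ n`). -/
def Quarter.segment (n : ℕ) : Quarter → Finset ℕ
  | .A => Finset.Icc 1 (n / 4)
  | .B => Finset.Icc (n / 4 + 1) (n / 2)
  | .C => Finset.Icc (n / 2 + 1) (3 * n / 4)
  | .D => Finset.Icc (3 * n / 4 + 1) n

/-- The number by which a quarter is presented to the machine. -/
def Quarter.code : Quarter → ℕ
  | .A => 0
  | .B => 1
  | .C => 2
  | .D => 3

/-- An ordering is a bijection from the jobs to the positions `1, …, n`;
`pos σ v` is the position of the job `v`. -/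
def pos {n : ℕ} (σ : Equiv.Perm (Fin n)) (v : Fin n) : ℕ := (σ v : ℕ) + 1

/-! ### The remaining instance -/

/-- The comparability graph of a strict order. -/
def compGraph {n : ℕ} (r : Fin n → Fin n → Prop) [IsStrictOrder (Fin n) r] :
    SimpleGraph (Fin n) where
  Adj u v := r u v ∨ r v u
  symm := ⟨fun _ _ h => h.symm⟩
  loopless := ⟨fun v h => h.elim (irrefl_of r v) (irrefl_of r v)⟩

/-- A scheduling instance with jobs `Fin n`, together with a maximal matching of its comparability
graph, a guess of the first and of the last job, and a guess of quarters.  The function `quarter`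
is only ever used on the jobs whose quarter is guessed. -/
structure Remaining (R : Type) [AddCommGroup R] [LinearOrder R] (n : ℕ) where
  four_dvd : 4 ∣ n
  /-- the given precedence constraints (`prec₀ u v`: `u` has to be scheduled before `v`) -/
  prec₀ : Fin n → Fin n → Prop
  strict : IsStrictOrder (Fin n) prec₀
  /-- the lengths of the jobs -/
  time : Fin n → R
  time_nonneg : ∀ v, 0 ≤ time v
  time_injective : Function.Injective time
  matching : (compGraph prec₀).Subgraph
  matching_maximal : Maximal SimpleGraph.Subgraph.IsMatching matching
  /-- the guessed first job -/
  first : Fin n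
  /-- the guessed last job -/
  last : Fin n
  first_ne_last : first ≠ last
  first_minimal : ∀ v, ¬ prec₀ v first
  last_maximal : ∀ v, ¬ prec₀ last v
  /-- the guessed quarters -/
  quarter : Fin n → Quarter

namespace Remaining

open Classical

variable {R : Type} [AddCommGroup R] [LinearOrder R] {n : ℕ} (I : Remaining R n)

/-- The strict order in force: the given one, with `first` put before and `last` put after
all other jobs. -/
def prec (u v : Fin n) : Prop :=
  I.prec₀ u v ∨ (u = I.first ∧ v ≠ I.first) ∨ (v = I.last ∧ u ≠ I.last)

/-- The endpoints of the matching, together with the first and the last job. -/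
noncomputable def M : Finset (Fin n) :=
  Finset.univ.filter fun v => v ∈ I.matching.verts ∨ v = I.first ∨ v = I.last

/-- The jobs outside `M`. -/
noncomputable def I₁ : Finset (Fin n) := Finset.univ \ I.M

/-- The elements of `M` that are assigned to the quarter `Γ`. -/
noncomputable def MQ (Γ : Quarter) : Finset (Fin n) := I.M.filter fun w => I.quarter w = Γ

/-- Jobs outside `M` that are forced into the first half. -/
noncomputable def WhalfAB : Finset (Fin n) :=
  I.I₁.filter fun v => ∃ w ∈ I.MQ .A ∪ I.MQ .B, I.prec v w

/-- Jobs outside `M` that are forced into the second half. -/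
noncomputable def WhalfCD : Finset (Fin n) :=
  I.I₁.filter fun v => ∃ w ∈ I.MQ .C ∪ I.MQ .D, I.prec w v

noncomputable def Whalf : Finset (Fin n) := I.WhalfAB ∪ I.WhalfCD

/-- The jobs whose quarter is not guessed. -/
noncomputable def I₂ : Finset (Fin n) := I.I₁ \ I.Whalf

noncomputable def PnotA : Finset (Fin n) := I.I₂.filter fun v => ∃ w ∈ I.MQ .B, I.prec w v

noncomputable def PA : Finset (Fin n) := I.I₂ \ I.PnotA

noncomputable def PnotD : Finset (Fin n) := I.I₂.filter fun v => ∃ w ∈ I.MQ .C, I.prec v w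

noncomputable def PD : Finset (Fin n) := I.I₂ \ I.PnotD

/-- The set paired with the quarter `Γ`; the pairs are
`(A, A)`, `(B, not A)`, `(C, not D)` and `(D, D)`. -/
noncomputable def P : Quarter → Finset (Fin n)
  | .A => I.PA
  | .B => I.PnotA
  | .C => I.PnotD
  | .D => I.PD

/-- Total completion time. -/
noncomputable def cost (σ : Equiv.Perm (Fin n)) : R :=
  ∑ v, ∑ u ∈ Finset.univ.filter (fun u => pos σ u ≤ pos σ v), I.time u

/-- The orderings of the branch: they satisfy the precedence constraints and put every job of
`M` and of `Whalf` into the quarter guessed for it. -/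
def branch : Set (Equiv.Perm (Fin n)) :=
  {σ | (∀ u v, I.prec u v → pos σ u < pos σ v) ∧
    ∀ v ∈ I.M ∪ I.Whalf, pos σ v ∈ (I.quarter v).segment n}

/-- The number of jobs of `P Γ` that `σ` puts into the quarter `Γ`. -/
noncomputable def count (Γ : Quarter) (σ : Equiv.Perm (Fin n)) : ℕ :=
  ((I.P Γ).image (pos σ) ∩ Γ.segment n).card

/-- `σ` has the least total completion time among the orderings in `S`. -/
def IsOptimal (S : Set (Equiv.Perm (Fin n))) (σ : Equiv.Perm (Fin n)) : Prop :=
  σ ∈ S ∧ ∀ τ ∈ S, I.cost σ ≤ I.cost τ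

/-- The initial memory, for a quarter `Γ` and a number `p`.  Integer arrays:
`0` holds `n`, the first job, the last job, the code of `Γ`, and `p`;
`1` is the matrix of the given precedence constraints, by rows;
`2` is the characteristic vector of `M`; `3` holds the guessed quarters.
Weight array `0` holds the lengths of the jobs.  Everything else is zero. -/
noncomputable def input (Γ : Quarter) (p : ℕ) : State R where
  nat a i :=
    if a = 0 then [n, (I.first : ℕ), (I.last : ℕ), Γ.code, p].getD i 0
    else if a = 1 then
      if ∃ u v : Fin n, i = (u : ℕ) * n + (v : ℕ) ∧ I.prec₀ u v then 1 else 0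
    else if a = 2 then if ∃ v ∈ I.M, i = (v : ℕ) then 1 else 0
    else if a = 3 then if h : i < n then (I.quarter ⟨i, h⟩).code else 0
    else 0
  grp a i := if a = 0 then if h : i < n then I.time ⟨i, h⟩ else 0 else 0

end Remaining

/-- How a final memory is read: cell `0` of the integer array `4` is `0` if no ordering was found;
otherwise it is `1`, and the integer array `5` holds the positions of the jobs. -/
def Outputs {R : Type} {n : ℕ} (s : State R) : Option (Equiv.Perm (Fin n)) → Prop
  | none => s.nat 4 0 = 0
  | some σ => s.nat 4 0 = 1 ∧ ∀ v : Fin n, s.nat 5 v = pos σ v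

end Sched

/-! The algorithm is a shortest path computation over prefixes of orderings. Jobs outside `M` are
pairwise incomparable, because the matching is maximal, so every job of `P Γ` has its predecessors
and successors in `M`. For `Γ` equal to `A` or `B` put `h = n/4` or `h = n/2`; under the constraints
of the branch, the jobs of `P Γ` in quarter `Γ` are exactly those at the first `h` positions, and
the predecessors of jobs of `P Γ` also lie there. A state is a prefix set together with the set `E`
of its jobs of `P Γ` at the first `h` positions.

Exchange argument (`adm_of_optimal`): in an optimal ordering let `v` in `P Γ` stand after position
`h`, let `w` be its earliest successor and let `y` in `P Γ` be a later predecessor of `w`. Swapping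
`v` and `y` violates nothing and keeps the count, so `v` must be shorter than `y`. Only prefixes
with the resulting property (`Problem.Adm`) and with `|E| ≤ p` are kept. All prefixes of an optimal
ordering survive (`exists_path_of_optimal`), and every complete path gives a feasible ordering
(`Path.exists_perm`), so the search is exact.

Counting (`card_states_le`): there are at most `2 ^ (n - |P|)` choices for the part of a prefix
outside `P`, and at most `(p + 1) * |P|.choose p` for `E`, since `p < |P|/2`. With both fixed, the
remaining late parts form a set family that shatters only sets of size at most `|M|`: each element
`d` of a shattered set gets a successor `w d` in `M` such that `d` is the shortest element of the
set that precedes `w d`, so `w` is injective. The Sauer–Shelah inequality then bounds the family by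
`(|P| + |M|).choose |M| ≤ n.choose |M|` (`card_fiber_le`).

For `C` and `D` orderings are reversed. The costs of an ordering and of its reversal have a constant
sum, so the same algorithm is run with the weights in the opposite order; on the machine this
exchanges the sides of weight comparisons (`Runs.flip`).

The machine part rests on a small language of terms with bounded sums and products, compiled with
polynomial overhead (`Tm.evaluates`, `Cmd.executes`, `whileProg_runs`). A breadth-first search then
spends polynomial time on each pair of a state and a job. -/

namespace Sched

open Function

/-! ### Costs of runs and polynomial bounds -/

section PowerBounds

variable {L : ℕ}

lemma le_pow_of_two_le (hL : 2 ≤ L) (c : ℕ) : c ≤ L ^ c :=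
  (Nat.lt_two_pow_self (n := c)).le.trans (Nat.pow_le_pow_left hL c)

/-- Since `L ≥ 2`, constant factors and summands can be absorbed into the exponent. Most cost
estimates below end with this lemma. -/
lemma affine_le_pow (hL : 2 ≤ L) {k B : ℕ} (hB : B ≤ L ^ k) (a b : ℕ) :
    a * B + b ≤ L ^ (k + (a + b)) := by
  have h1 : 1 ≤ L ^ k := Nat.one_le_pow _ _ (by omega)
  calc a * B + b ≤ a * L ^ k + b * L ^ k := by gcongr; nlinarith
    _ = (a + b) * L ^ k := by ring
    _ ≤ L ^ (a + b) * L ^ k := by gcongr; exact le_pow_of_two_le hL _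
    _ = L ^ (k + (a + b)) := by ring

lemma le_pow_of_le (hL : 2 ≤ L) {x k l : ℕ} (hx : x ≤ L ^ k) (h : k ≤ l) : x ≤ L ^ l :=
  hx.trans (Nat.pow_le_pow_right (by omega) h)

lemma lt_two_pow_of_le (hL : 2 ≤ L) {x k l : ℕ} (hx : x < 2 ^ L ^ k) (h : k ≤ l) :
    x < 2 ^ L ^ l :=
  hx.trans_le (Nat.pow_le_pow_right (by omega) (Nat.pow_le_pow_right (by omega) h))

lemma size_le_self (x : ℕ) : Nat.size x ≤ x := Nat.size_le.2 Nat.lt_two_pow_self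

end PowerBounds

/-- The measure drops in every round, so there are at most `μ s` rounds; the extra summand pays for
the final failing test. -/
lemma Runs.loop_of_measure {R : Type} [AddCommGroup R] [LinearOrder R] {b : Test} {p : Prog}
    {Inv : State R → Prop} {μ : State R → ℕ} {B C : ℕ} (hb : ∀ s, Inv s → b.cost s ≤ B)
    (hstep : ∀ s, Inv s → b.Holds s →
      ∃ s' c, Runs p s s' c ∧ c ≤ C ∧ Inv s' ∧ μ s' < μ s) (s : State R) (hs : Inv s) :
    ∃ s' c, Runs (.loop b p) s s' c ∧ Inv s' ∧ ¬ b.Holds s' ∧ c ≤ (μ s + 1) * (B + C + 1) := by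
  induction hm : μ s using Nat.strong_induction_on generalizing s with
  | _ m ih =>
    by_cases h : b.Holds s
    · obtain ⟨s₁, c₁, hr, hc, hi, hlt⟩ := hstep s hs h
      obtain ⟨s₂, c₂, hr₂, hi₂, hn, hc₂⟩ := ih (μ s₁) (hm ▸ hlt) s₁ hi rfl
      refine ⟨s₂, _, .loopStep h hr hr₂, hi₂, hn, ?_⟩
      have := hb s hs
      have : (μ s₁ + 1) * (B + C + 1) + (B + C + 1) ≤ (m + 1) * (B + C + 1) := by
        rw [← Nat.succ_mul]; gcongr; omega
      omega
    · refine ⟨s, _, .loopStop h, hs, h, ?_⟩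
      have := hb s hs
      nlinarith [Nat.zero_le (m * (B + C + 1))]

/-! ### Terms with bounded sums and products -/

/-- Binary operations on natural numbers. -/
inductive Op where
  | add | sub | mul | div

def Op.app : Op → ℕ → ℕ → ℕ
  | .add, x, y => x + y
  | .sub, x, y => x - y
  | .mul, x, y => x * y
  | .div, x, y => x / y

def Op.exp : Op → Exp → Exp → Exp
  | .add => .add
  | .sub => .sub
  | .mul => .mul
  | .div => .div

/-- Terms; the range of a bounded sum or product is the number in cell `0` of array `0`. -/
inductive Tm where
  | lit (c : ℕ)
  | var (k : ℕ)
  | read (a : ℕ) (e : Tm)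
  | op (o : Op) (e₁ e₂ : Tm)
  | le (e₁ e₂ : Tm)
  | gle (a : ℕ) (e₁ : Tm) (b : ℕ) (e₂ : Tm)
  | sum (k : ℕ) (e : Tm)
  | prod (k : ℕ) (e : Tm)
  | letv (k : ℕ) (e₁ e₂ : Tm)

/-- The arrays `6` and `7` are reserved for the evaluation of terms. -/
def enc (a : ℕ) : ℕ := if a < 6 then a else a + 2

lemma enc_ne_six (a : ℕ) : enc a ≠ 6 := by unfold enc; split <;> omega

lemma enc_ne_seven (a : ℕ) : enc a ≠ 7 := by unfold enc; split <;> omega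

lemma enc_injective : Function.Injective enc := by
  intro a b h; unfold enc at h; split at h <;> split at h <;> omega

section Semantics

variable {R : Type}

/-- The part of the memory that is visible to terms. -/
def State.view (s : State R) : State R := ⟨fun a => s.nat (enc a), s.grp⟩

@[simp] lemma State.view_nat (s : State R) (a : ℕ) : s.view.nat a = s.nat (enc a) := rfl

@[simp] lemma State.view_grp (s : State R) : s.view.grp = s.grp := rfl

lemma State.setNat_nat (s : State R) (a i x b j : ℕ) :
    (s.setNat a i x).nat b j = if b = a ∧ j = i then x else s.nat b j := by
  simp only [State.setNat, update_apply]
  by_cases h : b = a <;> by_cases h' : j = i <;> simp [h, h']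

@[simp] lemma State.setNat_grp (s : State R) (a i x : ℕ) : (s.setNat a i x).grp = s.grp := rfl

lemma State.setNat_nat_of_ne (s : State R) (a i x : ℕ) {b : ℕ} (h : b ≠ a) :
    (s.setNat a i x).nat b = s.nat b := by
  simp [State.setNat, h]

lemma State.setGrp_grp (s : State R) (a i : ℕ) (x : R) (b j : ℕ) :
    (s.setGrp a i x).grp b j = if b = a ∧ j = i then x else s.grp b j := by
  simp only [State.setGrp, update_apply]
  by_cases h : b = a <;> by_cases h' : j = i <;> simp [h, h']

@[simp] lemma State.setGrp_nat (s : State R) (a i : ℕ) (x : R) : (s.setGrp a i x).nat = s.nat := rfl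

variable [LinearOrder R]

def Tm.eval (s : State R) : Tm → (ℕ → ℕ) → ℕ
  | .lit c, _ => c
  | .var k, ρ => ρ k
  | .read a e, ρ => s.nat a (e.eval s ρ)
  | .op o e₁ e₂, ρ => o.app (e₁.eval s ρ) (e₂.eval s ρ)
  | .le e₁ e₂, ρ => if e₁.eval s ρ ≤ e₂.eval s ρ then 1 else 0
  | .gle a e₁ b e₂, ρ => if s.grp a (e₁.eval s ρ) ≤ s.grp b (e₂.eval s ρ) then 1 else 0
  | .sum k e, ρ => ∑ i ∈ Finset.range (s.nat 0 0), e.eval s (update ρ k i)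
  | .prod k e, ρ => ∏ i ∈ Finset.range (s.nat 0 0), e.eval s (update ρ k i)
  | .letv k e₁ e₂, ρ => e₂.eval s (update ρ k (e₁.eval s ρ))

/-- The sizes of the visible data are bounded by `L`. -/
def State.Bounded (L : ℕ) (s : State R) : Prop :=
  s.nat 0 0 ≤ L ∧ ∀ a i, s.nat a i < 2 ^ L

omit [LinearOrder R] in
lemma State.Bounded.mono {L L' : ℕ} {s : State R} (h : s.Bounded L) (hL : L ≤ L') :
    s.Bounded L' :=
  ⟨h.1.trans hL, fun a i => (h.2 a i).trans_le (Nat.pow_le_pow_right (by omega) hL)⟩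

lemma Op.app_lt (o : Op) {x y A : ℕ} (hA : 1 ≤ A) (hx : x < 2 ^ A) (hy : y < 2 ^ A) :
    o.app x y < 2 ^ (2 * A) := by
  have h1 : 2 ^ (2 * A) = 2 ^ A * 2 ^ A := by rw [two_mul, pow_add]
  have h2 : 2 ≤ 2 ^ A := Nat.le_self_pow (by omega) 2
  rw [h1]
  cases o <;> simp only [Op.app]
  · nlinarith
  · have := Nat.sub_le x y; nlinarith
  · exact Nat.mul_lt_mul'' hx hy
  · have := Nat.div_le_self x y; nlinarith

/-- Values of a term have polynomially bounded bit length. -/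
lemma Tm.eval_lt (e : Tm) : ∃ k, 1 ≤ k ∧ ∀ {R : Type} [LinearOrder R] (L : ℕ), 2 ≤ L →
    ∀ (s : State R) (ρ : ℕ → ℕ), s.Bounded L → (∀ j, ρ j < 2 ^ L) → e.eval s ρ < 2 ^ L ^ k := by
  induction e with
  | lit c =>
    refine ⟨c + 1, by omega, fun L hL s ρ _ _ => ?_⟩
    exact (Nat.lt_two_pow_self (n := c)).trans_le
      (Nat.pow_le_pow_right (by omega) ((le_pow_of_two_le hL c).trans
        (Nat.pow_le_pow_right (by omega) (by omega))))
  | var k => exact ⟨1, le_rfl, fun L hL s ρ _ h => by simpa [Tm.eval] using h k⟩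
  | read a e _ => exact ⟨1, le_rfl, fun L hL s ρ h _ => by simpa [Tm.eval] using h.2 _ _⟩
  | op o e₁ e₂ ih₁ ih₂ =>
    obtain ⟨k₁, hk₁, h₁⟩ := ih₁
    obtain ⟨k₂, hk₂, h₂⟩ := ih₂
    refine ⟨k₁ + k₂ + 1, by omega, fun L hL s ρ hs hρ => ?_⟩
    have a₁ := lt_two_pow_of_le hL (h₁ L hL s ρ hs hρ) (by omega : k₁ ≤ k₁ + k₂)
    have a₂ := lt_two_pow_of_le hL (h₂ L hL s ρ hs hρ) (by omega : k₂ ≤ k₁ + k₂)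
    refine (o.app_lt (Nat.one_le_pow _ _ (by omega)) a₁ a₂).trans_le
      (Nat.pow_le_pow_right (by omega) ?_)
    rw [pow_succ, mul_comm]; gcongr
  | le e₁ e₂ _ _ =>
    refine ⟨1, le_rfl, fun L hL s ρ _ _ => ?_⟩
    have : 1 < 2 ^ L ^ 1 := Nat.one_lt_two_pow (by simp; omega)
    simp only [Tm.eval]; split <;> omega
  | gle a e₁ b e₂ _ _ =>
    refine ⟨1, le_rfl, fun L hL s ρ _ _ => ?_⟩
    have : 1 < 2 ^ L ^ 1 := Nat.one_lt_two_pow (by simp; omega)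
    simp only [Tm.eval]; split <;> omega
  | sum k e ih =>
    obtain ⟨k₁, hk₁, h₁⟩ := ih
    refine ⟨k₁ + 1, by omega, fun L hL s ρ hs hρ => ?_⟩
    have hi : ∀ i ∈ Finset.range (s.nat 0 0), e.eval s (update ρ k i) ≤ 2 ^ L ^ k₁ := by
      intro i hi
      refine (h₁ L hL s _ hs fun j => ?_).le
      rw [update_apply]; split
      · exact (Finset.mem_range.1 hi).trans_le (hs.1.trans Nat.lt_two_pow_self.le)
      · exact hρ j
    have hL1 : L ≤ L ^ k₁ := Nat.le_self_pow (by omega) L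
    calc _ ≤ s.nat 0 0 * 2 ^ L ^ k₁ := by
          simpa [Tm.eval] using Finset.sum_le_card_nsmul _ _ _ hi
      _ < 2 ^ L * 2 ^ L ^ k₁ := by
          gcongr; exact hs.1.trans_lt Nat.lt_two_pow_self
      _ ≤ 2 ^ L ^ (k₁ + 1) := by
          rw [← pow_add]; gcongr
          · omega
          · rw [pow_succ]; nlinarith
  | prod k e ih =>
    obtain ⟨k₁, hk₁, h₁⟩ := ih
    refine ⟨k₁ + 2, by omega, fun L hL s ρ hs hρ => ?_⟩
    have hi : ∀ i ∈ Finset.range (s.nat 0 0), e.eval s (update ρ k i) ≤ 2 ^ L ^ k₁ := by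
      intro i hi
      refine (h₁ L hL s _ hs fun j => ?_).le
      rw [update_apply]; split
      · exact (Finset.mem_range.1 hi).trans_le (hs.1.trans Nat.lt_two_pow_self.le)
      · exact hρ j
    calc _ ≤ (2 ^ L ^ k₁) ^ s.nat 0 0 := by
          simpa [Tm.eval] using Finset.prod_le_pow_card _ _ _ hi
      _ ≤ 2 ^ (L ^ k₁ * L) := by
          rw [← pow_mul]; gcongr
          · omega
          · exact hs.1
      _ < 2 ^ L ^ (k₁ + 2) := by
          refine Nat.pow_lt_pow_right (by omega) ?_
          rw [← pow_succ]; exact Nat.pow_lt_pow_right (by omega) (by omega)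
  | letv k e₁ e₂ ih₁ ih₂ =>
    obtain ⟨k₁, hk₁, h₁⟩ := ih₁
    obtain ⟨k₂, hk₂, h₂⟩ := ih₂
    -- The bound variable may receive a value of `L ^ k₁` bits, so the bound for `e₂` is applied
    -- with `L ^ k₁` in place of `L`, and the exponents multiply.
    refine ⟨k₁ * k₂, Nat.mul_pos hk₁ hk₂, fun L hL s ρ hs hρ => ?_⟩
    have hL1 : L ≤ L ^ k₁ := Nat.le_self_pow (by omega) L
    rw [pow_mul]
    refine h₂ (L ^ k₁) (by omega) s _ (hs.mono hL1) fun j => ?_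
    rw [update_apply]; split
    · exact h₁ L hL s ρ hs hρ
    · exact (hρ j).trans_le (Nat.pow_le_pow_right (by omega) hL1)

end Semantics

end Sched

/-! ### Compilation of terms into programs -/

namespace Sched

open Function

/-- Stack cell `d`. -/
abbrev slot (d : ℕ) : Exp := .read 6 (.lit d)

/-- A program that leaves the value of a term in stack cell `d` and preserves everything
outside the stack and the lower cells of the stack. -/
def Tm.compile : Tm → ℕ → Prog
  | .lit c, d => .write 6 (.lit d) (.lit c)
  | .var k, d => .write 6 (.lit d) (.read 7 (.lit k))
  | .read a e, d => .seq (e.compile d) (.write 6 (.lit d) (.read (enc a) (slot d)))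
  | .op o e₁ e₂, d => .seq (e₁.compile d) (.seq (e₂.compile (d + 1))
      (.write 6 (.lit d) (o.exp (slot d) (slot (d + 1)))))
  | .le e₁ e₂, d => .seq (e₁.compile d) (.seq (e₂.compile (d + 1))
      (.ite (.le (slot d) (slot (d + 1))) (.write 6 (.lit d) (.lit 1)) (.write 6 (.lit d) (.lit 0))))
  | .gle a e₁ b e₂, d => .seq (e₁.compile d) (.seq (e₂.compile (d + 1))
      (.ite (.gle (.read a (slot d)) (.read b (slot (d + 1))))
        (.write 6 (.lit d) (.lit 1)) (.write 6 (.lit d) (.lit 0))))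
  | .sum k e, d => big .add 0 k (e.compile (d + 3)) d
  | .prod k e, d => big .mul 1 k (e.compile (d + 3)) d
  | .letv k e₁ e₂, d => .seq (e₁.compile d) (.seq (.write 6 (.lit (d + 1)) (.read 7 (.lit k)))
      (.seq (.write 7 (.lit k) (slot d)) (.seq (e₂.compile (d + 2))
        (.seq (.write 7 (.lit k) (slot (d + 1))) (.write 6 (.lit d) (slot (d + 2)))))))
where
  /-- Accumulate the values found in cell `d + 3` while variable `k` runs through its range. -/
  big (o : Op) (init k : ℕ) (p : Prog) (d : ℕ) : Prog :=
    -- Cell `d` accumulates, cell `d + 1` counts the rounds, and cell `d + 2` keeps the outer value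
    -- of variable `k`, which is restored at the end.
    .seq (.write 6 (.lit d) (.lit init)) (.seq (.write 6 (.lit (d + 1)) (.lit 0))
      (.seq (.write 6 (.lit (d + 2)) (.read 7 (.lit k)))
        (.seq (.loop (.not (.le (.read 0 (.lit 0)) (slot (d + 1))))
            (.seq (.write 7 (.lit k) (slot (d + 1))) (.seq p
              (.seq (.write 6 (.lit d) (o.exp (slot d) (slot (d + 3))))
                (.write 6 (.lit (d + 1)) (.add (slot (d + 1)) (.lit 1)))))))
          (.write 7 (.lit k) (slot (d + 2))))))

section Compile

variable {R : Type}

/-- Two memories agree outside the stack cells `≥ d`. -/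
def State.Agree (d : ℕ) (s s' : State R) : Prop :=
  s'.grp = s.grp ∧ (∀ a ≠ 6, s'.nat a = s.nat a) ∧ ∀ j < d, s'.nat 6 j = s.nat 6 j

lemma State.Agree.trans {d : ℕ} {s s' s'' : State R} (h : s.Agree d s') (h' : s'.Agree d s'') :
    s.Agree d s'' :=
  ⟨h'.1.trans h.1, fun a ha => (h'.2.1 a ha).trans (h.2.1 a ha),
    fun j hj => (h'.2.2 j hj).trans (h.2.2 j hj)⟩

lemma State.Agree.mono {d d' : ℕ} {s s' : State R} (h : s.Agree d' s') (hd : d ≤ d') :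
    s.Agree d s' :=
  ⟨h.1, h.2.1, fun j hj => h.2.2 j (hj.trans_le hd)⟩

lemma State.agree_setNat (s : State R) {d j : ℕ} (x : ℕ) (hj : d ≤ j) :
    s.Agree d (s.setNat 6 j x) := by
  refine ⟨rfl, fun a ha => s.setNat_nat_of_ne _ _ _ ha, fun i hi => ?_⟩
  rw [State.setNat_nat, if_neg (by omega)]

lemma State.Agree.view {d : ℕ} {s s' : State R} (h : s.Agree d s') : s'.view = s.view := by
  simp only [State.view, h.1, h.2.1 _ (enc_ne_six _)]

lemma State.view_setNat_seven (s : State R) (j x : ℕ) : (s.setNat 7 j x).view = s.view := by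
  simp only [State.view, State.setNat_nat_of_ne _ _ _ _ (enc_ne_seven _), State.setNat_grp]

/-- The sizes of all data outside the stack are bounded by `L`. -/
def State.Tame (L : ℕ) (s : State R) : Prop := s.view.Bounded L ∧ ∀ j, s.nat 7 j < 2 ^ L

lemma State.Tame.mono {L L' : ℕ} {s : State R} (h : s.Tame L) (hL : L ≤ L') : s.Tame L' :=
  ⟨h.1.mono hL, fun j => (h.2 j).trans_le (Nat.pow_le_pow_right (by omega) hL)⟩

lemma State.Tame.of_agree {L d : ℕ} {s s' : State R} (h : s.Tame L) (ha : s.Agree d s') :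
    s'.Tame L := by
  rw [State.Tame, ha.view, ha.2.1 7 (by omega)]; exact h

lemma State.Tame.set {L : ℕ} {s : State R} (h : s.Tame L) (k : ℕ) {x : ℕ} (hx : x < 2 ^ L) :
    (s.setNat 7 k x).Tame L := by
  refine ⟨by rw [State.view_setNat_seven]; exact h.1, fun j => ?_⟩
  rw [State.setNat_nat]; split
  · exact hx
  · exact h.2 j

lemma Op.exp_eval (o : Op) (e₁ e₂ : Exp) (s : State R) :
    (o.exp e₁ e₂).eval s = o.app (e₁.eval s) (e₂.eval s) := by
  cases o <;> rfl

lemma Op.exp_cost (o : Op) (e₁ e₂ : Exp) (s : State R) :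
    (o.exp e₁ e₂).cost s = e₁.cost s + e₂.cost s +
      (1 + Nat.size (o.app (e₁.eval s) (e₂.eval s))) := by
  cases o <;> rfl

variable [AddCommGroup R] [LinearOrder R]

/-- The specification of `Tm.compile`. -/
def Tm.Evaluates (e : Tm) (d k : ℕ) : Prop :=
  ∀ {R : Type} [AddCommGroup R] [LinearOrder R] (L : ℕ), 2 ≤ L → ∀ s : State R, s.Tame L → ∃ s' c, Runs (e.compile d) s s' c ∧ c ≤ L ^ k ∧
    s.Agree d s' ∧ s'.nat 6 d = e.eval s.view (s.nat 7)

lemma Tm.Evaluates.mono {e : Tm} {d k k' : ℕ} (h : e.Evaluates d k) (hk : k ≤ k') :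
    e.Evaluates d k' := fun L hL s hs => by
  obtain ⟨s', c, h₁, h₂, h₃⟩ := h L hL s hs
  exact ⟨s', c, h₁, le_pow_of_le hL h₂ hk, h₃⟩

lemma size_le_pow {L k x : ℕ} (h : x < 2 ^ L ^ k) : Nat.size x ≤ L ^ k := Nat.size_le.2 h

/-- Two terms evaluated one after the other. -/
lemma Tm.Evaluates.pair {e₁ e₂ : Tm} {d k : ℕ} (h₁ : e₁.Evaluates d k)
    (h₂ : e₂.Evaluates (d + 1) k) {L : ℕ} (hL : 2 ≤ L) {s : State R} (hs : s.Tame L) :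
    ∃ s₁ s₂ c₁ c₂, Runs (e₁.compile d) s s₁ c₁ ∧ Runs (e₂.compile (d + 1)) s₁ s₂ c₂ ∧
      c₁ ≤ L ^ k ∧ c₂ ≤ L ^ k ∧ s.Agree d s₂ ∧ s₂.nat 6 d = e₁.eval s.view (s.nat 7) ∧
      s₂.nat 6 (d + 1) = e₂.eval s.view (s.nat 7) := by
  obtain ⟨s₁, c₁, r₁, b₁, a₁, v₁⟩ := h₁ L hL s hs
  obtain ⟨s₂, c₂, r₂, b₂, a₂, v₂⟩ := h₂ L hL s₁ (hs.of_agree a₁)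
  refine ⟨s₁, s₂, c₁, c₂, r₁, r₂, b₁, b₂, a₁.trans (a₂.mono (by omega)), ?_, ?_⟩
  · rw [a₂.2.2 d (by omega), v₁]
  · rw [v₂, a₁.view, a₁.2.1 7 (by omega)]

/-- The exponent in the time bound for a bounded sum or product. -/
def Tm.bigExponent (k d k₁ k₂ : ℕ) : ℕ :=
  k₁ + k₂ + 1 + (1 + 1) + (k₁ + k₂ + 1 + (17 + (11 * d + k + 101))) + (k₁ + k₂ + 1) +
    (10 + (10 * d + 10 * k + 100))

/-- Sums and products are treated at once: `f i s` is the partial result after `i` rounds. Its bit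
length has to be controlled for every `i` in the range, because all intermediate values are charged.
-/
lemma Tm.evaluates_big (o : Op) (init k d k₁ k₂ : ℕ) (e : Tm) (f : ℕ → State R → ℕ)
    (hi : init ≤ 1)
    (he : e.Evaluates (d + 3) k₁)
    (h0 : ∀ s, f 0 s = init)
    (hf : ∀ i s, f (i + 1) s = o.app (f i s) (e.eval s.view (update (s.nat 7) k i)))
    (hk : ∀ L, 2 ≤ L → ∀ s : State R, s.Tame L → ∀ i ≤ s.nat 0 0, f i s < 2 ^ L ^ k₂)
    (hk' : ∀ L, 2 ≤ L → ∀ s : State R, s.Tame L → e.eval s.view (s.nat 7) < 2 ^ L ^ k₂) :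
    ∀ L, 2 ≤ L → ∀ s : State R, s.Tame L →
      ∃ s' c, Runs (Tm.compile.big o init k (e.compile (d + 3)) d) s s' c ∧
        c ≤ L ^ Tm.bigExponent k d k₁ k₂ ∧ s.Agree d s' ∧ s'.nat 6 d = f (s.nat 0 0) s := by
  intro L hL s hs
  set s₁ := s.setNat 6 d init with hs₁
  set s₂ := s₁.setNat 6 (d + 1) 0 with hs₂
  set s₃ := s₂.setNat 6 (d + 2) (s.nat 7 k) with hs₃
  have r₁ : Runs (.write 6 (.lit d) (.lit init)) s s₁ _ := .write _ _ _ _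
  have r₂ : Runs (.write 6 (.lit (d + 1)) (.lit 0)) s₁ s₂ _ := .write _ _ _ _
  have r₃ : Runs (.write 6 (.lit (d + 2)) (.read 7 (.lit k))) s₂ s₃ _ := .write _ _ _ _
  have hn : s.nat 0 0 ≤ L := hs.1.1
  set N := s.nat 0 0 with hN
  -- The loop may change only variable `k` and the stack from cell `d` on; cell `d` always holds the
  -- partial result that belongs to the counter in cell `d + 1`.
  let Inv : State R → Prop := fun t => t.grp = s.grp ∧ (∀ a, a ≠ 6 → a ≠ 7 → t.nat a = s.nat a) ∧
    (∀ j, j ≠ k → t.nat 7 j = s.nat 7 j) ∧ t.nat 7 k < 2 ^ L ∧ (∀ j < d, t.nat 6 j = s.nat 6 j) ∧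
    t.nat 6 (d + 2) = s.nat 7 k ∧ t.nat 6 (d + 1) ≤ N ∧ t.nat 6 d = f (t.nat 6 (d + 1)) s
  have hinv : Inv s₃ := by
    refine ⟨rfl, fun a h _ => ?_, fun j _ => ?_, ?_, fun j hj => ?_, ?_, ?_, ?_⟩
    · simp [hs₃, hs₂, hs₁, State.setNat_nat_of_ne _ _ _ _ h]
    · simp [hs₃, hs₂, hs₁, State.setNat_nat]
    · simpa [hs₃, hs₂, hs₁, State.setNat_nat] using hs.2 k
    · simp only [hs₃, hs₂, hs₁, State.setNat_nat]
      rw [if_neg (by omega), if_neg (by omega), if_neg (by omega)]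
    · simp [hs₃, State.setNat_nat]
    · simp [hs₃, hs₂, hs₁, State.setNat_nat]
    · simp [hs₃, hs₂, hs₁, State.setNat_nat, h0]
  have hsz : ∀ {t : State R}, Inv t → Nat.size (t.nat 6 (d + 1)) ≤ L := fun h =>
    (size_le_self _).trans (h.2.2.2.2.2.2.1.trans hn)
  have hszN : Nat.size N ≤ L := (size_le_self _).trans hn
  have hview : ∀ {t : State R}, Inv t → t.view = s.view := fun h => by
    simp only [State.view, h.1, h.2.1 _ (enc_ne_six _) (enc_ne_seven _)]
  have hsd : ∀ j ≤ 3, Nat.size (d + j) ≤ d + 3 := fun j hj => (size_le_self _).trans (by omega)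
  have hsd0 : Nat.size d ≤ d + 3 := hsd 0 (by omega)
  obtain ⟨s₄, c₄, r₄, i₄, n₄, b₄⟩ := Runs.loop_of_measure (Inv := Inv)
    (b := .not (.le (.read 0 (.lit 0)) (slot (d + 1))))
    (p := .seq (.write 7 (.lit k) (slot (d + 1))) (.seq (e.compile (d + 3))
      (.seq (.write 6 (.lit d) (o.exp (slot d) (slot (d + 3))))
        (.write 6 (.lit (d + 1)) (.add (slot (d + 1)) (.lit 1))))))
    (μ := fun t => N - t.nat 6 (d + 1)) (B := 2 * L + d + 20)
    (C := L ^ k₁ + 4 * L ^ k₂ + 10 * L + 10 * d + k + 80) (by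
      intro t ht
      have := hsz ht
      have := hsd 1 (by omega)
      simp only [Test.cost, Exp.cost, Exp.eval, ht.2.1 0 (by omega) (by omega), ← hN]
      simp only [Nat.size_zero]
      omega) (by
      intro t ht hb
      have hb' : t.nat 6 (d + 1) < N := by
        simpa [Test.Holds, Exp.eval, ht.2.1 0 (by omega) (by omega), ← hN] using hb
      set i := t.nat 6 (d + 1) with hi
      set t₁ := t.setNat 7 k i with ht₁
      have q₁ : Runs (.write 7 (.lit k) (slot (d + 1))) t t₁ _ := .write _ _ _ _
      have htame : t₁.Tame L := by
        refine ⟨by rw [ht₁, State.view_setNat_seven, hview ht]; exact hs.1, fun j => ?_⟩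
        rw [ht₁, State.setNat_nat]
        by_cases hj : j = k
        · simp only [hj, and_self, if_true]
          exact (hb'.trans_le hn).trans Nat.lt_two_pow_self
        · rw [if_neg (by tauto), ht.2.2.1 j hj]; exact hs.2 j
      obtain ⟨t₂, c₂, q₂, b₂, a₂, v₂⟩ := he L hL t₁ htame
      have hρ : t₁.nat 7 = update (s.nat 7) k i := by
        funext j
        rw [ht₁, State.setNat_nat, update_apply]
        by_cases hj : j = k
        · simp [hj]
        · simp [hj, ht.2.2.1 j hj]
      have v₂b := hk' L hL t₁ htame
      have hv₁ : t₁.view = s.view := by rw [ht₁, State.view_setNat_seven, hview ht]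
      rw [← v₂] at v₂b
      rw [hv₁, hρ] at v₂
      have e₁ : ∀ j ≤ d + 2, t₂.nat 6 j = t.nat 6 j := fun j hj => by
        rw [a₂.2.2 j (by omega), ht₁, State.setNat_nat_of_ne _ _ _ _ (by omega)]
      have fi : t.nat 6 d = f i s := ht.2.2.2.2.2.2.2
      have fi1 : o.app (t₂.nat 6 d) (t₂.nat 6 (d + 3)) = f (i + 1) s := by
        rw [e₁ d (by omega), fi, v₂, hf]
      set t₃ := t₂.setNat 6 d (f (i + 1) s) with ht₃
      have q₃ := Runs.write t₂ 6 (.lit d) (o.exp (slot d) (slot (d + 3)))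
      rw [Op.exp_eval] at q₃
      simp only [Exp.eval, fi1] at q₃
      have hi3 : t₃.nat 6 (d + 1) = i := by
        rw [ht₃, State.setNat_nat, if_neg (by omega), e₁ _ (by omega)]
      have q₄ := Runs.write t₃ 6 (.lit (d + 1)) (.add (slot (d + 1)) (.lit 1))
      simp only [Exp.eval, hi3] at q₄
      refine ⟨_, _, .seq q₁ (.seq q₂ (.seq q₃ q₄)), ?_, ?_, ?_⟩
      · have g₁ := hsz ht
        have g₂ := size_le_pow (hk L hL s hs i (by omega))
        have g₃ := size_le_pow (hk L hL s hs (i + 1) (by omega))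
        have g₄ := size_le_pow v₂b
        have g₅ : Nat.size (i + 1) ≤ L := (size_le_self _).trans (by omega)
        have g₆ := size_le_self k
        have := hsd 1 (by omega)
        have := hsd 3 (by omega)
        rw [e₁ d (by omega), fi] at fi1
        simp only [Exp.cost, Op.exp_cost, Exp.eval, e₁ d (by omega), fi, hi3, ← hi,
          Nat.size_one, fi1]
        rw [← hi] at g₁
        omega
      · have hag : t₁.Agree d (t₃.setNat 6 (d + 1) (i + 1)) :=
          (a₂.mono (by omega)).trans ((State.agree_setNat _ _ le_rfl).trans
            (State.agree_setNat _ _ (by omega)))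
        refine ⟨hag.1.trans ht.1, fun a h h' => ?_, fun j hj => ?_, ?_, fun j hj => ?_, ?_, ?_, ?_⟩
        · rw [hag.2.1 a h, ht₁, State.setNat_nat_of_ne _ _ _ _ h', ht.2.1 a h h']
        · rw [hag.2.1 7 (by omega), hρ, update_of_ne hj]
        · rw [hag.2.1 7 (by omega)]; exact htame.2 k
        · rw [hag.2.2 j hj, ht₁, State.setNat_nat_of_ne _ _ _ _ (by omega),
            ht.2.2.2.2.1 j hj]
        · rw [State.setNat_nat, if_neg (by omega), ht₃, State.setNat_nat, if_neg (by omega),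
            e₁ _ le_rfl, ht.2.2.2.2.2.1]
        · simp [State.setNat_nat]; omega
        · simp [State.setNat_nat, ht₃]
      · simp [State.setNat_nat]; omega) s₃ hinv
  have hend : s₄.nat 6 (d + 1) = N := by
    have := i₄.2.2.2.2.2.2.1
    simp [Test.Holds, Exp.eval, i₄.2.1 0 (by omega) (by omega), ← hN] at n₄
    omega
  have r₅ := Runs.write s₄ 7 (.lit k) (slot (d + 2))
  simp only [Exp.eval, i₄.2.2.2.2.2.1] at r₅
  refine ⟨_, _, .seq r₁ (.seq r₂ (.seq r₃ (.seq r₄ r₅))), ?_, ⟨i₄.1, fun a ha => ?_,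
    fun j hj => ?_⟩, ?_⟩
  · have g₁ := size_le_self k
    have g₂ : Nat.size (s.nat 7 k) ≤ L := Nat.size_le.2 (hs.2 k)
    have g₃ : Nat.size init ≤ 1 := (size_le_self _).trans hi
    have e₇ : s₂.nat 7 k = s.nat 7 k := rfl
    have := hsd 1 (by omega)
    have := hsd 2 (by omega)
    -- A common power `B` majorizes `L`, `L ^ k₁` and `L ^ k₂`, so the loop costs at most a product
    -- of two affine functions of `B`: number of rounds times cost of a round.
    have hB : L ≤ L ^ (k₁ + k₂ + 1) := le_pow_of_le hL (by simp : L ≤ L ^ 1) (by omega)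
    have hB₁ : L ^ k₁ ≤ L ^ (k₁ + k₂ + 1) := le_pow_of_le hL le_rfl (by omega)
    have hB₂ : L ^ k₂ ≤ L ^ (k₁ + k₂ + 1) := le_pow_of_le hL le_rfl (by omega)
    set B := L ^ (k₁ + k₂ + 1) with hBdef
    have hb4 : c₄ ≤ (B + 1) * (17 * B + 11 * d + k + 101) :=
      b₄.trans (Nat.mul_le_mul (by omega) (by omega))
    have hb5 : c₄ ≤ (1 * B + 1) * (17 * B + (11 * d + k + 101)) := by simpa [add_assoc] using hb4
    have hp := hb5.trans ((Nat.mul_le_mul (affine_le_pow hL hBdef.le 1 1)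
      (affine_le_pow hL hBdef.le 17 (11 * d + k + 101))).trans_eq (pow_add _ _ _).symm)
    have hm := max_le (α := ℕ) (le_pow_of_le hL hp (Nat.le_add_right _ (k₁ + k₂ + 1)))
      (le_pow_of_le hL hBdef.le (Nat.le_add_left _ _))
    refine le_trans ?_ (affine_le_pow hL hm 10 (10 * d + 10 * k + 100))
    simp only [Exp.cost, Exp.eval, e₇, i₄.2.2.2.2.2.1, Nat.size_zero]
    have := le_max_left c₄ B
    have := le_max_right c₄ B
    omega
  · by_cases h7 : a = 7
    · subst h7
      funext j
      rw [State.setNat_nat]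
      by_cases hj : j = k
      · simp [hj]
      · rw [if_neg (by tauto), i₄.2.2.1 j hj]
    · rw [State.setNat_nat_of_ne _ _ _ _ h7, i₄.2.1 a ha h7]
  · rw [State.setNat_nat_of_ne _ _ _ _ (by omega), i₄.2.2.2.2.1 j hj]
  · rw [State.setNat_nat_of_ne _ _ _ _ (by omega), i₄.2.2.2.2.2.2.2, hend]

/-- Terms are evaluated in polynomial time. -/
theorem Tm.evaluates (e : Tm) : ∀ d, ∃ k, e.Evaluates d k := by
  induction e with
  | lit c =>
    refine fun d => ⟨0 + (0 + (d + c + 3)), fun L hL s hs => ⟨_, _, .write _ _ _ _, ?_,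
      s.agree_setNat _ le_rfl, by simp [State.setNat_nat, Exp.eval, Tm.eval]⟩⟩
    refine le_trans ?_ (affine_le_pow hL (B := 0) (Nat.zero_le _) 0 (d + c + 3))
    have := size_le_self d
    have := size_le_self c
    simp only [Exp.cost]; omega
  | var k =>
    refine fun d => ⟨1 + (1 + (d + k + 4)), fun L hL s hs => ⟨_, _, .write _ _ _ _, ?_,
      s.agree_setNat _ le_rfl, by simp [State.setNat_nat, Exp.eval, Tm.eval]⟩⟩
    refine le_trans ?_ (affine_le_pow hL (B := L) (by simp) 1 (d + k + 4))
    have := size_le_self d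
    have := size_le_self k
    have : Nat.size (s.nat 7 k) ≤ L := Nat.size_le.2 (hs.2 k)
    simp only [Exp.cost, Exp.eval]; omega
  | read a e ih =>
    intro d
    obtain ⟨k₁, h₁⟩ := ih d
    obtain ⟨k₂, -, h₂⟩ := e.eval_lt
    refine ⟨k₁ + k₂ + 1 + (3 + (2 * d + 10)), fun L hL s hs => ?_⟩
    obtain ⟨s₁, c₁, r₁, b₁, a₁, v₁⟩ := h₁ L hL s hs
    refine ⟨_, _, .seq r₁ (.write _ _ _ _), ?_, a₁.trans (s₁.agree_setNat _ le_rfl), ?_⟩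
    · refine le_trans ?_ (affine_le_pow hL (B := L ^ (k₁ + k₂ + 1)) le_rfl 3 (2 * d + 10))
      have g₁ := le_pow_of_le hL b₁ (by omega : k₁ ≤ k₁ + k₂ + 1)
      have g₂ := size_le_pow (lt_two_pow_of_le hL (h₂ L hL s.view (s.nat 7) hs.1 hs.2)
        (by omega : k₂ ≤ k₁ + k₂ + 1))
      have g₃ : L ≤ L ^ (k₁ + k₂ + 1) := le_pow_of_le hL (by simp : L ≤ L ^ 1) (by omega)
      have g₄ : Nat.size (s.nat (enc a) (e.eval s.view (s.nat 7))) ≤ L :=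
        Nat.size_le.2 (hs.1.2 _ _)
      have := size_le_self d
      simp only [Exp.cost, Exp.eval, v₁, a₁.2.1 _ (enc_ne_six a)]
      omega
    · simp [State.setNat_nat, Exp.eval, v₁, a₁.2.1 _ (enc_ne_six a), Tm.eval]
  | op o e₁ e₂ ih₁ ih₂ =>
    intro d
    obtain ⟨k₁, h₁⟩ := ih₁ d
    obtain ⟨k₂, h₂⟩ := ih₂ (d + 1)
    obtain ⟨l₁, -, g₁⟩ := e₁.eval_lt
    obtain ⟨l₂, -, g₂⟩ := e₂.eval_lt
    obtain ⟨l₃, -, g₃⟩ := (Tm.op o e₁ e₂).eval_lt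
    set K := k₁ + k₂ + l₁ + l₂ + l₃ with hK
    refine ⟨K + (5 + (3 * d + 15)), fun L hL s hs => ?_⟩
    obtain ⟨s₁, s₂, c₁, c₂, r₁, r₂, b₁, b₂, a, v₁, v₂⟩ :=
      Tm.Evaluates.pair (h₁.mono (by omega : k₁ ≤ K)) (h₂.mono (by omega : k₂ ≤ K)) hL hs
    refine ⟨_, _, .seq r₁ (.seq r₂ (.write _ _ _ _)), ?_, a.trans (s₂.agree_setNat _ le_rfl), ?_⟩
    · refine le_trans ?_ (affine_le_pow hL (B := L ^ K) le_rfl 5 (3 * d + 15))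
      have f₁ := size_le_pow (lt_two_pow_of_le hL (g₁ L hL s.view (s.nat 7) hs.1 hs.2)
        (by omega : l₁ ≤ K))
      have f₂ := size_le_pow (lt_two_pow_of_le hL (g₂ L hL s.view (s.nat 7) hs.1 hs.2)
        (by omega : l₂ ≤ K))
      have f₃ := size_le_pow (lt_two_pow_of_le hL (g₃ L hL s.view (s.nat 7) hs.1 hs.2)
        (by omega : l₃ ≤ K))
      have := size_le_self d
      have := size_le_self (d + 1)
      simp only [Tm.eval] at f₃
      simp only [Exp.cost, Op.exp_cost, Exp.eval, v₁, v₂]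
      omega
    · simp [State.setNat_nat, Op.exp_eval, Exp.eval, v₁, v₂, Tm.eval]
  | le e₁ e₂ ih₁ ih₂ =>
    intro d
    obtain ⟨k₁, h₁⟩ := ih₁ d
    obtain ⟨k₂, h₂⟩ := ih₂ (d + 1)
    obtain ⟨l₁, -, g₁⟩ := e₁.eval_lt
    obtain ⟨l₂, -, g₂⟩ := e₂.eval_lt
    set K := k₁ + k₂ + l₁ + l₂ with hK
    refine ⟨K + (5 + (3 * d + 15)), fun L hL s hs => ?_⟩
    obtain ⟨s₁, s₂, c₁, c₂, r₁, r₂, b₁, b₂, a, v₁, v₂⟩ :=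
      Tm.Evaluates.pair (h₁.mono (by omega : k₁ ≤ K)) (h₂.mono (by omega : k₂ ≤ K)) hL hs
    have f₁ := size_le_pow (lt_two_pow_of_le hL (g₁ L hL s.view (s.nat 7) hs.1 hs.2)
      (by omega : l₁ ≤ K))
    have f₂ := size_le_pow (lt_two_pow_of_le hL (g₂ L hL s.view (s.nat 7) hs.1 hs.2)
      (by omega : l₂ ≤ K))
    have := size_le_self d
    have := size_le_self (d + 1)
    by_cases hle : e₁.eval s.view (s.nat 7) ≤ e₂.eval s.view (s.nat 7)
    · refine ⟨_, _, .seq r₁ (.seq r₂ (.iteTrue ?_ (.write _ _ _ _))), ?_,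
        a.trans (s₂.agree_setNat _ le_rfl), ?_⟩
      · simpa [Test.Holds, Exp.eval, v₁, v₂] using hle
      · refine le_trans ?_ (affine_le_pow hL (B := L ^ K) le_rfl 5 (3 * d + 15))
        simp only [Exp.cost, Test.cost, Exp.eval, v₁, v₂, Nat.size_one]
        omega
      · simp [State.setNat_nat, Exp.eval, Tm.eval, hle]
    · refine ⟨_, _, .seq r₁ (.seq r₂ (.iteFalse ?_ (.write _ _ _ _))), ?_,
        a.trans (s₂.agree_setNat _ le_rfl), ?_⟩
      · simpa [Test.Holds, Exp.eval, v₁, v₂] using hle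
      · refine le_trans ?_ (affine_le_pow hL (B := L ^ K) le_rfl 5 (3 * d + 15))
        simp only [Exp.cost, Test.cost, Exp.eval, v₁, v₂, Nat.size_zero]
        omega
      · simp [State.setNat_nat, Exp.eval, Tm.eval, hle]
  | gle a' e₁ b' e₂ ih₁ ih₂ =>
    intro d
    obtain ⟨k₁, h₁⟩ := ih₁ d
    obtain ⟨k₂, h₂⟩ := ih₂ (d + 1)
    obtain ⟨l₁, -, g₁⟩ := e₁.eval_lt
    obtain ⟨l₂, -, g₂⟩ := e₂.eval_lt
    set K := k₁ + k₂ + l₁ + l₂ with hK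
    refine ⟨K + (5 + (3 * d + 20)), fun L hL s hs => ?_⟩
    obtain ⟨s₁, s₂, c₁, c₂, r₁, r₂, b₁, b₂, a, v₁, v₂⟩ :=
      Tm.Evaluates.pair (h₁.mono (by omega : k₁ ≤ K)) (h₂.mono (by omega : k₂ ≤ K)) hL hs
    have f₁ := size_le_pow (lt_two_pow_of_le hL (g₁ L hL s.view (s.nat 7) hs.1 hs.2)
      (by omega : l₁ ≤ K))
    have f₂ := size_le_pow (lt_two_pow_of_le hL (g₂ L hL s.view (s.nat 7) hs.1 hs.2)
      (by omega : l₂ ≤ K))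
    have := size_le_self d
    have := size_le_self (d + 1)
    by_cases hle : s.grp a' (e₁.eval s.view (s.nat 7)) ≤ s.grp b' (e₂.eval s.view (s.nat 7))
    · refine ⟨_, _, .seq r₁ (.seq r₂ (.iteTrue ?_ (.write _ _ _ _))), ?_,
        a.trans (s₂.agree_setNat _ le_rfl), ?_⟩
      · simpa [Test.Holds, GExp.eval, Exp.eval, v₁, v₂, a.1] using hle
      · refine le_trans ?_ (affine_le_pow hL (B := L ^ K) le_rfl 5 (3 * d + 20))
        simp only [Exp.cost, GExp.cost, Test.cost, Exp.eval, v₁, v₂, Nat.size_one]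
        omega
      · simp [State.setNat_nat, Exp.eval, Tm.eval, hle]
    · refine ⟨_, _, .seq r₁ (.seq r₂ (.iteFalse ?_ (.write _ _ _ _))), ?_,
        a.trans (s₂.agree_setNat _ le_rfl), ?_⟩
      · simpa [Test.Holds, GExp.eval, Exp.eval, v₁, v₂, a.1] using hle
      · refine le_trans ?_ (affine_le_pow hL (B := L ^ K) le_rfl 5 (3 * d + 20))
        simp only [Exp.cost, GExp.cost, Test.cost, Exp.eval, v₁, v₂, Nat.size_zero]
        omega
      · simp [State.setNat_nat, Exp.eval, Tm.eval, hle]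
  | sum k e ih =>
    intro d
    obtain ⟨k₁, h₁⟩ := ih (d + 3)
    obtain ⟨l₁, -, g₁⟩ := e.eval_lt
    obtain ⟨l₂, -, g₂⟩ := (Tm.sum k e).eval_lt
    refine ⟨Tm.bigExponent k d k₁ (l₁ + l₂), Tm.evaluates_big .add 0 k d k₁ (l₁ + l₂) e
      (fun i s => ∑ j ∈ Finset.range i, e.eval s.view (update (s.nat 7) k j)) (by omega) h₁
      (fun s => by simp) (fun i s => Finset.sum_range_succ _ _) (fun L hL s hs i hi => ?_)
      fun L hL s hs => lt_two_pow_of_le hL (g₁ L hL _ _ hs.1 hs.2) (by omega)⟩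
    refine lt_of_le_of_lt ?_ (lt_two_pow_of_le hL (g₂ L hL s.view (s.nat 7) hs.1 hs.2)
      (by omega : l₂ ≤ l₁ + l₂))
    exact Finset.sum_le_sum_of_subset (Finset.range_subset_range.2 hi)
  | prod k e ih =>
    intro d
    obtain ⟨k₁, h₁⟩ := ih (d + 3)
    obtain ⟨l₁, -, g₁⟩ := e.eval_lt
    refine ⟨Tm.bigExponent k d k₁ (l₁ + 2), Tm.evaluates_big .mul 1 k d k₁ (l₁ + 2) e
      (fun i s => ∏ j ∈ Finset.range i, e.eval s.view (update (s.nat 7) k j)) (by omega) h₁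
      (fun s => by simp) (fun i s => Finset.prod_range_succ _ _) (fun L hL s hs i hi => ?_)
      fun L hL s hs => lt_two_pow_of_le hL (g₁ L hL _ _ hs.1 hs.2) (by omega)⟩
    have hb : ∀ j ∈ Finset.range i, e.eval s.view (update (s.nat 7) k j) ≤ 2 ^ L ^ l₁ := by
      intro j hj
      refine (g₁ L hL s.view _ hs.1 fun l => ?_).le
      rw [update_apply]; split
      · exact (Finset.mem_range.1 hj).trans_le
          (hi.trans (hs.1.1.trans Nat.lt_two_pow_self.le))
      · exact hs.2 l
    calc _ ≤ (2 ^ L ^ l₁) ^ i := by simpa using Finset.prod_le_pow_card _ _ _ hb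
      _ ≤ 2 ^ (L ^ l₁ * L) := by
          rw [← pow_mul]; gcongr
          · omega
          · exact hi.trans hs.1.1
      _ < 2 ^ L ^ (l₁ + 2) := by
          refine Nat.pow_lt_pow_right (by omega) ?_
          rw [← pow_succ]; exact Nat.pow_lt_pow_right (by omega) (by omega)
  | letv k e₁ e₂ ih₁ ih₂ =>
    intro d
    obtain ⟨k₁, h₁⟩ := ih₁ d
    obtain ⟨k₂, h₂⟩ := ih₂ (d + 2)
    obtain ⟨l₁, hl₁, g₁⟩ := e₁.eval_lt
    obtain ⟨l₂, -, g₂⟩ := (Tm.letv k e₁ e₂).eval_lt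
    set K := k₁ + l₁ * k₂ + l₁ + l₂ + 1 with hK
    refine ⟨K + (12 + (10 * d + 10 * k + 50)), fun L hL s hs => ?_⟩
    have hL₁ : L ≤ L ^ l₁ := Nat.le_self_pow (by omega) L
    obtain ⟨s₁, c₁, r₁, b₁, a₁, v₁⟩ := h₁ L hL s hs
    have vb := g₁ L hL s.view (s.nat 7) hs.1 hs.2
    set s₂ := s₁.setNat 6 (d + 1) (s.nat 7 k) with hs₂
    have r₂ := Runs.write s₁ 6 (.lit (d + 1)) (.read 7 (.lit k))
    have e₇ : s₁.nat 7 = s.nat 7 := a₁.2.1 7 (by omega)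
    simp only [Exp.eval, e₇] at r₂
    rw [← hs₂] at r₂
    have a₂ : s.Agree d s₂ := a₁.trans (s₁.agree_setNat _ (by omega))
    have v₂ : s₂.nat 6 d = e₁.eval s.view (s.nat 7) := by
      rw [hs₂, State.setNat_nat, if_neg (by omega), v₁]
    set x := e₁.eval s.view (s.nat 7) with hx
    set s₃ := s₂.setNat 7 k x with hs₃
    have r₃ := Runs.write s₂ 7 (.lit k) (slot d)
    simp only [Exp.eval, v₂] at r₃
    rw [← hs₃] at r₃
    -- The new value of variable `k` has up to `L ^ l₁` bits, so the cost bound for `e₂` is used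
    -- with this larger parameter.
    obtain ⟨s₄, c₄, r₄, b₄, a₄, v₄⟩ := h₂ (L ^ l₁) (by omega) s₃
      (((hs.of_agree a₂).mono hL₁).set k vb)
    have w₁ : s₄.nat 6 (d + 1) = s.nat 7 k := by
      rw [a₄.2.2 _ (by omega), hs₃, State.setNat_nat_of_ne _ _ _ _ (by omega), hs₂,
        State.setNat_nat, if_pos ⟨rfl, rfl⟩]
    have hρ : s₃.nat 7 = update (s.nat 7) k x := by
      rw [hs₃, ← a₂.2.1 7 (by omega)]
      funext j; rw [State.setNat_nat, update_apply]; simp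
    rw [hs₃, State.view_setNat_seven, a₂.view, ← hs₃, hρ] at v₄
    have r₅ := Runs.write s₄ 7 (.lit k) (slot (d + 1))
    simp only [Exp.eval, w₁] at r₅
    set s₅ := s₄.setNat 7 k (s.nat 7 k) with hs₅
    have w₂ : s₅.nat 6 (d + 2) = e₂.eval s.view (update (s.nat 7) k x) := by
      rw [hs₅, State.setNat_nat_of_ne _ _ _ _ (by omega), v₄]
    have r₆ := Runs.write s₅ 6 (.lit d) (slot (d + 2))
    simp only [Exp.eval, w₂] at r₆
    have hag : s.Agree d s₅ := by
      refine ⟨?_, fun a ha => ?_, fun j hj => ?_⟩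
      · rw [hs₅, State.setNat_grp, a₄.1, hs₃, State.setNat_grp, a₂.1]
      · by_cases h7 : a = 7
        · subst h7
          funext j
          rw [hs₅, State.setNat_nat]
          by_cases hj : j = k
          · simp [hj]
          · rw [if_neg (by tauto), a₄.2.1 7 (by omega), hρ, update_of_ne hj]
        · rw [hs₅, State.setNat_nat_of_ne _ _ _ _ h7, a₄.2.1 a ha, hs₃,
            State.setNat_nat_of_ne _ _ _ _ h7, a₂.2.1 a ha]
      · rw [hs₅, State.setNat_nat_of_ne _ _ _ _ (by omega), a₄.2.2 j (by omega), hs₃,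
            State.setNat_nat_of_ne _ _ _ _ (by omega), a₂.2.2 j hj]
    refine ⟨_, _, .seq r₁ (.seq r₂ (.seq r₃ (.seq r₄ (.seq r₅ r₆)))), ?_,
      hag.trans (s₅.agree_setNat _ le_rfl), by simp [State.setNat_nat, Tm.eval, hx]⟩
    refine le_trans ?_ (affine_le_pow hL (B := L ^ K) le_rfl 12 (10 * d + 10 * k + 50))
    have g₃ := le_pow_of_le hL b₁ (by omega : k₁ ≤ K)
    rw [← pow_mul] at b₄
    have g₄ := le_pow_of_le hL b₄ (by omega : l₁ * k₂ ≤ K)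
    have g₅ := size_le_pow (lt_two_pow_of_le hL vb (by omega : l₁ ≤ K))
    have g₆ := size_le_pow (lt_two_pow_of_le hL (g₂ L hL s.view (s.nat 7) hs.1 hs.2)
      (by omega : l₂ ≤ K))
    have g₇ : L ≤ L ^ K := le_pow_of_le hL (by simp : L ≤ L ^ 1) (by omega)
    have g₈ : Nat.size (s.nat 7 k) ≤ L := Nat.size_le.2 (hs.2 k)
    have := size_le_self d
    have := size_le_self (d + 1)
    have := size_le_self (d + 2)
    have := size_le_self k
    simp only [Tm.eval, ← hx] at g₆
    simp only [Exp.cost, Exp.eval, v₂, w₁, w₂, e₇]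
    omega

end Compile

end Sched

/-! ### Commands, loops and their running times -/

namespace Sched

open Function

/-- Commands: straight-line programs over terms. -/
inductive Cmd where
  | skip
  -- Array `0` is write-protected because its cell `0` is the range of all bounded sums and
  -- products.
  | assign (a : ℕ) (ha : a ≠ 0) (i e : Tm)
  | gset (a : ℕ) (i : Tm) (b : ℕ) (e₁ : Tm) (c : ℕ) (e₂ : Tm)
  | ite (e : Tm) (c₁ c₂ : Cmd)
  | seq (c₁ c₂ : Cmd)

def Cmd.compile : Cmd → Prog
  | .skip => .skip
  | .assign a _ i e => .seq (i.compile 0) (.seq (e.compile 1) (.write (enc a) (slot 0) (slot 1)))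
  | .gset a i b e₁ c e₂ => .seq (i.compile 0) (.seq (e₁.compile 1) (.seq (e₂.compile 2)
      (.gwrite a (slot 0) (.add (.read b (slot 1)) (.read c (slot 2))))))
  | .ite e c₁ c₂ => .seq (e.compile 0) (.ite (.le (.lit 1) (slot 0)) c₁.compile c₂.compile)
  | .seq c₁ c₂ => .seq c₁.compile c₂.compile

/-- Repeat a command as long as the value of a term is positive. -/
def whileProg (e : Tm) (c : Cmd) : Prog :=
  .seq (e.compile 0) (.loop (.le (.lit 1) (slot 0)) (.seq c.compile (e.compile 0)))

section Commands

variable {R : Type}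

lemma State.view_setNat (s : State R) (a i x : ℕ) :
    (s.setNat (enc a) i x).view = s.view.setNat a i x := by
  simp only [State.view, State.setNat, State.mk.injEq, and_true]
  funext b
  simp only [update_apply, enc_injective.eq_iff]

lemma State.view_setGrp (s : State R) (a i : ℕ) (x : R) :
    (s.setGrp a i x).view = s.view.setGrp a i x := rfl

lemma State.Bounded.setNat {L : ℕ} {s : State R} (h : s.Bounded L) {a : ℕ} (ha : a ≠ 0) (i : ℕ)
    {x : ℕ} (hx : x < 2 ^ L) : (s.setNat a i x).Bounded L := by
  refine ⟨by rw [State.setNat_nat_of_ne _ _ _ _ ha.symm]; exact h.1, fun b j => ?_⟩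
  rw [State.setNat_nat]; split
  · exact hx
  · exact h.2 b j

lemma State.Bounded.tame {L : ℕ} {s : State R} (h : s.view.Bounded L) (h₇ : s.nat 7 = 0) :
    s.Tame L := ⟨h, fun j => by simp [h₇]⟩

variable [AddCommGroup R] [LinearOrder R]

def Cmd.den : Cmd → State R → State R
  | .skip, s => s
  | .assign a _ i e, s => s.setNat a (i.eval s 0) (e.eval s 0)
  | .gset a i b e₁ c e₂, s => s.setGrp a (i.eval s 0) (s.grp b (e₁.eval s 0) + s.grp c (e₂.eval s 0))
  | .ite e c₁ c₂, s => if e.eval s 0 ≠ 0 then c₁.den s else c₂.den s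
  | .seq c₁ c₂, s => c₂.den (c₁.den s)

/-- The specification of `Cmd.compile`. -/
def Cmd.Executes (c : Cmd) (k : ℕ) : Prop :=
  ∀ {R : Type} [AddCommGroup R] [LinearOrder R] (L : ℕ), 2 ≤ L → ∀ s : State R,
    s.nat 7 = 0 → s.view.Bounded L →
    ∃ s' x, Runs c.compile s s' x ∧ x ≤ L ^ k ∧ s'.nat 7 = 0 ∧ s'.view = c.den s.view ∧
      s'.view.Bounded (L ^ k)

/-- Commands are executed in polynomial time. -/
theorem Cmd.executes (c : Cmd) : ∃ k, 1 ≤ k ∧ c.Executes k := by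
  induction c with
  | skip =>
    exact ⟨1, le_rfl, fun L hL s h₇ hs => ⟨s, 1, .skip s, by simp; omega, h₇, rfl, by simpa⟩⟩
  | assign a ha i e =>
    obtain ⟨k₁, h₁⟩ := i.evaluates 0
    obtain ⟨k₂, h₂⟩ := e.evaluates 1
    obtain ⟨l₁, -, g₁⟩ := i.eval_lt
    obtain ⟨l₂, -, g₂⟩ := e.eval_lt
    set K := k₁ + k₂ + l₁ + l₂ + 1 with hK
    refine ⟨K + (4 + 15), by omega, fun L hL s h₇ hs => ?_⟩
    obtain ⟨s₁, s₂, c₁, c₂, r₁, r₂, b₁, b₂, ag, v₁, v₂⟩ :=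
      Tm.Evaluates.pair (h₁.mono (by omega : k₁ ≤ K)) (h₂.mono (by omega : k₂ ≤ K)) hL (hs.tame h₇)
    rw [h₇] at v₁ v₂
    rw [zero_add] at v₂
    have f₁ := lt_two_pow_of_le hL (g₁ L hL s.view 0 hs (by simp)) (by omega : l₁ ≤ K)
    have f₂ := lt_two_pow_of_le hL (g₂ L hL s.view 0 hs (by simp)) (by omega : l₂ ≤ K)
    have hv : (s₂.setNat (enc a) (i.eval s.view 0) (e.eval s.view 0)).view =
        (Cmd.assign a ha i e).den s.view := by rw [State.view_setNat, ag.view]; rfl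
    have r₃ := Runs.write s₂ (enc a) (slot 0) (slot 1)
    simp only [Exp.eval, v₁, v₂] at r₃
    have hLK : L ≤ L ^ K := le_pow_of_le hL (by simp : L ≤ L ^ 1) (by omega)
    refine ⟨_, _, .seq r₁ (.seq r₂ r₃), ?_, ?_, hv, ?_⟩
    · refine le_trans ?_ (affine_le_pow hL (B := L ^ K) le_rfl 4 15)
      have := size_le_pow f₁
      have := size_le_pow f₂
      simp only [Exp.cost, Exp.eval, v₁, v₂, Nat.size_zero, Nat.size_one]
      omega
    · rw [State.setNat_nat_of_ne _ _ _ _ (enc_ne_seven a).symm, ag.2.1 7 (by omega), h₇]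
    · rw [hv]
      exact ((hs.mono hLK).setNat ha _ f₂).mono (Nat.pow_le_pow_right (by omega) (by omega))
  | gset a i b e₁ c e₂ =>
    obtain ⟨k₁, h₁⟩ := i.evaluates 0
    obtain ⟨k₂, h₂⟩ := e₁.evaluates 1
    obtain ⟨k₃, h₃⟩ := e₂.evaluates 2
    obtain ⟨l₁, -, g₁⟩ := i.eval_lt
    obtain ⟨l₂, -, g₂⟩ := e₁.eval_lt
    obtain ⟨l₃, -, g₃⟩ := e₂.eval_lt
    set K := k₁ + k₂ + k₃ + l₁ + l₂ + l₃ + 1 with hK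
    refine ⟨K + (6 + 30), by omega, fun L hL s h₇ hs => ?_⟩
    obtain ⟨s₁, s₂, c₁, c₂, r₁, r₂, b₁, b₂, ag, v₁, v₂⟩ :=
      Tm.Evaluates.pair (h₁.mono (by omega : k₁ ≤ K)) (h₂.mono (by omega : k₂ ≤ K)) hL (hs.tame h₇)
    obtain ⟨s₃, c₃, r₃, b₃, ag₃, v₃⟩ := h₃ L hL s₂ ((hs.tame h₇).of_agree ag)
    have b₃ := le_pow_of_le hL b₃ (by omega : k₃ ≤ K)
    rw [ag.view, ag.2.1 7 (by omega), h₇] at v₃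
    rw [h₇] at v₁ v₂
    have w₁ := (ag₃.2.2 0 (by omega)).trans v₁
    have w₂ := (ag₃.2.2 1 (by omega)).trans v₂
    have f₁ := size_le_pow (lt_two_pow_of_le hL (g₁ L hL s.view 0 hs (by simp)) (by omega : l₁ ≤ K))
    have f₂ := size_le_pow (lt_two_pow_of_le hL (g₂ L hL s.view 0 hs (by simp)) (by omega : l₂ ≤ K))
    have f₃ := size_le_pow (lt_two_pow_of_le hL (g₃ L hL s.view 0 hs (by simp)) (by omega : l₃ ≤ K))
    have hag := ag.trans (ag₃.mono (by omega))
    have r₄ := Runs.gwrite s₃ a (slot 0) (.add (.read b (slot 1)) (.read c (slot 2)))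
    simp only [Exp.eval, GExp.eval, w₁, w₂, v₃, hag.1] at r₄
    have hLK : L ≤ L ^ (K + (6 + 30)) := le_pow_of_le hL (by simp : L ≤ L ^ 1) (by omega)
    have hv : (s₃.setGrp a (i.eval s.view 0)
        (s.grp b (e₁.eval s.view 0) + s.grp c (e₂.eval s.view 0))).view =
        (Cmd.gset a i b e₁ c e₂).den s.view := by rw [State.view_setGrp, hag.view]; rfl
    refine ⟨_, _, .seq r₁ (.seq r₂ (.seq r₃ r₄)), ?_, ?_, hv, ?_⟩
    · refine le_trans ?_ (affine_le_pow hL (B := L ^ K) le_rfl 6 30)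
      have : Nat.size 2 ≤ 2 := size_le_self 2
      simp only [Exp.cost, GExp.cost, Exp.eval, w₁, w₂, v₃, Nat.size_zero, Nat.size_one]
      omega
    · rw [State.setGrp_nat, hag.2.1 7 (by omega), h₇]
    · rw [hv]; exact hs.mono hLK
  | ite e c₁ c₂ ih₁ ih₂ =>
    obtain ⟨k, h⟩ := e.evaluates 0
    obtain ⟨l, -, g⟩ := e.eval_lt
    obtain ⟨k₁, hk₁, h₁⟩ := ih₁
    obtain ⟨k₂, hk₂, h₂⟩ := ih₂
    set K := k + l + k₁ + k₂ with hK
    refine ⟨K + (3 + 10), by omega, fun L hL s h₇ hs => ?_⟩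
    obtain ⟨s₁, x, r, b, ag, v⟩ := h L hL s (hs.tame h₇)
    have f := size_le_pow (lt_two_pow_of_le hL (g L hL s.view 0 hs (by simp)) (by omega : l ≤ K))
    have b' := le_pow_of_le hL b (by omega : k ≤ K)
    rw [h₇] at v
    have h₇' : s₁.nat 7 = 0 := (ag.2.1 7 (by omega)).trans h₇
    have hs' : s₁.view.Bounded L := by rw [ag.view]; exact hs
    by_cases he : e.eval s.view 0 = 0
    · obtain ⟨s₂, y, r₂, b₂, z₂, w₂, u₂⟩ := h₂ L hL s₁ h₇' hs'
      refine ⟨s₂, _, .seq r (.iteFalse ?_ r₂), ?_, z₂, ?_, u₂.mono ?_⟩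
      · simp [Test.Holds, Exp.eval, v, he]
      · refine le_trans ?_ (affine_le_pow hL (B := L ^ K) le_rfl 3 10)
        have := le_pow_of_le hL b₂ (by omega : k₂ ≤ K)
        simp only [Test.cost, Exp.cost, Exp.eval, v, Nat.size_zero, Nat.size_one]
        omega
      · rw [w₂, ag.view]; simp [Cmd.den, he]
      · exact Nat.pow_le_pow_right (by omega) (by omega)
    · obtain ⟨s₂, y, r₂, b₂, z₂, w₂, u₂⟩ := h₁ L hL s₁ h₇' hs'
      refine ⟨s₂, _, .seq r (.iteTrue ?_ r₂), ?_, z₂, ?_, u₂.mono ?_⟩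
      · simp [Test.Holds, Exp.eval, v]; omega
      · refine le_trans ?_ (affine_le_pow hL (B := L ^ K) le_rfl 3 10)
        have := le_pow_of_le hL b₂ (by omega : k₁ ≤ K)
        simp only [Test.cost, Exp.cost, Exp.eval, v, Nat.size_zero, Nat.size_one]
        omega
      · rw [w₂, ag.view]; simp [Cmd.den, he]
      · exact Nat.pow_le_pow_right (by omega) (by omega)
  | seq c₁ c₂ ih₁ ih₂ =>
    obtain ⟨k₁, hk₁, h₁⟩ := ih₁
    obtain ⟨k₂, hk₂, h₂⟩ := ih₂
    refine ⟨k₁ + k₁ * k₂ + (2 + 0), by omega, fun L hL s h₇ hs => ?_⟩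
    obtain ⟨s₁, x₁, r₁, b₁, z₁, w₁, u₁⟩ := h₁ L hL s h₇ hs
    have hL₁ : 2 ≤ L ^ k₁ := hL.trans (Nat.le_self_pow (by omega) L)
    -- After the first command the data may have `L ^ k₁` bits; the second command is estimated with
    -- this parameter.
    obtain ⟨s₂, x₂, r₂, b₂, z₂, w₂, u₂⟩ := h₂ (L ^ k₁) hL₁ s₁ z₁ u₁
    rw [← pow_mul] at b₂ u₂
    refine ⟨s₂, _, .seq r₁ r₂, ?_, z₂, by rw [w₂, w₁]; rfl, u₂.mono ?_⟩
    · refine le_trans ?_ (affine_le_pow hL (B := L ^ (k₁ + k₁ * k₂)) le_rfl 2 0)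
      have := le_pow_of_le hL b₁ (by omega : k₁ ≤ k₁ + k₁ * k₂)
      have := le_pow_of_le hL b₂ (by omega : k₁ * k₂ ≤ k₁ + k₁ * k₂)
      omega
    · exact Nat.pow_le_pow_right (by omega) (by omega)

/-- Iterating the size bound of `Cmd.executes` would make it grow with every round. The invariant
therefore has to supply a single `L` that is valid throughout; then every round costs at most a
fixed power of `L`. -/
theorem whileProg_runs (e : Tm) (c : Cmd) : ∃ k, ∀ {R : Type} [AddCommGroup R] [LinearOrder R]
    (Inv : State R → Prop) (μ : State R → ℕ) (L : ℕ), 2 ≤ L → (∀ v, Inv v → v.Bounded L) →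
    (∀ v, Inv v → e.eval v 0 ≠ 0 → Inv (c.den v) ∧ μ (c.den v) < μ v) →
    ∀ s : State R, s.nat 7 = 0 → Inv s.view → ∃ s' x, Runs (whileProg e c) s s' x ∧
      x ≤ (μ s.view + 1) * L ^ k ∧ s'.nat 7 = 0 ∧ Inv s'.view ∧ e.eval s'.view 0 = 0 := by
  obtain ⟨k₁, h₁⟩ := e.evaluates 0
  obtain ⟨l, -, g⟩ := e.eval_lt
  obtain ⟨k₂, hk₂, h₂⟩ := c.executes
  set K := k₁ + k₂ + l + 1 with hK
  refine ⟨K + (4 + 20), fun {R} _ _ Inv μ L hL hbd hstep s h₇ hs => ?_⟩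
  obtain ⟨s₁, x₁, r₁, b₁, a₁, v₁⟩ := h₁ L hL s ((hbd _ hs).tame h₇)
  have hval : ∀ v, Inv v → Nat.size (e.eval v 0) ≤ L ^ K := fun v hv =>
    size_le_pow (lt_two_pow_of_le hL (g L hL v 0 (hbd v hv) (by simp)) (by omega : l ≤ K))
  obtain ⟨s₂, x₂, r₂, i₂, n₂, b₂⟩ := Runs.loop_of_measure
    -- Whenever the loop test is made, stack cell `0` contains the current value of `e`.
    (Inv := fun t : State R => t.nat 7 = 0 ∧ Inv t.view ∧ t.nat 6 0 = e.eval t.view 0)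
    (b := .le (.lit 1) (slot 0)) (p := .seq c.compile (e.compile 0)) (μ := fun t => μ t.view)
    (B := L ^ K + 10) (C := 2 * L ^ K) (by
      intro t ht
      have := hval _ ht.2.1
      simp only [Test.cost, Exp.cost, Exp.eval, ht.2.2, Nat.size_zero, Nat.size_one]
      omega) (by
      intro t ht hb
      have he : e.eval t.view 0 ≠ 0 := by
        have : 1 ≤ e.eval t.view 0 := by simpa [Test.Holds, Exp.eval, ht.2.2] using hb
        omega
      obtain ⟨hi, hμ⟩ := hstep _ ht.2.1 he
      obtain ⟨t₁, y₁, q₁, d₁, z₁, w₁, -⟩ := h₂ L hL t ht.1 (hbd _ ht.2.1)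
      rw [← w₁] at hi
      obtain ⟨t₂, y₂, q₂, d₂, a₂, v₂⟩ := h₁ L hL t₁ ((hbd _ hi).tame z₁)
      have d₁ := le_pow_of_le hL d₁ (by omega : k₂ ≤ K)
      have d₂ := le_pow_of_le hL d₂ (by omega : k₁ ≤ K)
      refine ⟨t₂, _, .seq q₁ q₂, by omega, ⟨by rw [a₂.2.1 7 (by omega), z₁], by rwa [a₂.view],
        by rw [v₂, a₂.view, z₁]⟩, by rw [a₂.view, w₁]; exact hμ⟩) s₁
    ⟨by rw [a₁.2.1 7 (by omega), h₇], by rwa [a₁.view], by rw [v₁, a₁.view, h₇]⟩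
  refine ⟨s₂, _, .seq r₁ r₂, ?_, i₂.1, i₂.2.1, ?_⟩
  · rw [a₁.view] at b₂
    refine le_trans ?_ (Nat.mul_le_mul_left _ (affine_le_pow hL (B := L ^ K) le_rfl 4 20))
    have b₁ := le_pow_of_le hL b₁ (by omega : k₁ ≤ K)
    nlinarith [Nat.zero_le (μ s.view * L ^ K), Nat.zero_le (μ s.view)]
  · simpa [Test.Holds, Exp.eval, i₂.2.2] using n₂

end Commands

/-! ### Reversing the order of the weights -/

/-- A run over `Rᵒᵈ` becomes a run over `R` of the same cost once the two sides of every weight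
comparison are exchanged. This is needed for the last two quarters, where reversing the orderings
turns minimization into maximization. -/
def Test.flip : Test → Test
  | .le e₁ e₂ => .le e₁ e₂
  | .gle g₁ g₂ => .gle g₂ g₁
  | .not b => .not b.flip
  | .and b₁ b₂ => .and b₁.flip b₂.flip

def Prog.flip : Prog → Prog
  | .skip => .skip
  | .write a i e => .write a i e
  | .gwrite a i g => .gwrite a i g
  | .seq p₁ p₂ => .seq p₁.flip p₂.flip
  | .ite b p₁ p₂ => .ite b.flip p₁.flip p₂.flip
  | .loop b p => .loop b.flip p.flip

section Flip

variable {R : Type}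

/-- A memory, with the weights taken from the opposite order. -/
def State.dual (s : State R) : State Rᵒᵈ := ⟨s.nat, s.grp⟩

def State.undual (s : State Rᵒᵈ) : State R := ⟨s.nat, s.grp⟩

lemma Exp.eval_undual (s : State Rᵒᵈ) (e : Exp) : e.eval s.undual = e.eval s := by
  induction e <;> simp_all [Exp.eval, State.undual]

lemma Exp.cost_undual (s : State Rᵒᵈ) (e : Exp) : e.cost s.undual = e.cost s := by
  induction e <;> simp only [Exp.cost, Exp.eval_undual, *]

lemma GExp.cost_undual (s : State Rᵒᵈ) (g : GExp) : g.cost s.undual = g.cost s := by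
  induction g <;> simp only [GExp.cost, Exp.cost_undual, *]

lemma Test.cost_flip_undual (s : State Rᵒᵈ) (b : Test) : b.flip.cost s.undual = b.cost s := by
  induction b <;> simp only [Test.flip, Test.cost, Exp.cost_undual, GExp.cost_undual, *]
  omega

variable [AddCommGroup R] [LinearOrder R]

omit [LinearOrder R] in
lemma GExp.eval_undual (s : State Rᵒᵈ) (g : GExp) :
    g.eval s.undual = OrderDual.ofDual (g.eval s) := by
  induction g with
  | zero => rfl
  | read a i => simp only [GExp.eval, Exp.eval_undual]; rfl
  | add g₁ g₂ h₁ h₂ => simp only [GExp.eval, h₁, h₂]; rfl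

lemma Test.holds_flip_undual (s : State Rᵒᵈ) (b : Test) :
    b.flip.Holds s.undual ↔ b.Holds s := by
  induction b with
  | le => simp only [Test.flip, Test.Holds, Exp.eval_undual]
  | gle => simp only [Test.flip, Test.Holds, GExp.eval_undual]; rfl
  | not b h => simp only [Test.flip, Test.Holds, h]
  | and b₁ b₂ h₁ h₂ => simp only [Test.flip, Test.Holds, h₁, h₂]

lemma Runs.flip {p : Prog} {s s' : State Rᵒᵈ} {c : ℕ} (h : Runs p s s' c) :
    Runs p.flip s.undual s'.undual c := by
  induction h with
  | skip s => exact .skip _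
  | write s a i e =>
    have := Runs.write s.undual a i e
    rw [Exp.eval_undual, Exp.eval_undual, Exp.cost_undual, Exp.cost_undual] at this
    exact this
  | gwrite s a i g =>
    have := Runs.gwrite s.undual a i g
    rw [Exp.eval_undual, GExp.eval_undual, Exp.cost_undual, GExp.cost_undual] at this
    exact this
  | seq _ _ h₁ h₂ => exact .seq h₁ h₂
  | iteTrue hb _ ih =>
    rw [← Test.cost_flip_undual]; exact .iteTrue ((Test.holds_flip_undual _ _).2 hb) ih
  | iteFalse hb _ ih =>
    rw [← Test.cost_flip_undual]; exact .iteFalse (mt (Test.holds_flip_undual _ _).1 hb) ih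
  | loopStop hb =>
    rw [← Test.cost_flip_undual]; exact .loopStop (mt (Test.holds_flip_undual _ _).1 hb)
  | loopStep hb _ _ ih₁ ih₂ =>
    rw [← Test.cost_flip_undual]; exact .loopStep ((Test.holds_flip_undual _ _).2 hb) ih₁ ih₂

end Flip

end Sched

namespace Sched

/-! ### Orderings as paths of states -/

/-- The task solved by dynamic programming: among the orderings that respect `prec`, put the jobs
at allowed positions and put exactly `p` jobs of `P` at the first `h` positions, find one of least
total completion time. -/
structure Problem (R : Type) (n : ℕ) where
  prec : Fin n → Fin n → Prop
  allowed : Fin n → ℕ → Prop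
  time : Fin n → R
  P : Finset (Fin n)
  h : ℕ
  p : ℕ

/-- A set of scheduled jobs, and the set of jobs of `P` scheduled at the first `h` positions. -/
abbrev DState (n : ℕ) := Finset (Fin n) × Finset (Fin n)

/-- The position of a job in a schedule that is listed with the last job first. -/
def place {n : ℕ} : List (Fin n) → Fin n → ℕ
  | [], _ => 0
  | u :: l, v => if v = u then l.length + 1 else place l v

section Place

variable {n : ℕ}

lemma place_le_length (l : List (Fin n)) (v : Fin n) : place l v ≤ l.length := by
  induction l with
  | nil => simp [place]
  | cons u l ih => simp only [place, List.length_cons]; split <;> omega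

lemma place_pos {l : List (Fin n)} {v : Fin n} (h : v ∈ l) : 0 < place l v := by
  induction l with
  | nil => simp at h
  | cons u l ih =>
    simp only [place]; split
    · omega
    · exact ih (by simp_all)

lemma place_injOn {l : List (Fin n)} {u v : Fin n} (hu : u ∈ l) (hv : v ∈ l)
    (h : place l u = place l v) : u = v := by
  induction l with
  | nil => simp at hu
  | cons w l ih =>
    simp only [place] at h
    have h₁ := place_le_length l u
    have h₂ := place_le_length l v
    split at h <;> split at h
    · simp_all
    · omega
    · omega
    · exact ih (by simp_all) (by simp_all) h

end Place

namespace Problem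

variable {R : Type} {n : ℕ} (J : Problem R n)

section

variable [LinearOrder R]

/-- The state reached when `v` is scheduled next. -/
def next (K : DState n) (v : Fin n) : DState n :=
  (insert v K.1, if v ∈ J.P ∧ K.1.card + 1 ≤ J.h then insert v K.2 else K.2)

/-- The condition that cuts down the number of states. -/
def Adm (K : DState n) : Prop :=
  -- The second clause records an exchange argument: if an unscheduled `y` in `P` precedes the first
  -- successor `w` of the late job `v`, then `v` and `y` can be swapped, which would pay off if `y`
  -- were shorter.
  K.2.card ≤ J.p ∧ ∀ v ∈ J.P, v ∈ K.1 → v ∉ K.2 → (∀ w, J.prec v w → w ∉ K.1) →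
    ∃ w, J.prec v w ∧ ∀ y ∈ J.P, y ∉ K.1 → J.prec y w → J.time v < J.time y

/-- `v` may be scheduled next. -/
def Ok (K : DState n) (v : Fin n) : Prop :=
  v ∉ K.1 ∧ (∀ u, J.prec u v → u ∈ K.1) ∧ J.allowed v (K.1.card + 1) ∧ J.Adm (J.next K v)

/-- The jobs of the list (the last one first) can be scheduled, leading to the given state. -/
inductive Path : List (Fin n) → DState n → Prop
  | nil : Path [] (∅, ∅)
  | cons {l : List (Fin n)} {K : DState n} {v : Fin n} (hl : Path l K) (hv : J.Ok K v) :
      Path (v :: l) (J.next K v)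

end

/-- Orderings that satisfy the constraints of the problem. -/
def good : Set (Equiv.Perm (Fin n)) :=
  {σ | (∀ u v, J.prec u v → pos σ u < pos σ v) ∧ (∀ v, J.allowed v (pos σ v)) ∧
    (J.P.filter fun v => pos σ v ≤ J.h).card = J.p}

variable [AddCommGroup R]

/-- Total completion time. -/
def cost (σ : Equiv.Perm (Fin n)) : R :=
  ∑ v, ∑ u ∈ Finset.univ.filter (fun u => pos σ u ≤ pos σ v), J.time u

/-- Total completion time of a list. -/
def listCost : List (Fin n) → R
  | [] => 0
  | v :: l => listCost l + ∑ u ∈ (v :: l).toFinset, J.time u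

/-- Appending a job to a schedule adds its own completion time, the total length of all jobs
scheduled so far, and leaves the other completion times alone. -/
lemma listCost_eq {l : List (Fin n)} (hl : l.Nodup) : J.listCost l =
    ∑ v ∈ l.toFinset, ∑ u ∈ l.toFinset.filter (fun u => place l u ≤ place l v), J.time u := by
  induction l with
  | nil => simp [listCost]
  | cons a l ih =>
    obtain ⟨ha, hl⟩ := List.nodup_cons.1 hl
    have hne : ∀ v ∈ l.toFinset, v ≠ a := fun v hv h => ha (by simpa [h] using hv)
    rw [listCost, ih hl, List.toFinset_cons, Finset.sum_insert (by simpa using ha),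
      Finset.sum_insert (s := l.toFinset) (by simpa using ha), add_comm]
    congr 1
    · rw [Finset.filter_true_of_mem, Finset.sum_insert (by simpa using ha)]
      intro u _
      simpa [place] using place_le_length (a :: l) u
    · refine Finset.sum_congr rfl fun v hv => Finset.sum_congr ?_ fun _ _ => rfl
      ext u
      have hv' := hne v hv
      have hlen := place_le_length l v
      simp only [Finset.mem_filter, Finset.mem_insert, place, if_neg hv']
      constructor
      · rintro ⟨hu, h⟩
        rw [if_neg (hne u hu)]; exact ⟨.inr hu, h⟩
      · rintro ⟨rfl | hu, h⟩
        · rw [if_pos rfl] at h; omega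
        · rw [if_neg (hne u hu)] at h; exact ⟨hu, h⟩

lemma cost_eq_listCost {l : List (Fin n)} (hl : l.Nodup) (hu : l.toFinset = Finset.univ)
    {σ : Equiv.Perm (Fin n)} (hσ : ∀ v, pos σ v = place l v) : J.cost σ = J.listCost l := by
  rw [J.listCost_eq hl, hu, cost]
  simp only [hσ]

variable [LinearOrder R] {J}

omit [AddCommGroup R] in
lemma Path.fst_eq {l : List (Fin n)} {K : DState n} (h : J.Path l K) :
    K.1 = l.toFinset ∧ l.Nodup := by
  induction h with
  | nil => simp
  | cons hl hv ih =>
    refine ⟨by simp [next, ih.1], List.nodup_cons.2 ⟨?_, ih.2⟩⟩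
    have := hv.1
    rw [ih.1] at this
    simpa using this

omit [AddCommGroup R] in
lemma Path.card_eq {l : List (Fin n)} {K : DState n} (h : J.Path l K) :
    K.1.card = l.length := by
  rw [h.fst_eq.1, List.toFinset_card_of_nodup h.fst_eq.2]

omit [AddCommGroup R] in
lemma Path.place_spec {l : List (Fin n)} {K : DState n} (h : J.Path l K) :
    (∀ v ∈ l, J.allowed v (place l v) ∧ ∀ u, J.prec u v → u ∈ l ∧ place l u < place l v) ∧
    K.2 = K.1.filter (fun v => v ∈ J.P ∧ place l v ≤ J.h) := by
  induction h with
  | nil => simp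
  | @cons l K v hl hv ih =>
    have hfst := hl.fst_eq
    have hvl : v ∉ l := by have := hv.1; rw [hfst.1] at this; simpa using this
    have hne : ∀ u ∈ l, u ≠ v := fun u hu h => hvl (h ▸ hu)
    have hlen := hl.card_eq
    refine ⟨fun x hx => ?_, ?_⟩
    · rcases List.mem_cons.1 hx with rfl | hx
      · refine ⟨?_, fun u hu => ?_⟩
        · simpa [place, ← hlen] using hv.2.2.1
        · have hul : u ∈ l := by have := hv.2.1 u hu; rw [hfst.1] at this; simpa using this
          refine ⟨by simp [hul], ?_⟩
          have := place_le_length l u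
          simp only [place, if_neg (hne u hul), if_true]; omega
      · obtain ⟨h₁, h₂⟩ := ih.1 x hx
        refine ⟨by simpa [place, hne x hx] using h₁, fun u hu => ?_⟩
        obtain ⟨h₃, h₄⟩ := h₂ u hu
        exact ⟨by simp [h₃], by simpa [place, hne x hx, hne u h₃] using h₄⟩
    · ext u
      have hv1 := hv.1
      simp only [next]
      by_cases huv : u = v
      · subst huv
        have hK2 : u ∉ K.2 := by rw [ih.2]; simp [hv1]
        have hpu : place (u :: l) u = K.1.card + 1 := by simp [place, hlen]
        rw [Finset.mem_filter, hpu]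
        split <;> rename_i hc
        · simpa using hc
        · simpa [hK2] using hc
      · have : (u ∈ if v ∈ J.P ∧ K.1.card + 1 ≤ J.h then insert v K.2 else K.2) ↔ u ∈ K.2 := by
          split <;> simp [huv]
        have hpu : place (v :: l) u = place l u := by simp [place, huv]
        rw [this, ih.2, Finset.mem_filter, Finset.mem_filter, hpu]
        simp [huv]

/-- A complete path gives a good ordering. -/
lemma Path.exists_perm {l : List (Fin n)} {K : DState n} (h : J.Path l K)
    (hu : K.1 = Finset.univ) (hp : K.2.card = J.p) :
    ∃ σ ∈ J.good, (∀ v, pos σ v = place l v) ∧ J.cost σ = J.listCost l := by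
  obtain ⟨hl, hnd⟩ := h.fst_eq
  have hmem : ∀ v, v ∈ l := fun v => by
    have : v ∈ K.1 := hu ▸ Finset.mem_univ v
    rw [hl] at this; simpa using this
  have hlen : l.length = n := by rw [← h.card_eq, hu]; simp
  have hinj : Function.Injective fun v : Fin n => (⟨place l v - 1, by
      have := place_pos (hmem v); have := place_le_length l v; omega⟩ : Fin n) := by
    intro u v huv
    have h₁ := place_pos (hmem u)
    have h₂ := place_pos (hmem v)
    simp only [Fin.mk.injEq] at huv
    exact place_injOn (hmem u) (hmem v) (by omega)
  set σ : Equiv.Perm (Fin n) := Equiv.ofBijective _ (Finite.injective_iff_bijective.1 hinj)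
  have hσ : ∀ v, pos σ v = place l v := fun v => by
    have := place_pos (hmem v)
    simp only [pos, σ, Equiv.ofBijective_apply]; omega
  obtain ⟨h₁, h₂⟩ := h.place_spec
  refine ⟨σ, ⟨fun u v huv => ?_, fun v => ?_, ?_⟩, hσ, ?_⟩
  · rw [hσ, hσ]; exact ((h₁ v (hmem v)).2 u huv).2
  · rw [hσ]; exact (h₁ v (hmem v)).1
  · rw [← hp, h₂, hu]
    congr 1
    ext v; simp [hσ]
  · exact J.cost_eq_listCost hnd (by rw [← hl, hu]) hσ

omit [LinearOrder R] in
-- The length of `u` enters the completion times of `u` and of all later jobs; as `σ u` counts from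
-- `0`, these are `n - σ u` jobs.
lemma cost_eq_sum (σ : Equiv.Perm (Fin n)) : J.cost σ = ∑ u, (n - (σ u : ℕ)) • J.time u := by
  simp only [cost, Finset.sum_filter]
  rw [Finset.sum_comm]
  refine Finset.sum_congr rfl fun u _ => ?_
  rw [← Finset.sum_filter, Finset.sum_const]
  congr 1
  rw [← Fin.card_Ici (σ u)]
  refine Finset.card_bij (fun v _ => σ v) (fun v hv => ?_) (fun _ _ _ _ h => σ.injective h)
    fun w hw => ⟨σ.symm w, ?_, by simp⟩
  · simpa [pos] using hv
  · simpa [pos] using hw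

/-- Only the coefficients of `v` and `y` change. They differ by `d = σ y - σ v > 0`, so the swap
saves `d • (time v - time y)`. -/
lemma cost_swap_lt [IsOrderedAddMonoid R] {σ : Equiv.Perm (Fin n)} {v y : Fin n} (hσ : σ v < σ y)
    (ht : J.time y < J.time v) : J.cost (σ * Equiv.swap v y) < J.cost σ := by
  have hne : v ≠ y := fun h => by simp [h] at hσ
  rw [← sub_pos, cost_eq_sum, cost_eq_sum, ← Finset.sum_sub_distrib]
  rw [Fintype.sum_eq_add v y hne]
  · simp only [Equiv.Perm.mul_apply, Equiv.swap_apply_left, Equiv.swap_apply_right]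
    obtain ⟨d, hd, he⟩ : ∃ d, d ≠ 0 ∧ n - (σ v : ℕ) = (n - (σ y : ℕ)) + d :=
      ⟨(σ y : ℕ) - σ v, by have := Fin.lt_def.1 hσ; omega,
        by have := Fin.lt_def.1 hσ; have := (σ y).2; omega⟩
    rw [he, add_nsmul, add_nsmul]
    have := nsmul_lt_nsmul_right hd ht
    have key : (n - (σ y : ℕ)) • J.time v + d • J.time v - (n - (σ y : ℕ)) • J.time v +
        ((n - (σ y : ℕ)) • J.time y - ((n - (σ y : ℕ)) • J.time y + d • J.time y)) =
        d • J.time v - d • J.time y := by abel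
    rw [key]; exact sub_pos.2 this
  · intro x hx
    simp [Equiv.swap_apply_of_ne_of_ne hx.1 hx.2]

/-- The jobs of `P` are related only to a set `M` disjoint from `P`; their predecessors belong to
the first `h` positions, and each of them has a successor. -/
structure Separated (J : Problem R n) (M : Finset (Fin n)) : Prop where
  time_injective : Function.Injective J.time
  disjoint : Disjoint J.P M
  succ_mem : ∀ v ∈ J.P, ∀ w, J.prec v w → w ∈ M
  succ_exists : ∀ v ∈ J.P, ∃ w, J.prec v w
  pred_early : ∀ v ∈ J.P, ∀ u, J.prec u v → ∀ i, J.allowed u i → i ≤ J.h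
  free : ∀ v ∈ J.P, ∀ i, J.allowed v i

variable {M : Finset (Fin n)}

omit [AddCommGroup R] [LinearOrder R] in
-- The job `y` moves forward, but stays beyond position `h`, behind all its predecessors; `v` moves
-- back, but not past a successor. Jobs of `P` are unrelated to each other and allowed everywhere.
-- Both positions exceed `h`, so the number of early jobs is kept.
lemma swap_mem_good (hJ : J.Separated M) {σ : Equiv.Perm (Fin n)} (hσ : σ ∈ J.good)
    {v y : Fin n} (hv : v ∈ J.P) (hy : y ∈ J.P) (hh : J.h < pos σ v) (hvy : pos σ v < pos σ y)
    (hsucc : ∀ w, J.prec v w → pos σ y < pos σ w) : σ * Equiv.swap v y ∈ J.good := by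
  obtain ⟨h₁, h₂, h₃⟩ := hσ
  have hP : ∀ x ∈ J.P, ∀ z ∈ J.P, ¬ J.prec x z := fun x hx z hz h =>
    Finset.disjoint_left.1 hJ.disjoint hz (hJ.succ_mem x hx z h)
  have pv : pos (σ * Equiv.swap v y) v = pos σ y := by simp [pos]
  have py : pos (σ * Equiv.swap v y) y = pos σ v := by simp [pos]
  have po : ∀ x, x ≠ v → x ≠ y → pos (σ * Equiv.swap v y) x = pos σ x := fun x h h' => by
    simp [pos, Equiv.swap_apply_of_ne_of_ne h h']
  have hpred : ∀ x ∈ J.P, ∀ u, J.prec u x → pos σ u ≤ J.h := fun x hx u hu =>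
    hJ.pred_early x hx u hu _ (h₂ u)
  refine ⟨fun a b hab => ?_, fun x => ?_, ?_⟩
  · by_cases hav : a = v
    · subst hav
      have hb : b ∉ J.P := fun hb => hP a hv b hb hab
      rw [pv, po b (fun h => hb (h ▸ hv)) (fun h => hb (h ▸ hy))]
      exact hsucc b hab
    by_cases hay : a = y
    · subst hay
      have hb : b ∉ J.P := fun hb => hP a hy b hb hab
      rw [py, po b (fun h => hb (h ▸ hv)) (fun h => hb (h ▸ hy))]
      exact hvy.trans (h₁ a b hab)
    rw [po a hav hay]
    by_cases hbv : b = v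
    · subst hbv
      rw [pv]; exact (h₁ a b hab).trans hvy
    by_cases hby : b = y
    · subst hby
      rw [py]; exact (hpred b hy a hab).trans_lt hh
    rw [po b hbv hby]; exact h₁ a b hab
  · by_cases hx : x ∈ J.P
    · exact hJ.free x hx _
    · rw [po x (fun h => hx (h ▸ hv)) (fun h => hx (h ▸ hy))]; exact h₂ x
  · rw [← h₃]
    congr 1
    ext x
    simp only [Finset.mem_filter]
    by_cases hxv : x = v
    · subst hxv; rw [pv]; constructor <;> rintro ⟨-, h⟩ <;> omega
    by_cases hxy : x = y
    · subst hxy; rw [py]; constructor <;> rintro ⟨-, h⟩ <;> omega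
    rw [po x hxv hxy]

variable [IsOrderedAddMonoid R]

/-- The required `w` is the earliest successor of `v`. An unscheduled `y` that precedes `w` stands
before all successors of `v`, so swapping `v` and `y` is feasible; by optimality and distinctness of
the lengths, `v` is shorter. -/
lemma adm_of_optimal (hJ : J.Separated M) {σ : Equiv.Perm (Fin n)} (hσ : σ ∈ J.good)
    (hopt : ∀ τ ∈ J.good, J.cost σ ≤ J.cost τ) (i : ℕ) :
    J.Adm (Finset.univ.filter fun v => pos σ v ≤ i,
      J.P.filter fun v => pos σ v ≤ i ∧ pos σ v ≤ J.h) := by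
  refine ⟨?_, fun v hv hvi hvE hN => ?_⟩
  · rw [← hσ.2.2]
    exact Finset.card_le_card fun v hv => by simp at hv ⊢; tauto
  · simp only [Finset.mem_filter, Finset.mem_univ, true_and, not_and, not_le] at hvi hvE hN ⊢
    have hvh := hvE hv hvi
    obtain ⟨w₀, hw₀⟩ := hJ.succ_exists v hv
    classical
    obtain ⟨w, hw, hmin⟩ := (Finset.univ.filter fun w => J.prec v w).exists_min_image (pos σ)
      ⟨w₀, by simpa using hw₀⟩
    simp only [Finset.mem_filter, Finset.mem_univ, true_and] at hw hmin
    refine ⟨w, hw, fun y hy hyi hyw => ?_⟩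
    have hlt : pos σ v < pos σ y := by omega
    by_contra hle
    have hne : J.time y ≠ J.time v := fun h => by
      rw [hJ.time_injective h] at hlt; omega
    have hty : J.time y < J.time v := lt_of_le_of_ne (not_lt.1 hle) hne
    refine absurd (hopt _ (swap_mem_good hJ hσ hv hy hvh hlt fun u hu => ?_)) (not_le.2
      (cost_swap_lt (by simpa [pos] using hlt) hty))
    exact (hσ.1 y w hyw).trans_le (hmin u hu)

/-- An optimal ordering gives a path. -/
lemma exists_path_of_optimal (hJ : J.Separated M) {σ : Equiv.Perm (Fin n)} (hσ : σ ∈ J.good)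
    (hopt : ∀ τ ∈ J.good, J.cost σ ≤ J.cost τ) :
    ∃ l K, J.Path l K ∧ K.1 = Finset.univ ∧ K.2.card = J.p ∧ J.listCost l = J.cost σ := by
  -- The states of the path are the prefixes of `σ`, built one position at a time.
  have key : ∀ i ≤ n, ∃ l, J.Path l (Finset.univ.filter fun v => pos σ v ≤ i,
      J.P.filter fun v => pos σ v ≤ i ∧ pos σ v ≤ J.h) ∧
      (∀ v, pos σ v ≤ i → place l v = pos σ v) ∧ l.length = i := by
    intro i
    induction i with
    | zero =>
      intro _
      refine ⟨[], ?_, fun v hv => by simp [pos] at hv, rfl⟩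
      simp [pos, Path.nil]
    | succ i ih =>
      intro hi
      obtain ⟨l, hl, hpl, hlen⟩ := ih (by omega)
      set v := σ.symm ⟨i, by omega⟩ with hv
      have hpv : pos σ v = i + 1 := by simp [hv, pos]
      have hiff : ∀ u, pos σ u ≤ i + 1 ↔ u = v ∨ pos σ u ≤ i := fun u => by
        constructor
        · intro h
          by_cases hu : pos σ u = i + 1
          · left
            apply σ.injective; apply Fin.ext
            simp only [pos] at hu hpv; omega
          · right; omega
        · rintro (rfl | h) <;> omega
      have hcard : (Finset.univ.filter fun v => pos σ v ≤ i).card = i := by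
        have := hl.card_eq; simpa [hlen] using this
      have hnext : J.next (Finset.univ.filter fun v => pos σ v ≤ i,
          J.P.filter fun v => pos σ v ≤ i ∧ pos σ v ≤ J.h) v =
          (Finset.univ.filter fun v => pos σ v ≤ i + 1,
          J.P.filter fun v => pos σ v ≤ i + 1 ∧ pos σ v ≤ J.h) := by
        simp only [next, hcard, Prod.mk.injEq]
        refine ⟨by ext u; simp [hiff], ?_⟩
        ext u
        by_cases huv : u = v
        · subst huv
          split <;> rename_i hc <;> simp [hpv] <;> grind
        · have h₁ := hiff u
          split <;> simp [huv, h₁]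
      refine ⟨v :: l, ?_, fun u hu => ?_, by simp [hlen]⟩
      · rw [← hnext]
        refine .cons hl ⟨by simp [hpv], fun u hu => ?_, ?_, ?_⟩
        · have := hσ.1 u v hu
          simp; omega
        · rw [hcard, ← hpv]; exact hσ.2.1 v
        · rw [hnext]; exact adm_of_optimal hJ hσ hopt _
      · simp only [place]
        split
        · rename_i huv; rw [huv, hpv, hlen]
        · rename_i huv
          exact hpl u (((hiff u).1 hu).resolve_left huv)
  obtain ⟨l, hl, hpl, hlen⟩ := key n le_rfl
  have hall : ∀ v, pos σ v ≤ n := fun v => by have := (σ v).2; simp only [pos]; omega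
  refine ⟨l, _, hl, by simp [hall], ?_, ?_⟩
  · simpa [hall] using hσ.2.2
  · refine (J.cost_eq_listCost hl.fst_eq.2 ?_ fun v => (hpl v (hall v)).symm).symm
    rw [← hl.fst_eq.1]; simp [hall]

end Problem

end Sched

namespace Sched

/-! ### The number of states -/

lemma card_powerset_filter_card_le {α : Type*} [DecidableEq α] (P : Finset α) (m : ℕ) :
    (P.powerset.filter fun D => D.card ≤ m).card = ∑ i ∈ Finset.range (m + 1), P.card.choose i := by
  rw [Finset.card_eq_sum_card_fiberwise (f := Finset.card) (t := Finset.range (m + 1))]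
  · refine Finset.sum_congr rfl fun i hi => ?_
    rw [← Finset.card_powersetCard]
    congr 1
    ext D
    simp only [Finset.mem_filter, Finset.mem_powerset, Finset.mem_powersetCard]
    have := Finset.mem_range.1 hi
    constructor
    · tauto
    · rintro ⟨h₁, h₂⟩; exact ⟨⟨h₁, by omega⟩, h₂⟩
  · intro D hD
    have : D.card ≤ m := by simp at hD; exact hD.2
    simp; omega

/-- In Vandermonde's identity for `(q + m).choose m` the second factor of each summand is at least
`1`. -/
lemma sum_choose_le_choose_add (q m : ℕ) :
    ∑ i ∈ Finset.range (m + 1), q.choose i ≤ (q + m).choose m := by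
  rw [Nat.add_choose_eq, Finset.Nat.sum_antidiagonal_eq_sum_range_succ_mk]
  refine Finset.sum_le_sum fun i hi => Nat.le_mul_of_pos_right _ (Nat.choose_pos (by omega))

/-- Binomial coefficients increase up to the middle, so the last of the `p + 1` summands is the
largest. -/
lemma sum_choose_le_mul_choose {q p : ℕ} (h : 2 * p < q) :
    ∑ i ∈ Finset.range (p + 1), q.choose i ≤ (p + 1) * q.choose p := by
  have hmono : ∀ i ≤ p, q.choose i ≤ q.choose p := fun i hi => by
    induction p, hi using Nat.le_induction with
    | base => rfl
    | succ p hp ih => exact (ih (by omega)).trans (Nat.choose_le_succ_of_lt_half_left (by omega))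
  simpa using Finset.sum_le_card_nsmul (Finset.range (p + 1)) _ (q.choose p)
    fun i hi => hmono i (by simp at hi; omega)

namespace Problem

variable {R : Type} {n : ℕ} {J : Problem R n} [LinearOrder R]

lemma Path.snd_subset {l : List (Fin n)} {K : DState n} (h : J.Path l K) :
    K.2 ⊆ K.1 ∩ J.P := by
  rw [h.place_spec.2]
  intro v hv
  simp only [Finset.mem_filter, Finset.mem_inter] at hv ⊢
  exact ⟨hv.1, hv.2.1⟩

lemma Path.adm {l : List (Fin n)} {K : DState n} (h : J.Path l K) : J.Adm K := by
  cases h with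
  | nil => exact ⟨by simp, by simp⟩
  | cons _ hv => exact hv.2.2.2

lemma Path.mem_of_prec {l : List (Fin n)} {K : DState n} (h : J.Path l K) {u v : Fin n}
    (hv : v ∈ K.1) (huv : J.prec u v) : u ∈ K.1 := by
  have h₁ := h.fst_eq.1
  have := (h.place_spec.1 v (by rw [h₁] at hv; simpa using hv)).2 u huv
  rw [h₁]; simpa using this.1

variable {M : Finset (Fin n)}

/-- This is the heart of the count. Once the part `Z` outside `P` and the early part `E` are fixed,
a state is determined by its late jobs of `P`. Admissibility forces the family of these late parts
to shatter only sets of size at most `|M|`, and the Sauer–Shelah inequality applies. -/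
lemma card_fiber_le (hJ : J.Separated M) (S : Finset (DState n))
    (hS : ∀ K ∈ S, ∃ l, J.Path l K) (Z E : Finset (Fin n)) :
    (S.filter fun K => (K.1 \ J.P, K.2) = (Z, E)).card ≤ n.choose M.card := by
  classical
  set F := S.filter fun K => (K.1 \ J.P, K.2) = (Z, E) with hF
  have hmem : ∀ K ∈ F, (∃ l, J.Path l K) ∧ K.1 \ J.P = Z ∧ K.2 = E := fun K hK => by
    rw [hF, Finset.mem_filter, Prod.mk.injEq] at hK
    exact ⟨hS K hK.1, hK.2⟩
  set 𝒜 : Finset (Finset (Fin n)) := F.image fun K => (K.1 ∩ J.P) \ E with h𝒜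
  have hcard : F.card = 𝒜.card := by
    refine (Finset.card_image_of_injOn fun K hK K' hK' h => ?_).symm
    obtain ⟨⟨l, hl⟩, h₁, h₂⟩ := hmem K hK
    obtain ⟨⟨l', hl'⟩, h₁', h₂'⟩ := hmem K' hK'
    have s := hl.snd_subset
    have s' := hl'.snd_subset
    refine Prod.ext ?_ (h₂.trans h₂'.symm)
    ext v
    have e₁ := Finset.ext_iff.1 (h₁.trans h₁'.symm) v
    have e₂ := Finset.ext_iff.1 h v
    have e₃ := @s v
    have e₄ := @s' v
    rw [h₂] at e₃
    rw [h₂'] at e₄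
    simp only [Finset.mem_sdiff, Finset.mem_inter] at e₁ e₂ e₃ e₄
    tauto
  have hsub : 𝒜.shatterer ⊆ J.P.powerset.filter fun D => D.card ≤ M.card := by
    intro D hD
    rw [Finset.mem_shatterer] at hD
    have hK : ∀ A ∈ 𝒜, ∃ K ∈ F, (K.1 ∩ J.P) \ E = A := fun A hA => by simpa [h𝒜] using hA
    have hDP : D ⊆ J.P \ E := by
      obtain ⟨A, hA, hDA⟩ := hD.exists_superset
      obtain ⟨K, -, rfl⟩ := hK A hA
      intro d hd
      have := hDA hd
      simp only [Finset.mem_sdiff, Finset.mem_inter] at this ⊢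
      tauto
    refine Finset.mem_filter.2 ⟨Finset.mem_powerset.2 (hDP.trans Finset.sdiff_subset), ?_⟩
    -- Shattering provides a state `K` whose late part meets `D` in `{d}` alone, so that the other
    -- elements of `D` are unscheduled in `K`, and a state `K₀` whose late part misses `D`.
    have hw : ∀ d ∈ D, ∃ w, J.prec d w ∧ ∀ d' ∈ D, d' ≠ d → J.prec d' w →
        J.time d < J.time d' := by
      intro d hd
      obtain ⟨A, hA, hdA⟩ := hD.exists_inter_eq_singleton hd
      obtain ⟨K, hKF, rfl⟩ := hK A hA
      obtain ⟨A₀, hA₀, hdA₀⟩ := hD (Finset.empty_subset D)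
      obtain ⟨K₀, hKF₀, rfl⟩ := hK A₀ hA₀
      obtain ⟨⟨l, hl⟩, h₁, h₂⟩ := hmem K hKF
      obtain ⟨⟨l₀, hl₀⟩, h₁₀, h₂₀⟩ := hmem K₀ hKF₀
      have hdP := Finset.mem_sdiff.1 (hDP hd)
      have hdK : d ∈ K.1 := by
        have := Finset.ext_iff.1 hdA d
        simp at this; tauto
      have hd₀ : d ∉ K₀.1 := by
        intro h
        have := Finset.ext_iff.1 hdA₀ d
        simp at this; tauto
      -- Admissibility applies to `d` in `K`: a scheduled successor of `d` would belong to `M`,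
      -- hence to the common part `Z`, hence to `K₀`, and then `K₀` would contain its predecessor
      -- `d`.
      obtain ⟨w, hw, hwy⟩ := hl.adm.2 d hdP.1 hdK (h₂ ▸ hdP.2) (fun w hw hwK => by
        have hwM := hJ.succ_mem d hdP.1 w hw
        have hwP : w ∉ J.P := fun h => Finset.disjoint_left.1 hJ.disjoint h hwM
        have : w ∈ K₀.1 \ J.P := by rw [h₁₀, ← h₁]; simp [hwK, hwP]
        exact hd₀ (hl₀.mem_of_prec (Finset.mem_sdiff.1 this).1 hw))
      refine ⟨w, hw, fun d' hd' hne hd'w => hwy d' (Finset.mem_sdiff.1 (hDP hd')).1 ?_ hd'w⟩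
      intro h
      have h₃ := Finset.mem_sdiff.1 (hDP hd')
      have := Finset.ext_iff.1 hdA d'
      simp only [Finset.mem_inter, Finset.mem_sdiff, Finset.mem_singleton, hne] at this
      tauto
    choose! w hw₁ hw₂ using hw
    -- If `d` and `d'` had the same `w`, each of them would be strictly shorter than the other.
    refine Finset.card_le_card_of_injOn w
      (fun d hd => hJ.succ_mem d (Finset.mem_sdiff.1 (hDP hd)).1 _ (hw₁ d hd)) ?_
    intro d hd d' hd' h
    by_contra hne
    have h₁ := hw₂ d hd d' hd' (Ne.symm hne) (by rw [h]; exact hw₁ d' hd')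
    have h₂ := hw₂ d' hd' d hd hne (by rw [← h]; exact hw₁ d hd)
    exact absurd h₁ h₂.not_gt
  have hPM : J.P.card + M.card ≤ n := by
    rw [← Finset.card_union_of_disjoint hJ.disjoint]
    simpa using Finset.card_le_univ (J.P ∪ M)
  calc F.card = 𝒜.card := hcard
    _ ≤ 𝒜.shatterer.card := 𝒜.card_le_card_shatterer
    _ ≤ _ := Finset.card_le_card hsub
    _ ≤ (J.P.card + M.card).choose M.card := by
      rw [card_powerset_filter_card_le]; exact sum_choose_le_choose_add _ _
    _ ≤ _ := Nat.choose_le_choose _ hPM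

/-- The number of states that occur on paths. -/
theorem card_states_le (hJ : J.Separated M) (hp : 2 * J.p < J.P.card) (S : Finset (DState n))
    (hS : ∀ K ∈ S, ∃ l, J.Path l K) :
    S.card ≤ n.choose M.card * (2 ^ (n - J.P.card) * ((J.p + 1) * J.P.card.choose J.p)) := by
  classical
  -- States are grouped by the part outside `P` and the early part; each group is bounded by
  -- `card_fiber_le`.
  refine (Finset.card_le_mul_card_image_of_maps_to (f := fun K : DState n => (K.1 \ J.P, K.2))
    (t := J.Pᶜ.powerset ×ˢ J.P.powerset.filter fun D => D.card ≤ J.p) (fun K hK => ?_)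
    (n.choose M.card) fun ZE _ => card_fiber_le hJ S hS ZE.1 ZE.2).trans ?_
  · obtain ⟨l, hl⟩ := hS K hK
    simp only [Finset.mem_product, Finset.mem_powerset, Finset.mem_filter]
    refine ⟨fun v hv => by simp at hv ⊢; exact hv.2, fun v hv => ?_, hl.adm.1⟩
    exact (Finset.mem_inter.1 (hl.snd_subset hv)).2
  · rw [Finset.card_product, Finset.card_powerset, Finset.card_compl, Fintype.card_fin,
      card_powerset_filter_card_le]
    gcongr
    exact sum_choose_le_mul_choose hp

end Problem

end Sched

namespace Sched

open Function

/-! ### Breadth-first search through the states -/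

/-- The data of the search: the states found so far in the order of discovery, the number of
transitions examined, and for each state the cost of a cheapest known path to it, its
predecessor on this path and the job scheduled last. -/
structure Search (R : Type) (n : ℕ) where
  queue : List (DState n)
  counter : ℕ
  val : DState n → R
  prev : DState n → DState n
  job : DState n → ℕ

namespace Problem

variable {R : Type} {n : ℕ} (J : Problem R n) [LinearOrder R] [AddCommGroup R]

/-- The cost of a path extended by `v`. -/
def cand (A : Search R n) (K : DState n) (v : Fin n) : R :=
  A.val K + ∑ u ∈ (J.next K v).1, J.time u

open Classical in
/-- Examine the transition from `K` that schedules `v`. -/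
noncomputable def relax (A : Search R n) (K : DState n) (v : Fin n) : Search R n :=
  if J.Ok K v then
    let b := J.next K v ∉ A.queue ∨ J.cand A K v < A.val (J.next K v)
    { queue := if J.next K v ∈ A.queue then A.queue else A.queue ++ [J.next K v]
      counter := A.counter + 1
      val := if b then update A.val (J.next K v) (J.cand A K v) else A.val
      prev := if b then update A.prev (J.next K v) K else A.prev
      job := if b then update A.job (J.next K v) v else A.job }
  else { A with counter := A.counter + 1 }

/-- The invariant of the search. -/
structure Inv (A : Search R n) : Prop where
  nodup : A.queue.Nodup
  path : ∀ K ∈ A.queue, ∃ l, J.Path l K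
  -- Transitions are numbered: `i * n + v` schedules job `v` in the state at index `i` of the queue.
  -- The recorded value is exact for the recorded predecessor.
  origin : ∀ K ∈ A.queue, K = (∅, ∅) ∨ ∃ (i : ℕ) (v : Fin n) (K' : DState n),
    A.queue[i]? = some K' ∧ i * n + v < A.counter ∧ J.Ok K' v ∧ K = J.next K' v ∧
      A.prev K = K' ∧ A.job K = v ∧ A.val K = A.val K' + ∑ u ∈ K.1, J.time u
  processed : ∀ (i : ℕ) (v : Fin n) (K : DState n), A.queue[i]? = some K →
    i * n + v < A.counter → J.Ok K v → J.next K v ∈ A.queue ∧ A.val (J.next K v) ≤ J.cand A K v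
  sorted : A.queue.Pairwise fun K K' => K.1.card ≤ K'.1.card
  -- As long as state `i` has unexamined transitions, nothing lies more than one level above it.
  -- This is what keeps the queue sorted when a state is appended.
  frontier : ∀ K ∈ A.queue, ∀ (i : ℕ) (K' : DState n), A.queue[i]? = some K' →
    A.counter < (i + 1) * n → K.1.card ≤ K'.1.card + 1
  counter_le : A.counter ≤ A.queue.length * n
  zero : A.queue[0]? = some (∅, ∅)
  val_zero : A.val (∅, ∅) = 0

omit [AddCommGroup R] in
lemma card_next {K : DState n} {v : Fin n} (h : J.Ok K v) :
    (J.next K v).1.card = K.1.card + 1 := Finset.card_insert_of_notMem h.1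

variable {J} in
lemma Inv.card_le {A : Search R n} (hA : J.Inv A) {i j : ℕ} {K K' : DState n} (hij : i ≤ j)
    (hi : A.queue[i]? = some K) (hj : A.queue[j]? = some K') : K.1.card ≤ K'.1.card := by
  rcases hij.eq_or_lt with rfl | hij
  · rw [hi] at hj; simp at hj; rw [hj]
  · obtain ⟨h₁, rfl⟩ := List.getElem?_eq_some_iff.1 hi
    obtain ⟨h₂, rfl⟩ := List.getElem?_eq_some_iff.1 hj
    exact List.pairwise_iff_getElem.1 hA.sorted i j h₁ h₂ hij

/-- The queue is sorted by cardinality and the new state has one job more than `K`, so it is none of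
the states at indices up to `j`. Hence the values of all states whose transitions have been or are
being examined are final; other values can only decrease. -/
lemma inv_relax {A : Search R n} (hA : J.Inv A) {j : ℕ} {K : DState n} {v : Fin n}
    (hj : A.queue[j]? = some K) (hc : A.counter = j * n + v) : J.Inv (J.relax A K v) := by
  classical
  have hKq : K ∈ A.queue := List.mem_of_getElem? hj
  have hjlen : j < A.queue.length := (List.getElem?_eq_some_iff.1 hj).1
  -- The pair of state index and job is recovered from the transition number by division by `n`.
  have hidx : ∀ (i : ℕ) (u : Fin n), i * n + u < A.counter + 1 → i ≤ j := fun i u h => by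
    by_contra hlt
    have hmul : (j + 1) * n ≤ i * n := Nat.mul_le_mul_right n (by omega)
    have := v.2
    rw [Nat.succ_mul] at hmul; omega
  have hlast : ∀ (i : ℕ) (u : Fin n), i * n + u < A.counter + 1 →
      i * n + u < A.counter ∨ (i = j ∧ u = v) := fun i u h => by
    by_cases h' : i * n + u < A.counter
    · exact .inl h'
    · have hij := hidx i u h
      have : i = j := by
        by_contra hne
        have hmul : (i + 1) * n ≤ j * n := Nat.mul_le_mul_right n (by omega)
        have := u.2
        rw [Nat.succ_mul] at hmul; omega
      subst this
      exact .inr ⟨rfl, Fin.ext (by omega)⟩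
  have hcl : A.counter + 1 ≤ A.queue.length * n := by
    have hmul : (j + 1) * n ≤ A.queue.length * n := Nat.mul_le_mul_right n (by omega)
    have := v.2
    rw [Nat.succ_mul] at hmul; omega
  by_cases hok : J.Ok K v
  swap
  · have : J.relax A K v = { A with counter := A.counter + 1 } := by simp [relax, hok]
    rw [this]
    refine ⟨hA.nodup, hA.path, fun K₁ h₁ => ?_, fun i u K₁ h₁ h₂ h₃ => ?_, hA.sorted,
      fun K₁ h₁ i K₂ h₂ h₃ => hA.frontier K₁ h₁ i K₂ h₂ (by simp at h₃; omega), hcl, hA.zero,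
      hA.val_zero⟩
    · rcases hA.origin K₁ h₁ with h | ⟨i, u, K₂, a, b, c⟩
      · exact .inl h
      · exact .inr ⟨i, u, K₂, a, b.trans (Nat.lt_succ_self _), c⟩
    · rcases hlast i u h₂ with h | ⟨rfl, rfl⟩
      · exact hA.processed i u K₁ h₁ h h₃
      · simp only at h₁
        rw [hj] at h₁; simp at h₁; exact absurd (h₁ ▸ h₃) hok
  set K' := J.next K v with hK'
  have hcard : K'.1.card = K.1.card + 1 := J.card_next hok
  have hne : ∀ (i : ℕ) (K₁ : DState n), i ≤ j → A.queue[i]? = some K₁ → K₁ ≠ K' := by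
    rintro i K₁ hi h rfl
    have := hA.card_le hi h hj
    omega
  have hne0 : ((∅, ∅) : DState n) ≠ K' := fun h => by rw [← h] at hcard; simp at hcard
  obtain ⟨lK, hlK⟩ := hA.path K hKq
  set b : Prop := K' ∉ A.queue ∨ J.cand A K v < A.val K' with hb
  have hfr : ∀ K₁ ∈ A.queue, K₁.1.card ≤ K.1.card + 1 := fun K₁ h₁ =>
    hA.frontier K₁ h₁ j K hj (by have := v.2; rw [Nat.succ_mul]; omega)
  set B := J.relax A K v with hB
  have eq₁ : B.queue = if K' ∈ A.queue then A.queue else A.queue ++ [K'] := by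
    simp [hB, relax, hok, hK']
  have eq₂ : B.counter = A.counter + 1 := by simp [hB, relax, hok]
  have eq₃ : B.val = if b then update A.val K' (J.cand A K v) else A.val := by
    simp [hB, relax, hok, hK', hb]
  have eq₄ : B.prev = if b then update A.prev K' K else A.prev := by
    simp [hB, relax, hok, hK', hb]
  have eq₅ : B.job = if b then update A.job K' (v : ℕ) else A.job := by
    simp [hB, relax, hok, hK', hb]
  have hmem : ∀ K₁, K₁ ∈ B.queue ↔ K₁ ∈ A.queue ∨ K₁ = K' := fun K₁ => by
    rw [eq₁]; split
    · constructor
      · exact .inl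
      · rintro (h | rfl) <;> assumption
    · simp
  have hget : ∀ (i : ℕ) (K₁ : DState n), A.queue[i]? = some K₁ → B.queue[i]? = some K₁ :=
    fun i K₁ h => by
      rw [eq₁]; split
      · exact h
      · rw [List.getElem?_append_left (List.getElem?_eq_some_iff.1 h).1, h]
  have hget' : ∀ (i : ℕ) (K₁ : DState n), B.queue[i]? = some K₁ →
      A.queue[i]? = some K₁ ∨ (K₁ = K' ∧ A.queue.length ≤ i) := fun i K₁ h => by
    rw [eq₁] at h
    split at h
    · exact .inl h
    · by_cases hi : i < A.queue.length
      · rw [List.getElem?_append_left hi] at h; exact .inl h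
      · rw [List.getElem?_append_right (by omega)] at h
        obtain ⟨h₁, h₂⟩ := List.getElem?_eq_some_iff.1 h
        simp at h₂
        exact .inr ⟨h₂.symm, by omega⟩
  have hval : ∀ K₁, K₁ ≠ K' → B.val K₁ = A.val K₁ := fun K₁ h => by
    rw [eq₃]; split
    · exact update_of_ne h _ _
    · rfl
  have hvalle : ∀ K₁ ∈ A.queue, B.val K₁ ≤ A.val K₁ := fun K₁ h => by
    by_cases hK₁ : K₁ = K'
    · subst hK₁
      rw [eq₃]; split <;> rename_i hb'
      · rw [update_self]; exact (hb'.resolve_left (not_not.2 h)).le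
      · rfl
    · exact (hval _ hK₁).le
  have hcandK : J.cand B K v = J.cand A K v := by
    simp only [cand, hval K (hne j K le_rfl hj)]
  have hvalK' : B.val K' ≤ J.cand A K v := by
    rw [eq₃]; split <;> rename_i hb'
    · rw [update_self]
    · rw [hb] at hb'; push Not at hb'; exact hb'.2
  refine ⟨?_, fun K₁ h₁ => ?_, fun K₁ h₁ => ?_, fun i u K₁ h₁ h₂ h₃ => ?_, ?_,
    fun K₁ h₁ i K₂ h₂ h₃ => ?_, ?_, hget 0 _ hA.zero, ?_⟩
  · rw [eq₁]; split
    · exact hA.nodup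
    · rename_i h
      exact hA.nodup.append (List.nodup_singleton _) (by simpa using h)
  · rcases (hmem K₁).1 h₁ with h | rfl
    · exact hA.path K₁ h
    · exact ⟨_, .cons hlK hok⟩
  · by_cases hbK : b ∧ K₁ = K'
    · obtain ⟨hb', rfl⟩ := hbK
      refine .inr ⟨j, v, K, hget j K hj, by omega, hok, rfl, ?_, ?_, ?_⟩
      · rw [eq₄, if_pos hb', update_self]
      · rw [eq₅, if_pos hb', update_self]
      · rw [eq₃, if_pos hb', update_self, update_of_ne (hne j K le_rfl hj)]; rfl
    · have hKA : K₁ ∈ A.queue := by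
        rcases (hmem K₁).1 h₁ with h | h
        · exact h
        · by_contra h'
          exact hbK ⟨.inl (h ▸ h'), h⟩
      have same : B.prev K₁ = A.prev K₁ ∧ B.job K₁ = A.job K₁ ∧ B.val K₁ = A.val K₁ := by
        rw [eq₃, eq₄, eq₅]
        by_cases hb' : b
        · have : K₁ ≠ K' := fun h => hbK ⟨hb', h⟩
          simp [hb', update_of_ne this]
        · simp [hb']
      rcases hA.origin K₁ hKA with h | ⟨i, u, K₂, g₁, g₂, g₃, g₄, g₅, g₆, g₇⟩
      · exact .inl h
      · refine .inr ⟨i, u, K₂, hget _ _ g₁, by omega, g₃, g₄, same.1.trans g₅, same.2.1.trans g₆, ?_⟩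
        rw [same.2.2, g₇, hval K₂ (hne i K₂ (hidx i u (by omega)) g₁)]
  · rw [eq₂] at h₂
    have hi := hidx i u h₂
    have hA₁ : A.queue[i]? = some K₁ := by
      rcases hget' i K₁ h₁ with h | ⟨-, h⟩
      · exact h
      · omega
    have hv₁ : B.val K₁ = A.val K₁ := hval _ (hne i K₁ hi hA₁)
    rcases hlast i u h₂ with h | ⟨rfl, rfl⟩
    · obtain ⟨p₁, p₂⟩ := hA.processed i u K₁ hA₁ h h₃
      refine ⟨(hmem _).2 (.inl p₁), (hvalle _ p₁).trans ?_⟩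
      simpa only [cand, hv₁] using p₂
    · rw [hj] at hA₁; simp at hA₁; subst hA₁
      exact ⟨(hmem _).2 (.inr rfl), hcandK ▸ hvalK'⟩
  · rw [eq₁]; split
    · exact hA.sorted
    · rw [List.pairwise_append]
      refine ⟨hA.sorted, List.pairwise_singleton _ _, fun K₁ h₁ K₂ h₂ => ?_⟩
      rw [List.mem_singleton.1 h₂, hcard]; exact hfr K₁ h₁
  · rw [eq₂] at h₃
    have hji : j ≤ i := by
      by_contra hlt
      have : (i + 1) * n ≤ j * n := Nat.mul_le_mul_right n (by omega)
      omega
    have h₁' : K₁.1.card ≤ K.1.card + 1 := by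
      rcases (hmem K₁).1 h₁ with h | rfl
      · exact hfr K₁ h
      · exact hcard.le
    rcases hget' i K₂ h₂ with h | ⟨rfl, -⟩
    · have := hA.card_le hji hj h; omega
    · omega
  · rw [eq₂]
    refine hcl.trans (Nat.mul_le_mul_right n ?_)
    rw [eq₁]; split
    · rfl
    · simp
  · rw [hval _ hne0, hA.val_zero]

lemma inv_init (A : Search R n) (hq : A.queue = [(∅, ∅)]) (hc : A.counter = 0)
    (hv : A.val (∅, ∅) = 0) : J.Inv A where
  nodup := by simp [hq]
  path K hK := by
    rw [hq, List.mem_singleton] at hK; exact ⟨[], hK ▸ .nil⟩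
  origin K hK := by rw [hq, List.mem_singleton] at hK; exact .inl hK
  processed i v K _ h := by omega
  sorted := by simp [hq]
  frontier K hK i K' hK' _ := by
    rw [hq, List.mem_singleton] at hK; simp [hK]
  counter_le := by omega
  zero := by simp [hq]
  val_zero := hv

/-- A path along the recorded predecessors. -/
inductive Chain (A : Search R n) : List (Fin n) → DState n → Prop
  | nil : Chain A [] (∅, ∅)
  | cons {l : List (Fin n)} {K : DState n} {v : Fin n} (hl : Chain A l K) (hv : J.Ok K v)
      (hprev : A.prev (J.next K v) = K) (hjob : A.job (J.next K v) = v) :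
      Chain A (v :: l) (J.next K v)

variable {J} {A : Search R n}

omit [AddCommGroup R] in
lemma Chain.path {l : List (Fin n)} {K : DState n} (h : J.Chain A l K) : J.Path l K := by
  induction h with
  | nil => exact .nil
  | cons _ hv _ _ ih => exact .cons ih hv

/-- Recorded predecessors have fewer jobs, so following them ends at the empty state; the exact
equations in `origin` add up to the recorded value. -/
lemma Inv.exists_chain (hA : J.Inv A) {K : DState n} (hK : K ∈ A.queue) :
    ∃ l, J.Chain A l K ∧ J.listCost l = A.val K := by
  induction hm : K.1.card using Nat.strong_induction_on generalizing K with
  | _ m ih =>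
    rcases hA.origin K hK with rfl | ⟨i, v, K', h₁, h₂, h₃, rfl, h₅, h₆, h₇⟩
    · exact ⟨[], .nil, by rw [hA.val_zero]; rfl⟩
    · obtain ⟨l, hl, hc⟩ := ih K'.1.card (by rw [← hm, J.card_next h₃]; omega)
        (List.mem_of_getElem? h₁) rfl
      refine ⟨v :: l, .cons hl h₃ h₅ h₆, ?_⟩
      rw [h₇, listCost, hc]
      congr 1
      rw [← (Path.cons hl.path h₃).fst_eq.1]

/-- When all transitions have been examined, `processed` is the Bellman inequality for every
transition, and it propagates along the path. -/
lemma Inv.mem_of_path [IsOrderedAddMonoid R] (hA : J.Inv A)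
    (hend : A.counter = A.queue.length * n) {l : List (Fin n)}
    {K : DState n} (h : J.Path l K) : K ∈ A.queue ∧ A.val K ≤ J.listCost l := by
  induction h with
  | nil => exact ⟨List.mem_of_getElem? hA.zero, by rw [hA.val_zero]; rfl⟩
  | @cons l K v hl hv ih =>
    obtain ⟨i, hi⟩ := List.getElem?_of_mem ih.1
    have hlen := (List.getElem?_eq_some_iff.1 hi).1
    have : (i + 1) * n ≤ A.queue.length * n := Nat.mul_le_mul_right n hlen
    have hvn := v.2
    rw [Nat.succ_mul] at this
    obtain ⟨h₁, h₂⟩ := hA.processed i v K hi (by omega) hv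
    refine ⟨h₁, h₂.trans ?_⟩
    rw [cand, listCost, (Path.cons hl hv).fst_eq.1]
    gcongr
    exact ih.2

end Problem

end Sched

namespace Sched

open Function

/-! ### Derived terms -/

namespace Tm

/-- Nonzero means true. Truncated `1 - e` is negation, products are conjunctions, sums are
disjunctions, and a bounded sum is an existential quantifier over jobs. -/
def notT (e : Tm) : Tm := .op .sub (.lit 1) e

def andT (e₁ e₂ : Tm) : Tm := .op .mul e₁ e₂

def orT (e₁ e₂ : Tm) : Tm := .op .add e₁ e₂

def impT (e₁ e₂ : Tm) : Tm := orT (notT e₁) e₂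

def ltT (e₁ e₂ : Tm) : Tm := notT (.le e₂ e₁)

def eqT (e₁ e₂ : Tm) : Tm := andT (.le e₁ e₂) (.le e₂ e₁)

/-- There is a job `k` such that `e`. -/
def exT (k : ℕ) (e : Tm) : Tm := .sum k e

/-- All jobs `k` satisfy `e`. -/
def allT (k : ℕ) (e : Tm) : Tm := notT (exT k (notT e))

/-- The number of jobs. -/
def size : Tm := .read 0 (.lit 0)

/-- `2 ^ e`, for `e` at most the number of jobs. -/
def powT (e : Tm) : Tm :=
  .letv 30 e (.prod 31 (.op .add (.lit 1) (ltT (.var 31) (.var 30))))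

/-- Bit `e` of `K`. -/
def bitT (K e : Tm) : Tm :=
  .op .sub (.op .div K (powT e))
    (.op .mul (.lit 2) (.op .div (.op .div K (powT e)) (.lit 2)))

/-- The number of bits `1` of `K` below the number of jobs. -/
def cardT (K : Tm) : Tm := .letv 28 K (.sum 29 (bitT (.var 28) (.var 29)))

section Eval

variable {R : Type} [LinearOrder R] (s : State R) (ρ : ℕ → ℕ)

/-- Positive terms are regarded as true. -/
def Tr (e : Tm) : Prop := e.eval s ρ ≠ 0

lemma tr_not (e : Tm) : Tr s ρ (notT e) ↔ ¬ Tr s ρ e := by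
  simp only [Tr, notT, Tm.eval, Op.app]; omega

lemma tr_and (e₁ e₂ : Tm) : Tr s ρ (andT e₁ e₂) ↔ Tr s ρ e₁ ∧ Tr s ρ e₂ := by
  simp [Tr, andT, Tm.eval, Op.app]

lemma tr_or (e₁ e₂ : Tm) : Tr s ρ (orT e₁ e₂) ↔ Tr s ρ e₁ ∨ Tr s ρ e₂ := by
  simp only [Tr, orT, Tm.eval, Op.app]; omega

lemma tr_imp (e₁ e₂ : Tm) : Tr s ρ (impT e₁ e₂) ↔ (Tr s ρ e₁ → Tr s ρ e₂) := by
  rw [impT, tr_or, tr_not]; tauto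

lemma tr_le (e₁ e₂ : Tm) : Tr s ρ (.le e₁ e₂) ↔ e₁.eval s ρ ≤ e₂.eval s ρ := by
  simp [Tr, Tm.eval]

lemma tr_lt (e₁ e₂ : Tm) : Tr s ρ (ltT e₁ e₂) ↔ e₁.eval s ρ < e₂.eval s ρ := by
  rw [ltT, tr_not, tr_le, not_le]

lemma tr_eq (e₁ e₂ : Tm) : Tr s ρ (eqT e₁ e₂) ↔ e₁.eval s ρ = e₂.eval s ρ := by
  rw [eqT, tr_and, tr_le, tr_le]; omega

lemma tr_gle (a : ℕ) (e₁ : Tm) (b : ℕ) (e₂ : Tm) :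
    Tr s ρ (.gle a e₁ b e₂) ↔ s.grp a (e₁.eval s ρ) ≤ s.grp b (e₂.eval s ρ) := by
  simp [Tr, Tm.eval]

lemma tr_let (k : ℕ) (e₁ e₂ : Tm) :
    Tr s ρ (.letv k e₁ e₂) ↔ Tr s (update ρ k (e₁.eval s ρ)) e₂ := Iff.rfl

variable {s} {n : ℕ} (hn : s.nat 0 0 = n)

include hn

lemma eval_sum (k : ℕ) (e : Tm) :
    (Tm.sum k e).eval s ρ = ∑ v : Fin n, e.eval s (update ρ k v) := by
  rw [Tm.eval, hn, Finset.sum_range]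

lemma tr_ex (k : ℕ) (e : Tm) : Tr s ρ (exT k e) ↔ ∃ v : Fin n, Tr s (update ρ k v) e := by
  simp only [Tr, exT, eval_sum ρ hn, ne_eq, Finset.sum_eq_zero_iff, Finset.mem_univ, true_imp_iff,
    not_forall]

lemma tr_all (k : ℕ) (e : Tm) : Tr s ρ (allT k e) ↔ ∀ v : Fin n, Tr s (update ρ k v) e := by
  simp only [allT, tr_not, tr_ex ρ hn, not_exists, not_not]

omit hn in
lemma eval_size : size.eval s ρ = s.nat 0 0 := rfl

lemma eval_pow (e : Tm) (h : e.eval s ρ ≤ n) : (powT e).eval s ρ = 2 ^ e.eval s ρ := by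
  set x := e.eval s ρ with hx
  have : (powT e).eval s ρ = ∏ i ∈ Finset.range n, if i < x then 2 else 1 := by
    simp only [powT, Tm.eval, hn, ← hx]
    refine Finset.prod_congr rfl fun i _ => ?_
    simp only [ltT, notT, Tm.eval, Op.app, update_self, update_of_ne (show (30 : ℕ) ≠ 31 by omega)]
    split <;> split <;> omega
  rw [this, ← Finset.prod_filter, Finset.prod_const]
  congr 1
  have : (Finset.range n).filter (fun i => i < x) = Finset.range x := by
    ext i; simp; omega
  rw [this, Finset.card_range]

lemma eval_bit (K e : Tm) (h : e.eval s ρ ≤ n) :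
    (bitT K e).eval s ρ = K.eval s ρ / 2 ^ e.eval s ρ % 2 := by
  simp only [bitT, Tm.eval, Op.app, eval_pow ρ hn e h]; omega

end Eval

end Tm

/-! ### Sets as numbers -/

section Bits

variable {n : ℕ}

/-- The number with the given set of positions of ones. -/
def bits (S : Finset (Fin n)) : ℕ := ∑ v ∈ S, 2 ^ (v : ℕ)

lemma bits_testBit (S : Finset (Fin n)) (i : ℕ) :
    (bits S).testBit i ↔ ∃ v ∈ S, (v : ℕ) = i := by
  have h : bits S = ∑ i ∈ S.map Fin.valEmbedding, 2 ^ i := by simp [bits]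
  have := Finset.toFinset_bitIndices_sum_two_pow (S.map Fin.valEmbedding)
  rw [← h] at this
  rw [← Nat.mem_bitIndices, ← List.mem_toFinset, this]
  simp

lemma bits_lt (S : Finset (Fin n)) : bits S < 2 ^ n := by
  refine Nat.lt_pow_two_of_testBit _ fun i hi => ?_
  rw [Bool.eq_false_iff, ne_eq, bits_testBit]
  rintro ⟨v, -, rfl⟩
  exact absurd v.2 (by omega)

lemma bits_div (S : Finset (Fin n)) (v : Fin n) :
    bits S / 2 ^ (v : ℕ) % 2 = if v ∈ S then 1 else 0 := by
  have h := bits_testBit S v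
  rw [Nat.testBit_eq_decide_div_mod_eq] at h
  simp only [decide_eq_true_eq, Fin.val_inj, exists_eq_right] at h
  split <;> rename_i hv
  · exact h.2 hv
  · have := mt h.1 hv; omega

lemma bits_injective : Function.Injective (bits (n := n)) := fun S T h => by
  ext v
  have h₁ := bits_div S v
  rw [h, bits_div] at h₁
  split at h₁ <;> split at h₁ <;> simp_all

lemma bits_insert {S : Finset (Fin n)} {v : Fin n} (h : v ∉ S) :
    bits (insert v S) = bits S + 2 ^ (v : ℕ) := by
  rw [bits, Finset.sum_insert h, add_comm]; rfl

/-- The number that represents a state in the memory. -/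
def DState.code (K : DState n) : ℕ := bits K.1 + 2 ^ n * bits K.2

lemma DState.code_div (K : DState n) : K.code / 2 ^ n = bits K.2 := by
  rw [DState.code, Nat.add_mul_div_left _ _ (by positivity), Nat.div_eq_of_lt (bits_lt _), zero_add]

lemma DState.code_bit (K : DState n) (v : Fin n) :
    K.code / 2 ^ (v : ℕ) % 2 = if v ∈ K.1 then 1 else 0 := by
  rw [← bits_div, DState.code]
  obtain ⟨d, hd⟩ : ∃ d, n = v + 1 + d := ⟨n - (v + 1), by omega⟩
  have : 2 ^ n * bits K.2 = 2 ^ (v : ℕ) * (2 * (2 ^ d * bits K.2)) := by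
    nth_rw 1 [hd]; ring
  rw [this, Nat.add_mul_div_left _ _ (by positivity)]
  omega

lemma DState.code_lt (K : DState n) : K.code < 2 ^ (2 * n) := by
  have h₁ := bits_lt K.1
  have h₂ := bits_lt K.2
  rw [DState.code, two_mul, pow_add]
  nlinarith

lemma DState.code_injective : Function.Injective (DState.code (n := n)) := fun K K' h => by
  have h₂ : bits K.2 = bits K'.2 := by rw [← DState.code_div, h, DState.code_div]
  refine Prod.ext (bits_injective ?_) (bits_injective h₂)
  rw [DState.code, DState.code, h₂] at h
  omega

@[simp] lemma DState.code_empty : DState.code ((∅, ∅) : DState n) = 0 := by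
  simp [DState.code, bits]

end Bits

end Sched

namespace Sched

open Function Tm

/-! ### The dynamic program -/

/-- Terms that describe a problem: `prec` has the free variables `8` and `9` (two jobs), `allowed`
has `8` (a job) and `9` (a position), `inP` has `8` (a job); `h` is closed; `out` translates the
position `8` for the output. -/
structure Coding where
  prec : Tm
  allowed : Tm
  inP : Tm
  h : Tm
  out : Tm

/-- The arrays of the input agree. -/
def SameInput {R : Type} (base s : State R) : Prop :=
  (∀ a ≤ 3, s.nat a = base.nat a) ∧ s.grp 0 = base.grp 0

section

variable {R : Type} [LinearOrder R] {n : ℕ}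

/-- The terms of `C` describe the problem `J` whenever the memory contains the input `base`;
`f` is the translation of positions. -/
structure Coding.Describes (C : Coding) (J : Problem R n) (base : State R) (f : ℕ → ℕ) : Prop where
  size : base.nat 0 0 = n
  goal : base.nat 0 4 = J.p
  time : ∀ v : Fin n, base.grp 0 v = J.time v
  prec : ∀ s, SameInput base s → ∀ (ρ : ℕ → ℕ) (u v : Fin n), ρ 8 = u → ρ 9 = v →
    (Tr s ρ C.prec ↔ J.prec u v)
  allowed : ∀ s, SameInput base s → ∀ (ρ : ℕ → ℕ) (v : Fin n) (i : ℕ), ρ 8 = v → ρ 9 = i →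
    1 ≤ i → i ≤ n → (Tr s ρ C.allowed ↔ J.allowed v i)
  inP : ∀ s, SameInput base s → ∀ (ρ : ℕ → ℕ) (v : Fin n), ρ 8 = v → (Tr s ρ C.inP ↔ v ∈ J.P)
  h : ∀ s, SameInput base s → ∀ ρ : ℕ → ℕ, C.h.eval s ρ = J.h
  out : ∀ s, SameInput base s → ∀ (ρ : ℕ → ℕ) (i : ℕ), ρ 8 = i → C.out.eval s ρ = f i

namespace Coding

variable (C : Coding)

def precT (e₁ e₂ : Tm) : Tm := .letv 8 e₁ (.letv 9 e₂ C.prec)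

def allowedT (e₁ e₂ : Tm) : Tm := .letv 8 e₁ (.letv 9 e₂ C.allowed)

def inPT (e : Tm) : Tm := .letv 8 e C.inP

/-- The state that follows the state `0` when job `1` is scheduled. -/
def nextT : Tm :=
  .op .add (.op .add (.var 0) (powT (.var 1)))
    -- The double negation reduces a truth value to `0` or `1`, so that it can serve as a factor.
    (.op .mul (notT (notT (andT (C.inPT (.var 1)) (.le (.op .add (cardT (.var 0)) (.lit 1)) C.h))))
      (.op .mul (powT size) (powT (.var 1))))

/-- The set of jobs of `P` scheduled early, in the state `K`. -/
def early (K : Tm) : Tm := .op .div K (powT size)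

/-- The state `2` is admissible. -/
def admT : Tm :=
  andT (.le (cardT (early (.var 2))) (.read 0 (.lit 4)))
    (allT 3 (impT
      (andT (C.inPT (.var 3)) (andT (bitT (.var 2) (.var 3)) (andT
        (notT (bitT (early (.var 2)) (.var 3)))
        (allT 4 (impT (C.precT (.var 3) (.var 4)) (notT (bitT (.var 2) (.var 4))))))))
      (exT 4 (andT (C.precT (.var 3) (.var 4)) (allT 5 (impT
        (andT (C.inPT (.var 5)) (andT (notT (bitT (.var 2) (.var 5)))
          (C.precT (.var 5) (.var 4))))
        (notT (.gle 0 (.var 5) 0 (.var 3)))))))))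

/-- Job `1` may be scheduled in the state `0`. -/
def okT : Tm :=
  andT (notT (bitT (.var 0) (.var 1)))
    (andT (allT 3 (impT (C.precT (.var 3) (.var 1)) (bitT (.var 0) (.var 3))))
      (andT (C.allowedT (.var 1) (.op .add (cardT (.var 0)) (.lit 1)))
        (.letv 2 C.nextT C.admT)))

variable {C} {J : Problem R n} {base s : State R} {f : ℕ → ℕ} (hC : C.Describes J base f)
  (hs : SameInput base s) {ρ : ℕ → ℕ}

include hC hs

lemma Describes.size_eq : s.nat 0 0 = n := by rw [hs.1 0 (by omega), hC.size]

/-- The term `e₂` is evaluated after variable `8` has been rebound, so its value must not depend on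
that variable. -/
lemma Describes.tr_prec {e₁ e₂ : Tm} {u v : Fin n} (h₁ : e₁.eval s ρ = u)
    (h₂ : ∀ x, e₂.eval s (update ρ 8 x) = v) : Tr s ρ (C.precT e₁ e₂) ↔ J.prec u v := by
  rw [precT, tr_let, tr_let, h₁, h₂]
  exact hC.prec s hs _ u v (by simp) (by simp)

lemma Describes.tr_inP {e : Tm} {v : Fin n} (h : e.eval s ρ = v) :
    Tr s ρ (C.inPT e) ↔ v ∈ J.P := by
  rw [inPT, tr_let, h]; exact hC.inP s hs _ v (by simp)

omit hC hs in
lemma tr_bit (hn : s.nat 0 0 = n) {K e : Tm} {S : DState n} {v : Fin n}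
    (hK : K.eval s ρ = S.code) (he : e.eval s ρ = v) : Tr s ρ (bitT K e) ↔ v ∈ S.1 := by
  rw [Tr, eval_bit ρ hn K e (by rw [he]; exact v.2.le), hK, he, DState.code_bit]
  simp

omit hC hs in
lemma tr_bit_early (hn : s.nat 0 0 = n) {K e : Tm} {S : DState n} {v : Fin n}
    (hK : K.eval s ρ = S.code) (he : e.eval s ρ = v) : Tr s ρ (bitT (early K) e) ↔ v ∈ S.2 := by
  have : (early K).eval s ρ = bits S.2 := by
    rw [early, Tm.eval, eval_pow ρ hn _ (by rw [eval_size, hn]), eval_size, hn, hK]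
    exact DState.code_div S
  rw [Tr, eval_bit ρ hn _ e (by rw [he]; exact v.2.le), this, he, bits_div]
  simp

omit hC hs in
lemma eval_card (hn : s.nat 0 0 = n) {K : Tm} {S : DState n} (hK : K.eval s ρ = S.code) :
    (cardT K).eval s ρ = S.1.card := by
  rw [cardT, Tm.eval, eval_sum _ hn, hK]
  have hb : ∀ (x : ℕ) (v : Fin n), (bitT (.var 28) (.var 29)).eval s
      (update (update ρ 28 x) 29 v) = x / 2 ^ (v : ℕ) % 2 := fun x v => by
    rw [eval_bit _ hn _ _ (by simp [Tm.eval, v.2.le])]; simp [Tm.eval]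
  simp_rw [hb]
  simp [DState.code_bit]

omit hC hs in
lemma eval_card_early (hn : s.nat 0 0 = n) {K : Tm} {S : DState n} (hK : K.eval s ρ = S.code) :
    (cardT (early K)).eval s ρ = S.2.card := by
  have : (early K).eval s ρ = bits S.2 := by
    rw [early, Tm.eval, eval_pow ρ hn _ (by rw [eval_size, hn]), eval_size, hn, hK]
    exact DState.code_div S
  rw [cardT, Tm.eval, eval_sum _ hn, this]
  have hb : ∀ (x : ℕ) (v : Fin n), (bitT (.var 28) (.var 29)).eval s
      (update (update ρ 28 x) 29 v) = x / 2 ^ (v : ℕ) % 2 := fun x v => by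
    rw [eval_bit _ hn _ _ (by simp [Tm.eval, v.2.le])]; simp [Tm.eval]
  simp_rw [hb]
  simp [bits_div]

/-- Adding `2 ^ v` inserts `v` only if the bit is not set yet, hence both nonmembership assumptions.
The early set occupies the bits from `n` on. -/
lemma Describes.eval_next {K : DState n} {v : Fin n} (h₀ : ρ 0 = K.code) (h₁ : ρ 1 = v)
    (hv : v ∉ K.1) (hv' : v ∉ K.2) : C.nextT.eval s ρ = (J.next K v).code := by
  have hn := hC.size_eq hs
  have hb : Tr s ρ (andT (C.inPT (.var 1)) (.le (.op .add (cardT (.var 0)) (.lit 1)) C.h)) ↔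
      v ∈ J.P ∧ K.1.card + 1 ≤ J.h := by
    rw [tr_and, tr_le, hC.tr_inP hs (e := .var 1) (v := v) h₁, hC.h s hs]
    simp [Tm.eval, Op.app, eval_card hn (show (Tm.var 0).eval s ρ = K.code from h₀)]
  have hb' : (notT (notT (andT (C.inPT (.var 1))
      (.le (.op .add (cardT (.var 0)) (.lit 1)) C.h)))).eval s ρ =
      if v ∈ J.P ∧ K.1.card + 1 ≤ J.h then 1 else 0 := by
    simp only [Tr] at hb
    simp only [notT, Tm.eval, Op.app, ← hb]
    split <;> omega
  have hp₁ : (powT (.var 1)).eval s ρ = 2 ^ (v : ℕ) := by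
    rw [eval_pow ρ hn _ (by simp only [Tm.eval, h₁]; exact v.2.le)]; simp [Tm.eval, h₁]
  have hp₂ : (powT Tm.size).eval s ρ = 2 ^ n := by
    rw [eval_pow ρ hn _ (by rw [eval_size, hn]), eval_size, hn]
  rw [nextT]
  simp only [Tm.eval, Op.app, h₀] at hb' ⊢
  rw [hb', hp₁, hp₂, Problem.next, DState.code, DState.code, bits_insert hv]
  split
  · rw [bits_insert hv']; ring
  · ring

lemma Describes.tr_adm {K : DState n} (h₂ : ρ 2 = K.code) : Tr s ρ C.admT ↔ J.Adm K := by
  have hn := hC.size_eq hs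
  rw [admT, tr_and, tr_le, eval_card_early hn (show (Tm.var 2).eval s ρ = K.code from h₂),
    tr_all ρ hn, Problem.Adm]
  refine and_congr ?_ (forall_congr' fun v => ?_)
  · simp only [Tm.eval]; rw [hs.1 0 (by omega), hC.goal]
  · rw [tr_imp, tr_and, tr_and, tr_and, hC.tr_inP hs (v := v) (by simp [Tm.eval]),
      tr_bit hn (S := K) (v := v) (by simp [Tm.eval, h₂]) (by simp [Tm.eval]),
      tr_not, tr_bit_early hn (S := K) (v := v) (by simp [Tm.eval, h₂]) (by simp [Tm.eval]),
      tr_all _ hn, tr_ex _ hn]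
    rw [and_imp, and_imp, and_imp]
    refine imp_congr_right fun _ => imp_congr_right fun _ => imp_congr_right fun _ =>
      imp_congr (forall_congr' fun w => ?_) (exists_congr fun w => ?_)
    · rw [tr_imp, tr_not, hC.tr_prec hs (u := v) (v := w) (by simp [Tm.eval]) (by simp [Tm.eval]),
        tr_bit hn (S := K) (v := w) (by simp [Tm.eval, h₂]) (by simp [Tm.eval])]
    · rw [tr_and, hC.tr_prec hs (u := v) (v := w) (by simp [Tm.eval]) (by simp [Tm.eval]),
        tr_all _ hn]
      refine and_congr_right fun _ => forall_congr' fun y => ?_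
      rw [tr_imp, tr_and, tr_and, hC.tr_inP hs (v := y) (by simp [Tm.eval]), tr_not, tr_not,
        tr_bit hn (S := K) (v := y) (by simp [Tm.eval, h₂]) (by simp [Tm.eval]),
        hC.tr_prec hs (u := y) (v := w) (by simp [Tm.eval]) (by simp [Tm.eval]), tr_gle]
      simp only [Tm.eval, update_self, update_of_ne (show (3 : ℕ) ≠ 5 by omega),
        update_of_ne (show (3 : ℕ) ≠ 4 by omega), hs.2, hC.time, not_le]
      tauto

lemma Describes.tr_ok {K : DState n} {v : Fin n} (h₀ : ρ 0 = K.code) (h₁ : ρ 1 = v)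
    (hK : K.2 ⊆ K.1) : Tr s ρ C.okT ↔ J.Ok K v := by
  have hn := hC.size_eq hs
  have hc : ∀ x, (cardT (.var 0)).eval s (update ρ 8 x) = K.1.card := fun x =>
    eval_card hn (by simp [Tm.eval, h₀])
  rw [okT, tr_and, tr_and, tr_and, tr_not,
    tr_bit hn (S := K) (v := v) (by simp [Tm.eval, h₀]) (by simp [Tm.eval, h₁]), tr_all _ hn,
    Problem.Ok]
  refine and_congr_right fun hv => and_congr (forall_congr' fun u => ?_) (and_congr ?_ ?_)
  · rw [tr_imp, hC.tr_prec hs (u := u) (v := v) (by simp [Tm.eval]) (by simp [Tm.eval, h₁]),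
      tr_bit hn (S := K) (v := u) (by simp [Tm.eval, h₀]) (by simp [Tm.eval])]
  · rw [allowedT, tr_let, tr_let]
    refine hC.allowed s hs _ v _ (by simp [Tm.eval, h₁]) ?_ (by omega) ?_
    · rw [update_self]
      exact congrArg (· + 1) (hc (ρ 1))
    · have := Finset.card_lt_univ_of_notMem hv
      simpa using this
  · rw [tr_let]
    exact hC.tr_adm hs (by rw [update_self, hC.eval_next hs h₀ h₁ hv (fun h => hv (hK h))])

end Coding

end

end Sched

/-! ### One transition of the search on the machine -/

namespace Sched

open Function Tm

namespace Coding

variable (C : Coding)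

/-- The state that is being processed. -/
def keyT : Tm := .read 8 (.op .div (.read 6 (.lit 0)) size)

/-- The job that is being tried. -/
def jobT : Tm := .op .sub (.read 6 (.lit 0)) (.op .mul size (.op .div (.read 6 (.lit 0)) size))

def okTop : Tm := .letv 0 keyT (.letv 1 jobT C.okT)

def nextTop : Tm := .letv 0 keyT (.letv 1 jobT C.nextT)

/-- For each state code, weight array `1` holds the total length of its jobs and array `2` the best
known cost; cell `0` of array `3` receives the candidate cost for comparison. -/
def sumCmd : Cmd :=
  .seq (.gset 1 C.nextTop 1 keyT 0 jobT) (.gset 3 (.lit 0) 2 keyT 1 C.nextTop)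

/-- Array `9` marks the states already found. The mark has to be read here before `pushCmd` sets it;
a new state is always recorded, a known one only if it gets cheaper. -/
def improveCmd : Cmd :=
  .ite (orT (notT (.read 9 C.nextTop)) (notT (.gle 2 C.nextTop 3 (.lit 0))))
    (.seq (.gset 2 C.nextTop 2 keyT 1 C.nextTop)
      (.seq (.assign 10 (by omega) C.nextTop jobT) (.assign 11 (by omega) C.nextTop keyT))) .skip

def pushCmd : Cmd :=
  .ite (notT (.read 9 C.nextTop))
    (.seq (.assign 9 (by omega) C.nextTop (.lit 1))
      (.seq (.assign 8 (by omega) (.read 7 (.lit 0)) C.nextTop)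
        (.assign 7 (by omega) (.lit 0) (.op .add (.read 7 (.lit 0)) (.lit 1))))) .skip

/-- Examine one transition. -/
def relaxCmd : Cmd :=
  .seq (.ite C.okTop (.seq C.sumCmd (.seq C.improveCmd C.pushCmd)) .skip)
    (.assign 6 (by omega) (.lit 0) (.op .add (.read 6 (.lit 0)) (.lit 1)))

/-- There is a transition to be examined. -/
def moreT : Tm := ltT (.read 6 (.lit 0)) (.op .mul (.read 7 (.lit 0)) size)

variable {C} {R : Type} [AddCommGroup R] [LinearOrder R] {n : ℕ}

/-- The memory represents the data of the search. -/
structure Rep (J : Problem R n) (base s : State R) (A : Search R n) : Prop where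
  input : SameInput base s
  counter : s.nat 6 0 = A.counter
  length : s.nat 7 0 = A.queue.length
  queue : ∀ i K, A.queue[i]? = some K → s.nat 8 i = K.code
  seen : ∀ K : DState n, s.nat 9 K.code = if K ∈ A.queue then 1 else 0
  job : ∀ K : DState n, s.nat 10 K.code = A.job K
  prev : ∀ K : DState n, s.nat 11 K.code = (A.prev K).code
  sum : ∀ K ∈ A.queue, s.grp 1 K.code = ∑ u ∈ K.1, J.time u
  val : ∀ K : DState n, s.grp 2 K.code = A.val K

/-- The transition examined in the memory `s` is to schedule `v` in the state `K`. -/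
def At (base s : State R) (c : ℕ) (K : DState n) (v : Fin n) : Prop :=
  SameInput base s ∧ s.nat 6 0 = c ∧ s.nat 8 (c / n) = K.code ∧ c % n = v

omit [AddCommGroup R] [LinearOrder R] in
lemma SameInput.setNat {base s : State R} (h : SameInput base s) {a : ℕ} (ha : 3 < a) (i x : ℕ) :
    SameInput base (s.setNat a i x) :=
  ⟨fun b hb => by rw [State.setNat_nat_of_ne _ _ _ _ (by omega), h.1 b hb], h.2⟩

omit [AddCommGroup R] [LinearOrder R] in
lemma SameInput.setGrp {base s : State R} (h : SameInput base s) {a : ℕ} (ha : a ≠ 0) (i : ℕ)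
    (x : R) : SameInput base (s.setGrp a i x) := by
  refine ⟨h.1, ?_⟩
  rw [← h.2]; funext j; rw [State.setGrp_grp, if_neg (by omega)]

omit [AddCommGroup R] [LinearOrder R] in
lemma At.setNat {base s : State R} {c : ℕ} {K : DState n} {v : Fin n} (h : At base s c K v)
    {a : ℕ} (h₁ : 8 < a) (i x : ℕ) : At base (s.setNat a i x) c K v :=
  ⟨SameInput.setNat h.1 (by omega) i x, by rw [State.setNat_nat_of_ne _ _ _ _ (by omega), h.2.1],
    by rw [State.setNat_nat_of_ne _ _ _ _ (by omega), h.2.2.1], h.2.2.2⟩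

omit [AddCommGroup R] [LinearOrder R] in
lemma At.setGrp {base s : State R} {c : ℕ} {K : DState n} {v : Fin n} (h : At base s c K v)
    {a : ℕ} (ha : a ≠ 0) (i : ℕ) (x : R) : At base (s.setGrp a i x) c K v :=
  ⟨SameInput.setGrp h.1 ha i x, h.2⟩

variable {J : Problem R n} {base : State R} {f : ℕ → ℕ} (hC : C.Describes J base f)

section AtLemmas

variable {s : State R} {c : ℕ} {K : DState n} {v : Fin n} (h : At base s c K v)

include hC h

omit [AddCommGroup R] in
lemma At.eval_key (ρ : ℕ → ℕ) : keyT.eval s ρ = K.code := by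
  simp only [keyT, Tm.eval, Op.app, Tm.size, hC.size_eq h.1, h.2.1, h.2.2.1]

omit [AddCommGroup R] in
lemma At.eval_job (ρ : ℕ → ℕ) : jobT.eval s ρ = v := by
  simp only [jobT, Tm.eval, Op.app, Tm.size, hC.size_eq h.1, h.2.1, ← h.2.2.2]
  have := Nat.div_add_mod c n
  omega

omit [AddCommGroup R] in
lemma At.tr_ok (hK : K.2 ⊆ K.1) : Tr s 0 C.okTop ↔ J.Ok K v := by
  rw [okTop, tr_let, tr_let, At.eval_key hC h, At.eval_job hC h]
  exact hC.tr_ok h.1 (by simp) (by simp) hK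

omit [AddCommGroup R] in
lemma At.eval_next (hK : K.2 ⊆ K.1) (hok : J.Ok K v) :
    C.nextTop.eval s 0 = (J.next K v).code := by
  rw [nextTop, Tm.eval, Tm.eval, At.eval_key hC h, At.eval_job hC h]
  exact hC.eval_next h.1 (by simp) (by simp) hok.1 fun h' => hok.1 (hK h')

end AtLemmas

include hC

open Classical in
-- Codes are injective, so a write at the code of the new state affects no other state. The size
-- bound survives because codes have at most `2 * n` bits and the two counters are bounded by
-- assumption.
lemma Rep.relax {s : State R} {A : Search R n} (hr : Rep J base s A) (hA : J.Inv A)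
    {K : DState n} {v : Fin n} (hat : At base s A.counter K v)
    (hj : A.queue[A.counter / n]? = some K) :
    Rep J base (C.relaxCmd.den s) (J.relax A K v) ∧
      (∀ a, a < 6 ∨ 11 < a → (C.relaxCmd.den s).nat a = s.nat a) ∧
      ∀ L, s.Bounded L → 2 * n ≤ L → A.counter + 1 < 2 ^ L → A.queue.length + 1 < 2 ^ L →
        (C.relaxCmd.den s).Bounded L := by
  have hKq : K ∈ A.queue := List.mem_of_getElem? hj
  obtain ⟨lK, hlK⟩ := hA.path K hKq
  have hK : K.2 ⊆ K.1 := hlK.snd_subset.trans Finset.inter_subset_left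
  have hcode : ∀ (L : ℕ) (K' : DState n), 2 * n ≤ L → K'.code < 2 ^ L := fun L K' hL =>
    K'.code_lt.trans_le (Nat.pow_le_pow_right (by omega) hL)
  by_cases hok : J.Ok K v
  swap
  · have hden : C.relaxCmd.den s = s.setNat 6 0 (A.counter + 1) := by
      have h₁ : ¬ (C.okTop.eval s 0 ≠ 0) := fun h => hok ((At.tr_ok hC hat hK).1 h)
      simp only [relaxCmd, Cmd.den, if_neg h₁, Tm.eval, Op.app, hr.counter]
    have hrel : J.relax A K v = { A with counter := A.counter + 1 } := by
      simp [Problem.relax, hok]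
    rw [hden, hrel]
    refine ⟨⟨SameInput.setNat hr.input (by omega) _ _, ?_, ?_, ?_, ?_, ?_, ?_, hr.sum, hr.val⟩,
      fun a ha => State.setNat_nat_of_ne _ _ _ _ (by omega), fun L hL _ hc _ =>
        hL.setNat (by omega) _ hc⟩
    · simp [State.setNat_nat]
    · simpa [State.setNat_nat] using hr.length
    · simpa [State.setNat_nat] using hr.queue
    · simpa [State.setNat_nat] using hr.seen
    · simpa [State.setNat_nat] using hr.job
    · simpa [State.setNat_nat] using hr.prev
  set K' := J.next K v with hK'
  have hcard : K'.1.card = K.1.card + 1 := J.card_next hok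
  have hK'1 : K'.1 = insert v K.1 := rfl
  have hsumK : s.grp 1 K.code + s.grp 0 v = ∑ u ∈ K'.1, J.time u := by
    rw [hr.sum K hKq, hr.input.2, hC.time, hK'1, Finset.sum_insert hok.1, add_comm]
  set x := ∑ u ∈ K'.1, J.time u with hx
  have hcand : J.cand A K v = A.val K + x := rfl
  have inj : ∀ K₁ : DState n, K₁.code = K'.code ↔ K₁ = K' := fun K₁ => DState.code_injective.eq_iff
  have hKK' : K.code ≠ K'.code := by
    rw [Ne, inj]; intro h; rw [h] at hcard; omega
  -- the sum
  set s₂ := (s.setGrp 1 K'.code x).setGrp 3 0 (A.val K + x) with hs₂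
  have at₂ : At base s₂ A.counter K v := At.setGrp (At.setGrp hat (by omega) _ _) (by omega) _ _
  have den₂ : C.sumCmd.den s = s₂ := by
    have at₁ : At base (s.setGrp 1 K'.code x) A.counter K v := At.setGrp hat (by omega) _ _
    simp only [sumCmd, Cmd.den, At.eval_next hC hat hK hok, At.eval_key hC hat, At.eval_job hC hat,
      ← hK', hsumK, At.eval_next hC at₁ hK hok, At.eval_key hC at₁, Tm.eval]
    simp only [State.setGrp_grp, hs₂]
    simp [hr.val]
  -- improvement
  set b : Prop := K' ∉ A.queue ∨ J.cand A K v < A.val K' with hb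
  set s₃ := if b then ((s₂.setGrp 2 K'.code (A.val K + x)).setNat 10 K'.code v).setNat 11 K'.code
    K.code else s₂ with hs₃
  have at₃ : At base s₃ A.counter K v := by
    rw [hs₃]; split
    · exact At.setNat (At.setNat (At.setGrp at₂ (by omega) _ _) (by omega) _ _) (by omega) _ _
    · exact at₂
  have den₃ : C.improveCmd.den s₂ = s₃ := by
    have hcond : Tr s₂ 0 (orT (notT (.read 9 C.nextTop))
        (notT (.gle 2 C.nextTop 3 (.lit 0)))) ↔ b := by
      have e₉ : (Tm.read 9 C.nextTop).eval s₂ 0 = s.nat 9 K'.code := by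
        rw [Tm.eval, At.eval_next hC at₂ hK hok]; rfl
      rw [tr_or, tr_not, tr_not, tr_gle, hb, Tr, e₉, At.eval_next hC at₂ hK hok, hcand,
        ← hr.val K', hr.seen]
      refine or_congr (by simp) ?_
      simp [hs₂, ← hK', State.setGrp_grp, Tm.eval]
    have q₁ : At base (s₂.setGrp 2 K'.code (A.val K + x)) A.counter K v :=
      At.setGrp at₂ (by omega) _ _
    have q₂ : At base ((s₂.setGrp 2 K'.code (A.val K + x)).setNat 10 K'.code v) A.counter K v :=
      At.setNat q₁ (by omega) _ _
    have e₁ : s₂.grp 2 K.code = A.val K := by simp [hs₂, State.setGrp_grp, hr.val]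
    have e₂ : s₂.grp 1 K'.code = x := by simp [hs₂, State.setGrp_grp]
    rw [Tr] at hcond
    simp only [improveCmd, Cmd.den, hcond, At.eval_next hC at₂ hK hok, At.eval_key hC at₂, ← hK',
      e₁, e₂, At.eval_next hC q₁ hK hok, At.eval_job hC q₁, At.eval_next hC q₂ hK hok,
      At.eval_key hC q₂, hs₃]
  -- insertion into the queue
  set s₄ := if K' ∈ A.queue then s₃ else ((s₃.setNat 9 K'.code 1).setNat 8 A.queue.length
    K'.code).setNat 7 0 (A.queue.length + 1) with hs₄
  have n₃ : ∀ a, a ≠ 10 → a ≠ 11 → s₃.nat a = s.nat a := fun a h₁ h₂ => by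
    rw [hs₃]; split
    · rw [State.setNat_nat_of_ne _ _ _ _ h₂, State.setNat_nat_of_ne _ _ _ _ h₁]; rfl
    · rfl
  have den₄ : C.pushCmd.den s₃ = s₄ := by
    have hcond : Tr s₃ 0 (notT (.read 9 C.nextTop)) ↔ K' ∉ A.queue := by
      rw [tr_not, Tr, Tm.eval, At.eval_next hC at₃ hK hok, n₃ 9 (by omega) (by omega), ← hK',
        hr.seen]
      simp
    have q₁ : At base (s₃.setNat 9 K'.code 1) A.counter K v := At.setNat at₃ (by omega) _ _
    have e₇ : s₃.nat 7 0 = A.queue.length := by rw [n₃ 7 (by omega) (by omega), hr.length]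
    rw [Tr] at hcond
    simp only [pushCmd, Cmd.den, hcond, At.eval_next hC at₃ hK hok, At.eval_next hC q₁ hK hok, ← hK',
      Tm.eval, Op.app, hs₄, State.setNat_nat_of_ne _ 9 _ _ (show (7 : ℕ) ≠ 9 by omega), e₇,
      State.setNat_nat_of_ne _ 8 _ _ (show (7 : ℕ) ≠ 8 by omega)]
    by_cases h : K' ∈ A.queue <;> simp [h]
  have n₄ : ∀ a, a ≠ 7 → a ≠ 8 → a ≠ 9 → s₄.nat a = s₃.nat a := fun a h₁ h₂ h₃ => by
    rw [hs₄]; split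
    · rfl
    · rw [State.setNat_nat_of_ne _ _ _ _ h₁, State.setNat_nat_of_ne _ _ _ _ h₂,
        State.setNat_nat_of_ne _ _ _ _ h₃]
  have g₄ : s₄.grp = s₃.grp := by rw [hs₄]; split <;> rfl
  set s₅ := s₄.setNat 6 0 (A.counter + 1) with hs₅
  have hden : C.relaxCmd.den s = s₅ := by
    have h₁ : C.okTop.eval s 0 ≠ 0 := (At.tr_ok hC hat hK).2 hok
    have e₆ : s₄.nat 6 0 = A.counter := by
      rw [n₄ 6 (by omega) (by omega) (by omega), n₃ 6 (by omega) (by omega), hr.counter]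
    simp only [relaxCmd, Cmd.den, if_pos h₁, den₂, den₃, den₄, Tm.eval, Op.app, e₆, hs₅]
  have n₅ : ∀ a, a ≠ 6 → s₅.nat a = s₄.nat a := fun a h => State.setNat_nat_of_ne _ _ _ _ h
  rw [hden]
  set B := J.relax A K v with hB
  have eq₁ : B.queue = if K' ∈ A.queue then A.queue else A.queue ++ [K'] := by
    simp [hB, Problem.relax, hok, hK']
  have eq₂ : B.counter = A.counter + 1 := by simp [hB, Problem.relax, hok]
  have eq₃ : B.val = if b then update A.val K' (J.cand A K v) else A.val := by
    simp [hB, Problem.relax, hok, hK', hb]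
  have eq₄ : B.prev = if b then update A.prev K' K else A.prev := by
    simp [hB, Problem.relax, hok, hK', hb]
  have eq₅ : B.job = if b then update A.job K' (v : ℕ) else A.job := by
    simp [hB, Problem.relax, hok, hK', hb]
  have same₅ : SameInput base s₅ := by
    refine SameInput.setNat ?_ (by omega) _ _
    refine ⟨fun a ha => ?_, ?_⟩
    · rw [n₄ a (by omega) (by omega) (by omega), n₃ a (by omega) (by omega), hr.input.1 a ha]
    · rw [g₄, at₃.1.2]
  refine ⟨⟨same₅, ?_, ?_, fun i K₁ h => ?_, fun K₁ => ?_, fun K₁ => ?_, fun K₁ => ?_,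
    fun K₁ h => ?_, fun K₁ => ?_⟩, fun a ha => ?_, fun L hL h2n hc hq => ?_⟩
  · simp [hs₅, State.setNat_nat, eq₂]
  · rw [n₅ 7 (by omega), eq₁, hs₄]
    split
    · rw [n₃ 7 (by omega) (by omega), hr.length]
    · simp [State.setNat_nat]
  · rw [n₅ 8 (by omega), hs₄]
    rw [eq₁] at h
    split at h <;> rename_i hm
    · rw [if_pos hm, n₃ 8 (by omega) (by omega), hr.queue i K₁ h]
    · rw [if_neg hm]
      simp only [State.setNat_nat]
      by_cases hi : i < A.queue.length
      · rw [List.getElem?_append_left hi] at h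
        rw [if_neg (by omega), if_neg (by omega), if_neg (by omega), n₃ 8 (by omega) (by omega),
          hr.queue i K₁ h]
      · rw [List.getElem?_append_right (by omega)] at h
        obtain ⟨h₁, h₂⟩ := List.getElem?_eq_some_iff.1 h
        simp at h₁ h₂
        rw [if_neg (by omega), if_pos ⟨trivial, by omega⟩, h₂]
  · rw [n₅ 9 (by omega), eq₁, hs₄]
    split <;> rename_i hm
    · rw [n₃ 9 (by omega) (by omega), hr.seen]
    · simp only [State.setNat_nat, inj, n₃ 9 (show (9 : ℕ) ≠ 10 by omega) (by omega), hr.seen]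
      by_cases h : K₁ = K' <;> simp [h]
  · rw [n₅ 10 (by omega), n₄ 10 (by omega) (by omega) (by omega), eq₅, hs₃]
    split
    · simp only [State.setNat_nat, inj, State.setGrp_nat, hs₂, hr.job, update_apply]
      simp
    · simp [hs₂, hr.job]
  · rw [n₅ 11 (by omega), n₄ 11 (by omega) (by omega) (by omega), eq₄, hs₃]
    split
    · simp only [State.setNat_nat, inj, State.setGrp_nat, hs₂, hr.prev, update_apply]
      by_cases h : K₁ = K' <;> simp [h]
    · simp [hs₂, hr.prev]
  · have e : s₅.grp 1 K₁.code = s₂.grp 1 K₁.code := by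
      rw [hs₅, State.setNat_grp, g₄, hs₃]
      split
      · simp [State.setGrp_grp]
      · rfl
    rw [e, hs₂]
    simp only [State.setGrp_grp, inj]
    by_cases h' : K₁ = K'
    · simp [h', hx]
    · have : K₁ ∈ A.queue := by
        rw [eq₁] at h
        split at h
        · exact h
        · simpa [h'] using h
      simp [h', hr.sum K₁ this]
  · have e : s₅.grp 2 K₁.code = s₃.grp 2 K₁.code := by
      rw [hs₅, State.setNat_grp, g₄]
    rw [e, eq₃, hs₃]
    split
    · simp only [State.setNat_grp, State.setGrp_grp, inj, hs₂, update_apply, hr.val, hcand]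
      simp
    · simp [hs₂, State.setGrp_grp, hr.val]
  · rw [n₅ a (by omega), n₄ a (by omega) (by omega) (by omega), n₃ a (by omega) (by omega)]
  · have b₂ : s₂.Bounded L := hL
    have b₃ : s₃.Bounded L := by
      rw [hs₃]; split
      · have hv : (v : ℕ) < 2 ^ L := v.2.trans (Nat.lt_two_pow_self.trans_le
          (Nat.pow_le_pow_right (by omega) (by omega)))
        exact State.Bounded.setNat (State.Bounded.setNat
          (s := s₂.setGrp 2 K'.code (A.val K + x)) b₂ (by omega) _ hv) (by omega) _ (hcode L K h2n)
      · exact b₂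
    refine State.Bounded.setNat ?_ (by omega) _ hc
    rw [hs₄]; split
    · exact b₃
    · exact ((b₃.setNat (by omega) _ (by omega)).setNat (by omega) _ (hcode L K' h2n)).setNat
        (by omega) _ hq

end Coding

end Sched

/-! ### The complete program: search, choice of the best state, output -/

namespace Sched

open Function Tm

lemma place_append_cons {n : ℕ} {l₁ : List (Fin n)} {v : Fin n} (h : v ∉ l₁) (l₂ : List (Fin n)) :
    place (l₁ ++ v :: l₂) v = l₂.length + 1 := by
  induction l₁ with
  | nil => simp [place]
  | cons u l ih =>
    rw [List.mem_cons, not_or] at h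
    rw [List.cons_append, place, if_neg h.1, ih h.2]

namespace Problem

variable {R : Type} {n : ℕ} {J : Problem R n} [LinearOrder R] [AddCommGroup R] {A : Search R n}
  {M : Finset (Fin n)}

/-- A bound for the number of states. -/
def bound (J : Problem R n) (M : Finset (Fin n)) : ℕ :=
  n.choose M.card * (2 ^ (n - J.P.card) * ((J.p + 1) * J.P.card.choose J.p))

lemma Inv.length_le (hA : J.Inv A) (hJ : J.Separated M) (hp : 2 * J.p < J.P.card) :
    A.queue.length ≤ J.bound M := by
  classical
  rw [← List.toFinset_card_of_nodup hA.nodup]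
  exact card_states_le hJ hp _ fun K hK => hA.path K (by simpa using hK)

lemma Inv.length_le_pow (hA : J.Inv A) : A.queue.length ≤ 2 ^ (2 * n) := by
  classical
  rw [← List.toFinset_card_of_nodup hA.nodup, ← Finset.card_image_of_injective _
    DState.code_injective, ← Finset.card_range (2 ^ (2 * n))]
  refine Finset.card_le_card fun x hx => ?_
  obtain ⟨K, -, rfl⟩ := Finset.mem_image.1 hx
  exact Finset.mem_range.2 K.code_lt

lemma Inv.length_lt (hA : J.Inv A) : A.queue.length + 1 < 2 ^ (3 * n + 2) := by
  have h₁ := hA.length_le_pow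
  have h₂ : 2 ^ (2 * n) ≤ 2 ^ (3 * n) := Nat.pow_le_pow_right (by omega) (by omega)
  have h₃ : 0 < 2 ^ (3 * n) := by positivity
  rw [pow_add]; omega

/-- There are at most `2 ^ (2 * n)` codes and `n ≤ 2 ^ n` jobs for each. This is why `3 * n + 2`
serves as the size parameter throughout. -/
lemma Inv.counter_lt (hA : J.Inv A) : A.counter + 1 < 2 ^ (3 * n + 2) := by
  have h₁ := hA.length_le_pow
  have h₂ : A.counter ≤ 2 ^ (2 * n) * 2 ^ n :=
    hA.counter_le.trans (Nat.mul_le_mul h₁ Nat.lt_two_pow_self.le)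
  have h₃ : 0 < 2 ^ (3 * n) := by positivity
  have h₄ : 2 ^ (2 * n) * 2 ^ n = 2 ^ (3 * n) := by rw [← pow_add]; congr 1; omega
  rw [pow_add]; omega

/-- A state reached by complete orderings with the right number of early jobs. -/
def Done (J : Problem R n) (K : DState n) : Prop := K.1.card = n ∧ K.2.card = J.p

end Problem

namespace Coding

/-- Preparation of the search. -/
def initCmd : Cmd :=
  .seq (.assign 9 (by omega) (.lit 0) (.lit 1)) (.assign 7 (by omega) (.lit 0) (.lit 1))

/-- The state examined in the search for the best complete state. -/
def scanT : Tm := .read 8 (.read 13 (.lit 0))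

/-- The best complete state found, later the state to be traced back. -/
def bestT : Tm := .read 12 (.lit 0)

def betterT : Tm :=
  andT (andT (eqT (cardT scanT) size) (eqT (cardT (early scanT)) (.read 0 (.lit 4))))
    (orT (notT (.read 4 (.lit 0))) (notT (.gle 2 bestT 2 scanT)))

def scanCmd : Cmd :=
  .seq (.ite betterT
      (.seq (.assign 12 (by omega) (.lit 0) scanT) (.assign 4 (by omega) (.lit 0) (.lit 1))) .skip)
    (.assign 13 (by omega) (.lit 0) (.op .add (.read 13 (.lit 0)) (.lit 1)))

def scanMoreT : Tm := ltT (.read 13 (.lit 0)) (.read 7 (.lit 0))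

variable (C : Coding)

/-- Output of the position of one job. -/
def traceCmd : Cmd :=
  -- The job scheduled last in a state stands at the position given by the cardinality of the state.
  .seq (.assign 5 (by omega) (.read 10 bestT) (.letv 8 (cardT bestT) C.out))
    (.assign 12 (by omega) (.lit 0) (.read 11 bestT))

/-- The program that solves the problem described by `C`. -/
def program : Prog :=
  .seq initCmd.compile (.seq (whileProg moreT C.relaxCmd)
    -- The empty state has code `0`, so tracing back stops there; it also stops at once if no
    -- complete state was found, since the cell read by `bestT` is then still `0`.
    (.seq (whileProg scanMoreT scanCmd) (whileProg bestT C.traceCmd)))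

section Phases

variable {C} {R : Type} [AddCommGroup R] [LinearOrder R] {n : ℕ} {J : Problem R n}
  {base s : State R} {A : Search R n} {f : ℕ → ℕ}

omit [LinearOrder R] in
lemma Rep.setNat (h : Rep J base s A) {a : ℕ} (ha : a = 4 ∨ a = 5 ∨ 11 < a) (i x : ℕ) :
    Rep J base (s.setNat a i x) A := by
  have e : ∀ b, b ≠ a → (s.setNat a i x).nat b = s.nat b :=
    fun b hb => State.setNat_nat_of_ne _ _ _ _ hb
  refine ⟨SameInput.setNat h.input (by omega) i x, ?_, ?_, ?_, ?_, ?_, ?_, h.sum, h.val⟩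
  · rw [e 6 (by omega), h.counter]
  · rw [e 7 (by omega), h.length]
  · rw [e 8 (by omega)]; exact h.queue
  · rw [e 9 (by omega)]; exact h.seen
  · rw [e 10 (by omega)]; exact h.job
  · rw [e 11 (by omega)]; exact h.prev

/-- The memory before the search. -/
structure Fresh (s : State R) : Prop where
  nat : ∀ a, 3 < a → s.nat a = 0
  grp : ∀ a, 0 < a → s.grp a = 0

lemma rep_init (hs : Fresh s) : Rep J s (initCmd.den s)
    ⟨[(∅, ∅)], 0, fun _ => 0, fun _ => (∅, ∅), fun _ => 0⟩ := by
  have e : initCmd.den s = (s.setNat 9 0 1).setNat 7 0 1 := rfl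
  rw [e]
  refine ⟨SameInput.setNat (SameInput.setNat ⟨fun _ _ => rfl, rfl⟩ (by omega) _ _) (by omega) _ _,
    ?_, ?_, fun i K hi => ?_, fun K => ?_, fun K => ?_, fun K => ?_, fun K hK => ?_, fun K => ?_⟩
  · simp [State.setNat_nat, hs.nat]
  · simp [State.setNat_nat]
  · obtain ⟨hi', rfl⟩ := List.getElem?_eq_some_iff.1 hi
    simp [State.setNat_nat, hs.nat]
  · have : K.code = 0 ↔ K = (∅, ∅) := by
      rw [← DState.code_empty (n := n)]; exact DState.code_injective.eq_iff
    simp [State.setNat_nat, hs.nat, this]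
  · simp [State.setNat_nat, hs.nat]
  · simp [State.setNat_nat, hs.nat]
  · rw [List.mem_singleton] at hK
    simp [hK, hs.grp]
  · simp [hs.grp]

variable (hC : C.Describes J base f)

include hC

lemma Rep.tr_more (hr : Rep J base s A) :
    moreT.eval s 0 ≠ 0 ↔ A.counter < A.queue.length * n := by
  have := tr_lt s 0 (.read 6 (.lit 0)) (.op .mul (.read 7 (.lit 0)) size)
  rw [Tr] at this
  rw [moreT, this]
  simp only [Tm.eval, Op.app, Tm.size, hC.size_eq hr.input, hr.counter, hr.length]

omit hC [LinearOrder R] in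
lemma Rep.at_counter (hr : Rep J base s A) (h : A.counter < A.queue.length * n) :
    ∃ (K : DState n) (v : Fin n), At base s A.counter K v ∧
      A.queue[A.counter / n]? = some K ∧ A.counter = A.counter / n * n + v := by
  have hn : 0 < n := Nat.pos_of_ne_zero fun h0 => by simp [h0] at h
  have hlt : A.counter / n < A.queue.length := (Nat.div_lt_iff_lt_mul hn).2 h
  refine ⟨A.queue[A.counter / n], ⟨A.counter % n, Nat.mod_lt _ hn⟩, ⟨hr.input, hr.counter, ?_, rfl⟩,
    List.getElem?_eq_getElem hlt, (Nat.div_add_mod' _ _).symm⟩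
  exact hr.queue _ _ (List.getElem?_eq_getElem hlt)

lemma Rep.tr_better (hr : Rep J base s A) {K Kb : DState n} (hk : s.nat 8 (s.nat 13 0) = K.code)
    (hb : s.nat 12 0 = Kb.code) :
    betterT.eval s 0 ≠ 0 ↔ J.Done K ∧ (s.nat 4 0 = 0 ∨ A.val K < A.val Kb) := by
  have hn := hC.size_eq hr.input
  have hp : s.nat 0 4 = J.p := by rw [hr.input.1 0 (by omega), hC.goal]
  change Tr s 0 betterT ↔ _
  have e : scanT.eval s 0 = K.code := hk
  have e' : bestT.eval s 0 = Kb.code := hb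
  rw [betterT, tr_and, tr_and, tr_or, tr_eq, tr_eq, tr_not, tr_not, tr_gle, eval_card hn e,
    eval_card_early hn e, e, e', hr.val, hr.val, eval_size, hn, not_le, Problem.Done]
  simp only [Tm.eval, hp, Tr, not_not]

end Phases

section Runs

/-- The search. -/
lemma search_runs : ∃ k, ∀ {R : Type} [AddCommGroup R] [LinearOrder R] {n : ℕ} {J : Problem R n}
    {base : State R} {f : ℕ → ℕ} {M : Finset (Fin n)}, C.Describes J base f → J.Separated M →
    2 * J.p < J.P.card → ∀ (s : State R) (A : Search R n), s.nat 7 = 0 → Rep J base s.view A →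
      J.Inv A → s.view.Bounded (3 * n + 2) →
    ∃ s' x A', Runs (whileProg moreT C.relaxCmd) s s' x ∧
      x ≤ (J.bound M * n + 1) * (3 * n + 2) ^ k ∧ s'.nat 7 = 0 ∧ Rep J base s'.view A' ∧
      J.Inv A' ∧ A'.counter = A'.queue.length * n ∧ s'.view.Bounded (3 * n + 2) ∧
      ∀ a, a < 6 ∨ 11 < a → s'.view.nat a = s.view.nat a := by
  obtain ⟨k, hk⟩ := whileProg_runs moreT C.relaxCmd
  refine ⟨k, fun {R} _ _ {n J base f M} hC hJ hp s A h₇ hr hA hb => ?_⟩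
  obtain ⟨s', x, hrun, hx, h₇', ⟨A', hr', hA', hb', hf'⟩, hend⟩ := hk
    (fun v => ∃ A, Rep J base v A ∧ J.Inv A ∧ v.Bounded (3 * n + 2) ∧
      ∀ a, a < 6 ∨ 11 < a → v.nat a = s.view.nat a)
    -- Every round examines one transition, and there are at most `n` transitions for each of the at
    -- most `J.bound M` states.
    (fun v => J.bound M * n - v.nat 6 0) (3 * n + 2) (by omega) (fun v ⟨_, h⟩ => h.2.2.1)
    (by
      rintro v ⟨A, hr, hA, hb, hf⟩ he
      have hlt := (hr.tr_more hC).1 he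
      obtain ⟨K, u, hat, hK, hc⟩ := hr.at_counter hlt
      obtain ⟨hr', hf', hb'⟩ := hr.relax hC hA hat hK
      have hA' := J.inv_relax hA hK hc
      refine ⟨⟨_, hr', hA', hb' _ hb (by omega) hA.counter_lt hA.length_lt,
        fun a ha => (hf' a ha).trans (hf a ha)⟩, ?_⟩
      have hcount : (J.relax A K u).counter = A.counter + 1 := by
        rw [Problem.relax]; split <;> rfl
      have := Nat.mul_le_mul_right n (hA.length_le hJ hp)
      rw [hr'.counter, hr.counter, hcount]
      omega)
    s h₇ ⟨A, hr, hA, hb, fun _ _ => rfl⟩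
  refine ⟨s', x, A', hrun, hx.trans (Nat.mul_le_mul_right _ (by omega)), h₇', hr', hA', ?_, hb',
    hf'⟩
  have := mt (hr'.tr_more hC).2 (not_not.2 hend)
  have := hA'.counter_le
  omega


/-- The search for the best complete state. -/
lemma scan_runs : ∃ k, ∀ {R : Type} [AddCommGroup R] [LinearOrder R] {n : ℕ} {J : Problem R n}
    {base : State R} {f : ℕ → ℕ}, C.Describes J base f →
    ∀ (s : State R) (A : Search R n), s.nat 7 = 0 → Rep J base s.view A → J.Inv A →
      s.view.Bounded (3 * n + 2) → s.view.nat 4 0 = 0 → s.view.nat 12 0 = 0 →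
      s.view.nat 13 0 = 0 →
    ∃ s' x, Runs (whileProg scanMoreT scanCmd) s s' x ∧
      x ≤ (A.queue.length + 1) * (3 * n + 2) ^ k ∧ s'.nat 7 = 0 ∧ Rep J base s'.view A ∧
      s'.view.Bounded (3 * n + 2) ∧
      ((s'.view.nat 4 0 = 0 ∧ s'.view.nat 12 0 = 0 ∧ ∀ K ∈ A.queue, ¬ J.Done K) ∨
        (s'.view.nat 4 0 = 1 ∧ ∃ Kb ∈ A.queue, s'.view.nat 12 0 = Kb.code ∧ J.Done Kb ∧
          ∀ K ∈ A.queue, J.Done K → A.val Kb ≤ A.val K)) := by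
  obtain ⟨k, hk⟩ := whileProg_runs scanMoreT scanCmd
  refine ⟨k, fun {R} _ _ {n J base f} hC s A h₇ hr hA hb h4 h12 h13 => ?_⟩
  have tr_more : ∀ v, Rep J base v A → (scanMoreT.eval v 0 ≠ 0 ↔ v.nat 13 0 < A.queue.length) :=
    fun v hr => by
      have := tr_lt v 0 (.read 13 (.lit 0)) (.read 7 (.lit 0))
      rw [Tr] at this
      rw [scanMoreT, this]
      simp only [Tm.eval, hr.length]
  obtain ⟨s', x, hrun, hx, h₇', ⟨hr', hb', -, hbest⟩, hend⟩ := hk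
    (fun v => Rep J base v A ∧ v.Bounded (3 * n + 2) ∧ v.nat 13 0 ≤ A.queue.length ∧
      ((v.nat 4 0 = 0 ∧ v.nat 12 0 = 0 ∧
          ∀ j K, j < v.nat 13 0 → A.queue[j]? = some K → ¬ J.Done K) ∨
        (v.nat 4 0 = 1 ∧ ∃ Kb ∈ A.queue, v.nat 12 0 = Kb.code ∧ J.Done Kb ∧
          ∀ j K, j < v.nat 13 0 → A.queue[j]? = some K → J.Done K → A.val Kb ≤ A.val K)))
    (fun v => A.queue.length - v.nat 13 0) (3 * n + 2) (by omega) (fun v h => h.2.1)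
    (by
      rintro v ⟨hr, hb, hle, hbest⟩ he
      have hlt := (tr_more v hr).1 he
      set i := v.nat 13 0 with hi
      set K := A.queue[i] with hK
      have hKi : A.queue[i]? = some K := List.getElem?_eq_getElem hlt
      have hkey : v.nat 8 (v.nat 13 0) = K.code := hr.queue _ _ hKi
      have hlt2 : i + 1 < 2 ^ (3 * n + 2) := by have := hA.length_lt; omega
      set v₁ := (v.setNat 12 0 K.code).setNat 4 0 1 with hv₁
      have hden : scanCmd.den v = (if betterT.eval v 0 ≠ 0 then v₁ else v).setNat 13 0 (i + 1) := by
        simp only [scanCmd, Cmd.den, Tm.eval, Op.app, scanT, hkey]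
        congr 1
        split <;> simp [State.setNat_nat, hi]
      have r₁ : Rep J base v₁ A := (hr.setNat (by omega) _ _).setNat (by omega) _ _
      have b₁ : v₁.Bounded (3 * n + 2) := by
        refine (hb.setNat (by omega) _ ?_).setNat (by omega) _ (Nat.one_lt_two_pow (by omega))
        exact K.code_lt.trans_le (Nat.pow_le_pow_right (by omega) (by omega))
      set w := if betterT.eval v 0 ≠ 0 then v₁ else v with hw
      have hw13 : ∀ a b, a ≠ 13 → (w.setNat 13 0 (i + 1)).nat a b = w.nat a b := fun a b ha => by
        rw [State.setNat_nat_of_ne _ _ _ _ ha]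
      have hsplit : ∀ {q : ℕ → DState n → Prop}, (∀ j K, j < i → A.queue[j]? = some K → q j K) →
          q i K → ∀ j K, j < i + 1 → A.queue[j]? = some K → q j K := by
        intro q h₁ h₂ j K' hj hK'
        rcases Nat.lt_succ_iff_lt_or_eq.1 hj with hj | rfl
        · exact h₁ j K' hj hK'
        · rw [hKi] at hK'; simp only [Option.some.injEq] at hK'; exact hK' ▸ h₂
      rw [hden]
      have hnew : (w.setNat 13 0 (i + 1)).nat 13 0 = i + 1 := by simp [State.setNat_nat]
      refine ⟨⟨?_, ?_, by rw [hnew]; omega, ?_⟩, by rw [hnew]; omega⟩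
      · rw [hw]; split
        · exact r₁.setNat (by omega) _ _
        · exact hr.setNat (by omega) _ _
      · rw [hw]; split
        · exact b₁.setNat (by omega) _ hlt2
        · exact hb.setNat (by omega) _ hlt2
      · rw [hnew, hw13 4 0 (by omega), hw13 12 0 (by omega)]
        have w4 : v₁.nat 4 0 = 1 := by simp [hv₁, State.setNat_nat]
        have w12 : v₁.nat 12 0 = K.code := by simp [hv₁, State.setNat_nat]
        rcases hbest with ⟨h4, h12, hno⟩ | ⟨h4, Kb, hKb, h12, hdone, hmin⟩
        -- Nothing has been found yet: the cell `0` for the best state reads as the code of the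
        -- empty state, which serves as a dummy.
        · have hbt := hr.tr_better hC hkey (Kb := (∅, ∅)) (by rw [h12, DState.code_empty])
          by_cases hd : J.Done K
          · have : betterT.eval v 0 ≠ 0 := hbt.2 ⟨hd, .inl h4⟩
            rw [hw, if_pos this, w4, w12]
            exact .inr ⟨rfl, K, List.mem_of_getElem? hKi, rfl, hd, hsplit
              (fun j K' hj hK' hd' => absurd hd' (hno j K' hj hK')) fun _ => le_rfl⟩
          · have : ¬ betterT.eval v 0 ≠ 0 := fun h => hd (hbt.1 h).1
            rw [hw, if_neg this, h4, h12]
            exact .inl ⟨rfl, rfl, hsplit hno hd⟩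
        · have hbt := hr.tr_better hC hkey h12
          by_cases hbet : betterT.eval v 0 ≠ 0
          · obtain ⟨hd, hlt⟩ := hbt.1 hbet
            have hlt := hlt.resolve_left (by omega)
            rw [hw, if_pos hbet, w4, w12]
            exact .inr ⟨rfl, K, List.mem_of_getElem? hKi, rfl, hd, hsplit
              (fun j K' hj hK' hd' => hlt.le.trans (hmin j K' hj hK' hd')) fun _ => le_rfl⟩
          · rw [hw, if_neg hbet, h4, h12]
            refine .inr ⟨rfl, Kb, hKb, rfl, hdone, hsplit hmin fun hd => ?_⟩
            exact not_lt.1 fun h => hbet (hbt.2 ⟨hd, .inr h⟩))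
    s h₇ ⟨hr, hb, by omega, .inl ⟨h4, h12, fun j K hj => by omega⟩⟩
  have hlen : A.queue.length ≤ s'.view.nat 13 0 :=
    not_lt.1 fun h => (tr_more _ hr').2 h hend
  have hall : ∀ K ∈ A.queue, ∃ j, j < s'.view.nat 13 0 ∧ A.queue[j]? = some K := fun K hK => by
    obtain ⟨j, hj⟩ := List.getElem?_of_mem hK
    exact ⟨j, (List.getElem?_eq_some_iff.1 hj).1.trans_le hlen, hj⟩
  refine ⟨s', x, hrun, by rwa [h13] at hx, h₇', hr', hb', ?_⟩
  rcases hbest with ⟨h4, h12, hno⟩ | ⟨h4, Kb, hKb, h12, hdone, hmin⟩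
  · refine .inl ⟨h4, h12, fun K hK => ?_⟩
    obtain ⟨j, hj, hj'⟩ := hall K hK
    exact hno j K hj hj'
  · refine .inr ⟨h4, Kb, hKb, h12, hdone, fun K hK hd => ?_⟩
    obtain ⟨j, hj, hj'⟩ := hall K hK
    exact hmin j K hj hj' hd

/-- The output of an ordering. -/
lemma trace_runs : ∃ k, ∀ {R : Type} [AddCommGroup R] [LinearOrder R] {n : ℕ} {J : Problem R n}
    {base : State R} {f : ℕ → ℕ}, C.Describes J base f → (∀ i, 1 ≤ i → i ≤ n → f i ≤ n) →
    ∀ (s : State R) (A : Search R n) (l : List (Fin n)) (K : DState n), s.nat 7 = 0 →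
      Rep J base s.view A → s.view.Bounded (3 * n + 2) → J.Chain A l K →
      s.view.nat 12 0 = K.code →
    ∃ s' x, Runs (whileProg bestT C.traceCmd) s s' x ∧ x ≤ (n + 1) * (3 * n + 2) ^ k ∧
      s'.nat 4 0 = s.nat 4 0 ∧ ∀ v ∈ l, s'.nat 5 v = f (place l v) := by
  obtain ⟨k, hk⟩ := whileProg_runs bestT C.traceCmd
  refine ⟨k, fun {R} _ _ {n J base f} hC hf s A l K h₇ hr hb hl hK => ?_⟩
  have hnd := hl.path.fst_eq.2
  have hcard : ∀ v, Rep J base v A → ∀ K : DState n, v.nat 12 0 = K.code →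
      (cardT bestT).eval v 0 = K.1.card := fun v hr K hK =>
    eval_card (hC.size_eq hr.input) (K := bestT) hK
  obtain ⟨s', x, hrun, hx, -, ⟨hr', hb', h4, l₁, l₂, K', hll, hl₂, hK', hout⟩, hend⟩ := hk
    (fun v => Rep J base v A ∧ v.Bounded (3 * n + 2) ∧ v.nat 4 0 = s.view.nat 4 0 ∧
      ∃ l₁ l₂ K', l = l₁ ++ l₂ ∧ J.Chain A l₂ K' ∧ v.nat 12 0 = K'.code ∧
        ∀ u ∈ l₁, v.nat 5 u = f (place l u))
    -- Each round removes the last job from the current state.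
    (fun v => (cardT bestT).eval v 0) (3 * n + 2) (by omega) (fun v h => h.2.1)
    (by
      rintro v ⟨hr, hb, h4, l₁, l₂, K', hll, hl₂, hK', hout⟩ he
      have hbest : bestT.eval v 0 = K'.code := hK'
      cases hl₂ with
      | nil => rw [hbest, DState.code_empty] at he; exact absurd rfl he
      | @cons l₃ K₃ u hl₃ hok hprev hjob =>
        set K' := J.next K₃ u with hKdef
        have hc' : K'.1.card = K₃.1.card + 1 := J.card_next hok
        have hc := hcard v hr K' hK'
        have hle : K'.1.card ≤ n := by simpa using Finset.card_le_univ K'.1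
        have hu₁ : u ∉ l₁ := fun h => by
          rw [hll] at hnd
          exact (List.disjoint_of_nodup_append hnd) h List.mem_cons_self
        have hplace : place l u = K'.1.card := by
          rw [hll, place_append_cons hu₁, hc', hl₃.path.card_eq]
        have hden : C.traceCmd.den v = (v.setNat 5 u (f (place l u))).setNat 12 0 K₃.code := by
          have e₁ : (Tm.letv 8 (cardT bestT) C.out).eval v 0 = f (place l u) := by
            rw [Tm.eval]
            exact hC.out v hr.input _ _ (by rw [update_self, hc, hplace])
          have e₂ : (Tm.read 10 bestT).eval v 0 = u := by rw [Tm.eval, hbest, hr.job, hjob]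
          have e₃ : (Tm.read 11 bestT).eval (v.setNat 5 u (f (place l u))) 0 = K₃.code := by
            have r := hr.setNat (a := 5) (by omega) u (f (place l u))
            have : bestT.eval (v.setNat 5 u (f (place l u))) 0 = K'.code := by
              simp only [bestT, Tm.eval, State.setNat_nat_of_ne _ 5 _ _ (show (12 : ℕ) ≠ 5 by omega),
                hK']
            rw [Tm.eval, this, r.prev, hprev]
          simp only [traceCmd, Cmd.den, e₁, e₂, e₃]
          rfl
        rw [hden]
        have r' := (hr.setNat (a := 5) (by omega) u (f (place l u))).setNat (a := 12) (by omega) 0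
          K₃.code
        have h12 : ((v.setNat 5 u (f (place l u))).setNat 12 0 K₃.code).nat 12 0 = K₃.code := by
          simp [State.setNat_nat]
        refine ⟨⟨r', ?_, ?_, l₁ ++ [u], l₃, K₃, by simp [hll], hl₃, h12, fun w hw => ?_⟩, ?_⟩
        · refine (hb.setNat (by omega) _ ?_).setNat (by omega) _ ?_
          · have h₁ := hf (place l u) (by omega) (by omega)
            exact h₁.trans_lt (Nat.lt_two_pow_self.trans_le
              (Nat.pow_le_pow_right (by omega) (by omega)))
          · exact K₃.code_lt.trans_le (Nat.pow_le_pow_right (by omega) (by omega))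
        · rw [State.setNat_nat_of_ne _ _ _ _ (by omega), State.setNat_nat_of_ne _ _ _ _ (by omega),
            h4]
        · rw [State.setNat_nat_of_ne _ _ _ _ (by omega), State.setNat_nat]
          by_cases hwu : w = u
          · subst hwu; simp
          · have : w ∈ l₁ := by simpa [hwu] using hw
            rw [if_neg (fun h => hwu (Fin.ext h.2)), hout w this]
        · rw [hcard _ r' K₃ h12, hc]; omega)
    s h₇ ⟨hr, hb, rfl, [], l, K, rfl, hl, hK, by simp⟩
  refine ⟨s', x, hrun, hx.trans (Nat.mul_le_mul_right _ ?_), h4, ?_⟩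
  · rw [hcard _ hr K hK]
    have : K.1.card ≤ n := by simpa using Finset.card_le_univ K.1
    omega
  · have h0 : K'.code = 0 := by rw [← hK']; exact hend
    have : l₂ = [] := by
      rw [← DState.code_empty (n := n)] at h0
      have := hl₂.path.card_eq
      rw [DState.code_injective h0] at this
      exact List.eq_nil_of_length_eq_zero (by simpa using this.symm)
    rw [hll, this, List.append_nil]
    rw [this, List.append_nil] at hll
    rw [← hll]
    intro v hv
    exact hout v (hll ▸ hv)

/-- The program finds a best good ordering. -/
theorem program_runs : ∃ k, ∀ {R : Type} [AddCommGroup R] [LinearOrder R] [IsOrderedAddMonoid R]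
    {n : ℕ} {J : Problem R n} {M : Finset (Fin n)} {f : ℕ → ℕ} {s : State R}, 2 ≤ n →
    C.Describes J s.view f → J.Separated M → 2 * J.p < J.P.card →
    (∀ i, 1 ≤ i → i ≤ n → f i ≤ n) → Fresh s → s.view.Bounded (3 * n + 2) →
    ∃ s' x, Runs C.program s s' x ∧
      x ≤ 2 ^ (n - J.P.card) * J.P.card.choose J.p * n.choose M.card * n ^ k ∧
      ((s'.nat 4 0 = 0 ∧ J.good = ∅) ∨ (s'.nat 4 0 = 1 ∧ ∃ σ ∈ J.good,
        (∀ τ ∈ J.good, J.cost σ ≤ J.cost τ) ∧ ∀ v : Fin n, s'.nat 5 v = f (pos σ v))) := by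
  obtain ⟨k₁, -, h₁⟩ := initCmd.executes
  obtain ⟨k₂, h₂⟩ := search_runs C
  obtain ⟨k₃, h₃⟩ := scan_runs C
  obtain ⟨k₄, h₄⟩ := trace_runs C
  set k := k₁ + k₂ + k₃ + k₄ with hk
  refine ⟨3 * (k + 6), fun {R} _ _ _ {n J M f s} hn hC hJ hp hf hs hb => ?_⟩
  set L := 3 * n + 2 with hL
  obtain ⟨s₁, x₁, r₁, c₁, z₁, w₁, -⟩ := h₁ L (by omega) s (hs.nat 7 (by omega)) hb
  have hfresh : Fresh s.view :=
    ⟨fun a ha => hs.nat _ (by unfold enc; split <;> omega), fun a ha => hs.grp a ha⟩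
  have rep₁ := rep_init (J := J) hfresh
  have inv₁ : J.Inv ⟨[(∅, ∅)], 0, fun _ => 0, fun _ => (∅, ∅), fun _ => 0⟩ :=
    J.inv_init _ rfl rfl rfl
  have e₁ : initCmd.den s.view = (s.view.setNat 9 0 1).setNat 7 0 1 := rfl
  have bd₁ : s₁.view.Bounded L := by
    have : 1 < 2 ^ L := Nat.one_lt_two_pow (by omega)
    rw [w₁, e₁]
    exact (hb.setNat (by omega) _ this).setNat (by omega) _ this
  rw [← w₁] at rep₁
  obtain ⟨s₂, x₂, A, r₂, c₂, z₂, rep₂, inv₂, hend, bd₂, same₂⟩ :=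
    h₂ hC hJ hp s₁ _ z₁ rep₁ inv₁ bd₁
  have zero₂ : ∀ a, a = 4 ∨ a = 12 ∨ a = 13 → s₂.view.nat a 0 = 0 := fun a ha => by
    rw [same₂ a (by omega), w₁, e₁, State.setNat_nat_of_ne _ _ _ _ (by omega),
      State.setNat_nat_of_ne _ _ _ _ (by omega), hfresh.nat a (by omega)]
    rfl
  obtain ⟨s₃, x₃, r₃, c₃, z₃, rep₃, bd₃, hres⟩ := h₃ hC s₂ A z₂ rep₂ inv₂ bd₂
    (zero₂ 4 (by omega)) (zero₂ 12 (by omega)) (zero₂ 13 (by omega))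
  -- If there is no complete state, the empty chain is used, so that `trace_runs` covers both
  -- outcomes.
  obtain ⟨K, l, hKl, hK12, hKq⟩ : ∃ K l, (J.Chain A l K ∧ J.listCost l = A.val K) ∧
      s₃.view.nat 12 0 = K.code ∧ (s₃.view.nat 4 0 = 1 → K ∈ A.queue ∧ J.Done K ∧
        ∀ K' ∈ A.queue, J.Done K' → A.val K ≤ A.val K') := by
    rcases hres with ⟨h4, h12, -⟩ | ⟨-, Kb, hKb, h12, hd, hmin⟩
    · exact ⟨(∅, ∅), [], ⟨.nil, by rw [inv₂.val_zero]; rfl⟩, by rw [h12, DState.code_empty],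
        fun h => by omega⟩
    · obtain ⟨l, hl⟩ := inv₂.exists_chain hKb
      exact ⟨Kb, l, hl, h12, fun _ => ⟨hKb, hd, hmin⟩⟩
  obtain ⟨s₄, x₄, r₄, c₄, e4, hout⟩ := h₄ hC hf s₃ A l K z₃ rep₃ bd₃ hKl.1 hK12
  -- An ordering `τ` need not itself be an admissible path, but a cheapest good ordering is one, and
  -- it exists by finiteness.
  have hopt : ∀ τ ∈ J.good, ∃ K' ∈ A.queue, J.Done K' ∧ A.val K' ≤ J.cost τ := by
    intro τ hτ
    obtain ⟨σ, hσ, hmin⟩ := (Set.toFinite J.good).exists_minimalFor J.cost J.good ⟨τ, hτ⟩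
    have hmin : ∀ τ ∈ J.good, J.cost σ ≤ J.cost τ := fun τ hτ =>
      (le_total (J.cost σ) (J.cost τ)).elim id fun h => hmin hτ h
    obtain ⟨l', K', hl', hu, hp', hcost⟩ := Problem.exists_path_of_optimal hJ hσ hmin
    obtain ⟨hq, hv⟩ := inv₂.mem_of_path hend hl'
    exact ⟨K', hq, ⟨by simp [hu], hp'⟩, (hv.trans hcost.le).trans (hmin τ hτ)⟩
  refine ⟨s₄, _, .seq r₁ (.seq r₂ (.seq r₃ r₄)), ?_, ?_⟩
  · set X := 2 ^ (n - J.P.card) * J.P.card.choose J.p * n.choose M.card with hX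
    have hPn : J.P.card ≤ n := by simpa using Finset.card_le_univ J.P
    have hMn : M.card ≤ n := by simpa using Finset.card_le_univ M
    have hX1 : 1 ≤ X := by
      have h₁ : 0 < J.P.card.choose J.p := Nat.choose_pos (by omega)
      have h₂ : 0 < n.choose M.card := Nat.choose_pos hMn
      exact Nat.mul_pos (Nat.mul_pos (by positivity) h₁) h₂
    have hbound : J.bound M ≤ X * L := by
      have : J.bound M = X * (J.p + 1) := by rw [Problem.bound, hX]; ring
      rw [this]
      exact Nat.mul_le_mul_left _ (by omega)
    have hlen := (inv₂.length_le hJ hp).trans hbound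
    have hXL : 1 ≤ X * L := Nat.mul_pos hX1 (by omega)
    have hpow : ∀ i ≤ k, L ^ i ≤ L ^ k := fun i hi => Nat.pow_le_pow_right (by omega) hi
    have hkpos : 1 ≤ L ^ k := Nat.one_le_pow _ _ (by omega)
    have a₁ : x₁ ≤ X * L * L * L ^ k := by
      calc x₁ ≤ 1 * L ^ k := by rw [one_mul]; exact c₁.trans (hpow _ (by omega))
        _ ≤ _ := Nat.mul_le_mul_right _ (Nat.mul_pos hXL (by omega))
    have a₂ : x₂ ≤ X * L * L * L ^ k := by
      refine c₂.trans (Nat.mul_le_mul ?_ (hpow _ (by omega)))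
      calc J.bound M * n + 1 ≤ X * L * n + X * L := by
            gcongr
        _ = X * L * (n + 1) := by ring
        _ ≤ _ := Nat.mul_le_mul_left _ (by omega)
    have a₃ : x₃ ≤ X * L * L * L ^ k := by
      refine c₃.trans (Nat.mul_le_mul ?_ (hpow _ (by omega)))
      calc A.queue.length + 1 ≤ X * L * 1 + X * L * 1 := by omega
        _ = X * L * 2 := by ring
        _ ≤ _ := Nat.mul_le_mul_left _ (by omega)
    have a₄ : x₄ ≤ X * L * L * L ^ k := by
      refine c₄.trans (Nat.mul_le_mul ?_ (hpow _ (by omega)))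
      calc n + 1 ≤ 1 * L := by omega
        _ ≤ _ := Nat.mul_le_mul_right _ hXL
    have hL2 : 4 ≤ L ^ 2 := by nlinarith
    calc x₁ + (x₂ + (x₃ + x₄)) ≤ X * (4 * L ^ (k + 2)) := by
          have : X * (4 * L ^ (k + 2)) = 4 * (X * L * L * L ^ k) := by ring
          omega
      _ ≤ X * (L ^ 2 * L ^ (k + 2)) := by gcongr
      _ ≤ X * L ^ (k + 6) := by
          rw [← pow_add]
          exact Nat.mul_le_mul_left _ (Nat.pow_le_pow_right (by omega) (by omega))
      _ ≤ X * n ^ (3 * (k + 6)) := by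
          rw [pow_mul]
          refine Nat.mul_le_mul_left _ (Nat.pow_le_pow_left ?_ _)
          -- Here `n ≥ 2` turns powers of `3 * n + 2` into powers of `n`.
          have : 4 * n ≤ n ^ 3 := by
            rw [pow_succ]; exact Nat.mul_le_mul_right n (by nlinarith)
          omega
  · have h4 : s₄.nat 4 0 = s₃.view.nat 4 0 := e4
    rw [h4]
    rcases hres with ⟨hf4, -, hno⟩ | ⟨hf4, -⟩
    · refine .inl ⟨hf4, Set.eq_empty_of_forall_notMem fun τ hτ => ?_⟩
      obtain ⟨K', hq, hd, -⟩ := hopt τ hτ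
      exact hno K' hq hd
    · obtain ⟨-, hd, hmin⟩ := hKq hf4
      have hKu : K.1 = Finset.univ := (Finset.card_eq_iff_eq_univ _).1 (by simpa using hd.1)
      obtain ⟨σ, hσ, hplace, hcost⟩ := hKl.1.path.exists_perm hKu hd.2
      refine .inr ⟨hf4, σ, hσ, fun τ hτ => ?_, fun v => ?_⟩
      · obtain ⟨K', hq, hd', hle⟩ := hopt τ hτ
        rw [hcost, hKl.2]
        exact (hmin K' hq hd').trans hle
      · rw [hplace]
        refine hout v ?_
        have := hKl.1.path.fst_eq.1
        rw [hKu] at this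
        simpa using (this ▸ Finset.mem_univ v : v ∈ l.toFinset)

end Runs

end Coding

end Sched

/-! ### Reduction of the branch to the dynamic programming task -/

namespace Sched

open Function

/-- One formula in the code of the quarter replaces four cases, both in the proofs and in the terms
given to the machine. -/
lemma Quarter.mem_segment {n : ℕ} (hn : 4 ∣ n) (q : Quarter) (i : ℕ) :
    i ∈ q.segment n ↔ q.code * (n / 4) < i ∧ i ≤ (q.code + 1) * (n / 4) := by
  cases q <;> simp only [Quarter.segment, Quarter.code, Finset.mem_Icc] <;> omega

namespace Remaining

variable {R : Type} [AddCommGroup R] [LinearOrder R] {n : ℕ} (I : Remaining R n)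

include I in
lemma four_le : 4 ≤ n :=
  Nat.le_of_dvd (Fin.pos I.first) I.four_dvd

lemma first_mem : I.first ∈ I.M := by simp [M]

lemma last_mem : I.last ∈ I.M := by simp [M]

lemma mem_I₁ {v : Fin n} : v ∈ I.I₁ ↔ v ∉ I.M := by simp [I₁]

/-- The jobs outside `M` are pairwise incomparable. -/
lemma mem_M_of_prec {u v : Fin n} (h : I.prec u v) (hu : u ∉ I.M) : v ∈ I.M := by
  by_contra hv
  have hu' : u ∉ I.matching.verts := fun h => hu (by simp [M, h])
  have hv' : v ∉ I.matching.verts := fun h => hv (by simp [M, h])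
  have huf : u ≠ I.first := fun h => hu (h ▸ I.first_mem)
  have hvl : v ≠ I.last := fun h => hv (h ▸ I.last_mem)
  have h₀ : I.prec₀ u v := by
    rcases h with h | ⟨h, -⟩ | ⟨h, -⟩
    · exact h
    · exact absurd h huf
    · exact absurd h hvl
  have := I.strict
  have hadj : (compGraph I.prec₀).Adj u v := .inl h₀
  -- Two comparable jobs that are both unmatched could be added to the matching as a further edge.
  have hsup : (I.matching ⊔ (compGraph I.prec₀).subgraphOfAdj hadj).IsMatching := by
    refine I.matching_maximal.1.sup (SimpleGraph.Subgraph.IsMatching.subgraphOfAdj hadj) ?_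
    rw [I.matching_maximal.1.support_eq_verts,
      (SimpleGraph.Subgraph.IsMatching.subgraphOfAdj hadj).support_eq_verts]
    rw [Set.disjoint_left]
    rintro x hx (rfl | rfl)
    · exact hu' hx
    · exact hv' hx
  have hle := I.matching_maximal.2 hsup le_sup_left
  exact hu' (hle.1 (.inr (by simp)))

/-- The jobs whose quarter is known. -/
noncomputable def fixed : Finset (Fin n) := I.M ∪ I.Whalf

lemma mem_I₂ {v : Fin n} : v ∈ I.I₂ ↔ v ∉ I.fixed := by
  simp [I₂, fixed, mem_I₁]

lemma mem_fixed {v : Fin n} : v ∈ I.fixed ↔ v ∈ I.M ∨ ∃ w ∈ I.M,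
    ((I.quarter w).code ≤ 1 ∧ I.prec v w) ∨ (2 ≤ (I.quarter w).code ∧ I.prec w v) := by
  have hAB : ∀ w, w ∈ I.MQ .A ∪ I.MQ .B ↔ w ∈ I.M ∧ (I.quarter w).code ≤ 1 := fun w => by
    cases h : I.quarter w <;> simp [MQ, h, Quarter.code]
  have hCD : ∀ w, w ∈ I.MQ .C ∪ I.MQ .D ↔ w ∈ I.M ∧ 2 ≤ (I.quarter w).code := fun w => by
    cases h : I.quarter w <;> simp [MQ, h, Quarter.code]
  simp only [fixed, Whalf, WhalfAB, WhalfCD, Finset.mem_union (s := I.M), Finset.mem_union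
    (s := Finset.filter _ I.I₁), Finset.mem_filter, hAB, hCD, mem_I₁]
  by_cases hv : v ∈ I.M
  · simp [hv]
  · simp only [hv, false_or, not_false_eq_true, true_and]
    constructor
    · rintro (⟨w, h₁, h₂⟩ | ⟨w, h₁, h₂⟩)
      · exact ⟨w, h₁.1, .inl ⟨h₁.2, h₂⟩⟩
      · exact ⟨w, h₁.1, .inr ⟨h₁.2, h₂⟩⟩
    · rintro ⟨w, h₁, h₂ | h₂⟩
      · exact .inl ⟨w, ⟨h₁, h₂.1⟩, h₂.2⟩
      · exact .inr ⟨w, ⟨h₁, h₂.1⟩, h₂.2⟩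

/-- `v` comes after a job of the second quarter. -/
def AfterB (v : Fin n) : Prop := ∃ w ∈ I.M, (I.quarter w).code = 1 ∧ I.prec w v

/-- `v` comes before a job of the third quarter. -/
def BeforeC (v : Fin n) : Prop := ∃ w ∈ I.M, (I.quarter w).code = 2 ∧ I.prec v w

lemma mem_P {Γ : Quarter} {v : Fin n} : v ∈ I.P Γ ↔ v ∉ I.fixed ∧
    ((Γ.code = 0 ∧ ¬ I.AfterB v) ∨ (Γ.code = 1 ∧ I.AfterB v) ∨ (Γ.code = 2 ∧ I.BeforeC v) ∨
      (Γ.code = 3 ∧ ¬ I.BeforeC v)) := by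
  have hB : ∀ w, w ∈ I.MQ .B ↔ w ∈ I.M ∧ (I.quarter w).code = 1 := fun w => by
    cases h : I.quarter w <;> simp [MQ, h, Quarter.code]
  have hC : ∀ w, w ∈ I.MQ .C ↔ w ∈ I.M ∧ (I.quarter w).code = 2 := fun w => by
    cases h : I.quarter w <;> simp [MQ, h, Quarter.code]
  cases Γ <;> simp only [P, PA, PnotA, PD, PnotD, Finset.mem_sdiff, Finset.mem_filter, mem_I₂, hB,
    hC, AfterB, BeforeC, and_assoc, Quarter.code] <;> simp +contextual

lemma not_mem_M_of_mem_P {Γ : Quarter} {v : Fin n} (h : v ∈ I.P Γ) : v ∉ I.M := fun h' =>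
  (I.mem_P.1 h).1 (Finset.mem_union_left _ h')

/-- The number of positions at which the jobs of `P Γ` are counted from the nearer end. -/
def reach (n : ℕ) : Quarter → ℕ
  | .A => n / 4
  | .B => n / 2
  | .C => n / 2
  | .D => n / 4

/-- A predecessor of a job of `P Γ` belongs to the first positions. -/
lemma code_of_prec_left {Γ : Quarter} (hΓ : Γ.code ≤ 1) {u v : Fin n} (hv : v ∈ I.P Γ)
    (h : I.prec u v) : u ∈ I.M ∧ (I.quarter u).code ≤ Γ.code := by
  obtain ⟨h₁, h₂⟩ := I.mem_P.1 hv
  have hu : u ∈ I.M := by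
    by_contra hu
    exact I.not_mem_M_of_mem_P hv (I.mem_M_of_prec h hu)
  refine ⟨hu, ?_⟩
  -- A predecessor in the second half would force `v` into `WhalfCD`. For `Γ = A` a predecessor in
  -- quarter `B` is excluded as well, by the definition of `PA`.
  have h₃ : (I.quarter u).code ≤ 1 := by
    by_contra hlt
    exact h₁ (I.mem_fixed.2 (.inr ⟨u, hu, .inr ⟨by omega, h⟩⟩))
  rcases h₂ with ⟨h₀, h₂⟩ | ⟨h₀, -⟩ | ⟨h₀, -⟩ | ⟨h₀, -⟩
  · have : (I.quarter u).code ≠ 1 := fun h' => h₂ ⟨u, hu, h', h⟩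
    omega
  all_goals omega

/-- A successor of a job of `P Γ` belongs to the last positions. -/
lemma code_of_prec_right {Γ : Quarter} (hΓ : 2 ≤ Γ.code) {u v : Fin n} (hv : v ∈ I.P Γ)
    (h : I.prec v u) : u ∈ I.M ∧ Γ.code ≤ (I.quarter u).code := by
  obtain ⟨h₁, h₂⟩ := I.mem_P.1 hv
  have hu : u ∈ I.M := I.mem_M_of_prec h (I.not_mem_M_of_mem_P hv)
  refine ⟨hu, ?_⟩
  have h₃ : 2 ≤ (I.quarter u).code := by
    by_contra hlt
    exact h₁ (I.mem_fixed.2 (.inr ⟨u, hu, .inl ⟨by omega, h⟩⟩))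
  rcases h₂ with ⟨h₀, -⟩ | ⟨h₀, -⟩ | ⟨h₀, -⟩ | ⟨h₀, h₂⟩
  any_goals omega
  have : (I.quarter u).code ≠ 2 := fun h' => h₂ ⟨u, hu, h', h⟩
  cases hq : I.quarter u <;> simp_all [Quarter.code]

lemma pos_injective (σ : Equiv.Perm (Fin n)) : Function.Injective (pos σ) := fun u v h =>
  σ.injective (Fin.ext (by simpa [pos] using h))

lemma count_eq (Γ : Quarter) (σ : Equiv.Perm (Fin n)) :
    I.count Γ σ = ((I.P Γ).filter fun v => pos σ v ∈ Γ.segment n).card := by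
  rw [count, ← Finset.card_image_of_injective _ (pos_injective σ)]
  congr 1
  ext i
  simp only [Finset.mem_inter, Finset.mem_image, Finset.mem_filter]
  constructor
  · rintro ⟨⟨v, hv, rfl⟩, h⟩; exact ⟨v, ⟨hv, h⟩, rfl⟩
  · rintro ⟨v, ⟨hv, h⟩, rfl⟩; exact ⟨⟨v, hv, rfl⟩, h⟩

/-- The problem for the first two quarters. -/
noncomputable def forward (Γ : Quarter) (p : ℕ) : Problem R n where
  prec := I.prec
  allowed v i := v ∈ I.fixed → i ∈ (I.quarter v).segment n
  time := I.time
  P := I.P Γ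
  h := reach n Γ
  p := p

/-- The problem for the last two quarters; the order of the jobs is reversed. -/
noncomputable def backward (Γ : Quarter) (p : ℕ) : Problem Rᵒᵈ n where
  prec u v := I.prec v u
  allowed v i := v ∈ I.fixed → n + 1 - i ∈ (I.quarter v).segment n
  time v := OrderDual.toDual (I.time v)
  P := I.P Γ
  h := reach n Γ
  p := p

variable {Γ : Quarter} {p : ℕ}

lemma forward_separated (hΓ : Γ.code ≤ 1) : (I.forward Γ p).Separated I.M where
  time_injective := I.time_injective
  disjoint := Finset.disjoint_left.2 fun _ => I.not_mem_M_of_mem_P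
  succ_mem v hv w h := I.mem_M_of_prec h (I.not_mem_M_of_mem_P hv)
  -- The guessed last job gives every job of `P Γ` a successor; in the reversed problem the first
  -- job plays this role.
  succ_exists v hv := ⟨I.last, .inr (.inr ⟨rfl, fun h =>
    I.not_mem_M_of_mem_P hv (h ▸ I.last_mem)⟩)⟩
  pred_early v hv u h i hi := by
    obtain ⟨hu, hq⟩ := I.code_of_prec_left hΓ hv h
    have := ((I.quarter u).mem_segment I.four_dvd i).1 (hi (Finset.mem_union_left _ hu))
    have h₁ : ((I.quarter u).code + 1) * (n / 4) ≤ (Γ.code + 1) * (n / 4) :=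
      Nat.mul_le_mul_right _ (by omega)
    have h₂ : (Γ.code + 1) * (n / 4) ≤ reach n Γ := by
      cases Γ <;> (simp [Quarter.code, reach] at hΓ ⊢; try omega)
    exact this.2.trans (h₁.trans h₂)
  free v hv i h := absurd h (I.mem_P.1 hv).1

lemma backward_separated (hΓ : 2 ≤ Γ.code) : (I.backward Γ p).Separated I.M where
  time_injective := I.time_injective
  disjoint := Finset.disjoint_left.2 fun _ => I.not_mem_M_of_mem_P
  succ_mem v hv w h := by
    by_contra hw
    exact I.not_mem_M_of_mem_P hv (I.mem_M_of_prec h hw)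
  succ_exists v hv := ⟨I.first, .inr (.inl ⟨rfl, fun h =>
    I.not_mem_M_of_mem_P hv (h ▸ I.first_mem)⟩)⟩
  pred_early v hv u h i hi := by
    obtain ⟨hu, hq⟩ := I.code_of_prec_right hΓ hv h
    have := ((I.quarter u).mem_segment I.four_dvd _).1 (hi (Finset.mem_union_left _ hu))
    have h₁ : Γ.code * (n / 4) ≤ (I.quarter u).code * (n / 4) :=
      Nat.mul_le_mul_right _ (by omega)
    have h₂ : n ≤ Γ.code * (n / 4) + reach n Γ := by
      have := I.four_dvd
      cases Γ <;> (simp [Quarter.code, reach] at hΓ ⊢; try omega)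
    change i ≤ reach n Γ
    omega
  free v hv i h := absurd h (I.mem_P.1 hv).1

/-- For `A` the first `h` positions are the quarter itself. For `B` they are the first half, but
each job of `PnotA` comes after a job placed in `B`, so it cannot stand in `A`, and both counts
agree. -/
lemma forward_good (hΓ : Γ.code ≤ 1) :
    (I.forward Γ p).good = {τ ∈ I.branch | I.count Γ τ = p} := by
  ext σ
  simp only [Problem.good, branch, Set.mem_ofPred_eq, and_assoc, count_eq]
  refine and_congr_right fun h₁ => and_congr_right fun h₂ => ?_
  suffices h : ((I.forward Γ p).P.filter fun v => pos σ v ≤ (I.forward Γ p).h) =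
      (I.P Γ).filter fun v => pos σ v ∈ Γ.segment n by rw [h]; rfl
  refine Finset.filter_congr fun v hv => ?_
  have hv : v ∈ I.P Γ := hv
  rw [Γ.mem_segment I.four_dvd]
  have hreach : (Γ.code + 1) * (n / 4) = (I.forward Γ p).h := by
    have := I.four_dvd
    change _ = reach n Γ
    cases Γ <;> (simp [Quarter.code, reach] at hΓ ⊢; try omega)
  rw [hreach, iff_and_self]
  intro _
  rcases (I.mem_P.1 hv).2 with ⟨h₀, -⟩ | ⟨h₀, w, hw, hq, hwv⟩ | ⟨h₀, -⟩ | ⟨h₀, -⟩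
  · simp [h₀, pos]
  · have := ((I.quarter w).mem_segment I.four_dvd _).1 (h₂ w (Finset.mem_union_left _ hw))
    rw [hq, ← h₀] at this
    exact this.1.trans (h₁ w v hwv)
  all_goals omega

/-- The reversed ordering. -/
def reverse (σ : Equiv.Perm (Fin n)) : Equiv.Perm (Fin n) := σ.trans Fin.revPerm

lemma pos_reverse (σ : Equiv.Perm (Fin n)) (v : Fin n) : pos (reverse σ) v = n + 1 - pos σ v := by
  simp only [pos, reverse, Equiv.trans_apply, Fin.revPerm_apply, Fin.val_rev]
  omega

lemma reverse_reverse (σ : Equiv.Perm (Fin n)) : reverse (reverse σ) = σ := by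
  ext v; simp [reverse]

/-- The mirror image of `forward_good`: a job of `PnotD` comes before a job placed in `C`, so it
cannot stand in `D`. -/
lemma backward_good (hΓ : 2 ≤ Γ.code) (σ : Equiv.Perm (Fin n)) :
    σ ∈ (I.backward Γ p).good ↔ reverse σ ∈ {τ ∈ I.branch | I.count Γ τ = p} := by
  have hpos : ∀ v, 1 ≤ pos σ v ∧ pos σ v ≤ n := fun v => by simp [pos]
  simp only [Problem.good, branch, Set.mem_ofPred_eq, and_assoc, count_eq, pos_reverse]
  have hprec : (∀ u v, (I.backward Γ p).prec u v → pos σ u < pos σ v) ↔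
      ∀ u v, I.prec u v → n + 1 - pos σ u < n + 1 - pos σ v := by
    constructor
    · intro h u v huv
      have := h v u huv; have := hpos v; omega
    · intro h u v huv
      have := h v u huv; have := hpos v; omega
  rw [hprec]
  refine and_congr_right fun h₁ => and_congr_right fun h₂ => ?_
  suffices h : ((I.backward Γ p).P.filter fun v => pos σ v ≤ (I.backward Γ p).h) =
      (I.P Γ).filter fun v => n + 1 - pos σ v ∈ Γ.segment n by rw [h]; rfl
  refine Finset.filter_congr fun v hv => ?_
  have hv : v ∈ I.P Γ := hv
  rw [Γ.mem_segment I.four_dvd]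
  have hreach : Γ.code * (n / 4) + (I.backward Γ p).h = n := by
    have := I.four_dvd
    change _ + reach n Γ = _
    cases Γ <;> (simp [Quarter.code, reach] at hΓ ⊢; try omega)
  have hp := hpos v
  have key : n + 1 - pos σ v ≤ (Γ.code + 1) * (n / 4) := by
    rcases (I.mem_P.1 hv).2 with ⟨h₀, -⟩ | ⟨h₀, -⟩ | ⟨h₀, w, hw, hq, hwv⟩ | ⟨h₀, -⟩
    any_goals omega
    · have := ((I.quarter w).mem_segment I.four_dvd _).1 (h₂ w (Finset.mem_union_left _ hw))
      rw [hq, ← h₀] at this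
      exact (h₁ v w hwv).le.trans this.2
    · have := I.four_dvd
      rw [h₀]; omega
  constructor
  · intro h; exact ⟨by omega, key⟩
  · rintro ⟨h, -⟩; omega

lemma forward_cost (σ : Equiv.Perm (Fin n)) : (I.forward Γ p).cost σ = I.cost σ := rfl

/-- A job enters the cost of `σ` with coefficient `n - σ u` and that of the reversal with `σ u + 1`.
The two costs sum to the constant `(n + 1) • ∑ time`, so maximizing one is minimizing the other. -/
lemma backward_cost_le_iff [IsOrderedAddMonoid R] (σ τ : Equiv.Perm (Fin n)) :
    (I.backward Γ p).cost σ ≤ (I.backward Γ p).cost τ ↔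
      I.cost (reverse σ) ≤ I.cost (reverse τ) := by
  have key : ∀ σ, OrderDual.ofDual ((I.backward Γ p).cost σ) + I.cost (reverse σ) =
      ∑ u, (n + 1) • I.time u := fun σ => by
    have h₁ : OrderDual.ofDual ((I.backward Γ p).cost σ) = ∑ u, (n - (σ u : ℕ)) • I.time u := by
      rw [Problem.cost_eq_sum]; rfl
    rw [h₁, ← I.forward_cost (Γ := Γ) (p := p), Problem.cost_eq_sum, ← Finset.sum_add_distrib]
    refine Finset.sum_congr rfl fun u _ => ?_
    change _ + _ • I.time u = _
    rw [← add_nsmul]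
    congr 1
    have := (σ u).2
    simp only [reverse, Equiv.trans_apply, Fin.revPerm_apply, Fin.val_rev]
    omega
  have hσ := eq_sub_of_add_eq (key σ)
  have hτ := eq_sub_of_add_eq (key τ)
  rw [← OrderDual.ofDual_le_ofDual, hσ, hτ, sub_le_sub_iff_left]

end Remaining

end Sched

namespace Sched

open Function Tm

namespace Remaining

variable {R : Type} [AddCommGroup R] [LinearOrder R] {n : ℕ}

/-! ### Terms that describe the remaining instance -/

def precTerm (e₁ e₂ : Tm) : Tm :=
  orT (.read 1 (.op .add (.op .mul e₁ size) e₂))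
    (orT (andT (eqT e₁ (.read 0 (.lit 1))) (notT (eqT e₂ (.read 0 (.lit 1)))))
      (andT (eqT e₂ (.read 0 (.lit 2))) (notT (eqT e₁ (.read 0 (.lit 2))))))

/-- The quarter of job `8` is known. -/
def fixedTerm : Tm :=
  orT (.read 2 (.var 8)) (exT 10 (andT (.read 2 (.var 10))
    (orT (andT (.le (.read 3 (.var 10)) (.lit 1)) (precTerm (.var 8) (.var 10)))
      (andT (.le (.lit 2) (.read 3 (.var 10))) (precTerm (.var 10) (.var 8))))))

def afterBTerm : Tm :=
  exT 10 (andT (.read 2 (.var 10))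
    (andT (eqT (.read 3 (.var 10)) (.lit 1)) (precTerm (.var 10) (.var 8))))

def beforeCTerm : Tm :=
  exT 10 (andT (.read 2 (.var 10))
    (andT (eqT (.read 3 (.var 10)) (.lit 2)) (precTerm (.var 8) (.var 10))))

/-- The code of the quarter for which the jobs are counted. -/
def codeTerm : Tm := .read 0 (.lit 3)

def inPTerm : Tm :=
  andT (notT fixedTerm) (orT (andT (eqT codeTerm (.lit 0)) (notT afterBTerm))
    (orT (andT (eqT codeTerm (.lit 1)) afterBTerm)
      (orT (andT (eqT codeTerm (.lit 2)) beforeCTerm)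
        (andT (eqT codeTerm (.lit 3)) (notT beforeCTerm)))))

/-- The divisor is `2` for the codes `1` and `2` and `4` otherwise. -/
def reachTerm : Tm :=
  .op .div size (.op .sub (.lit 4)
    (.op .mul (.lit 2) (.op .mul (.le (.lit 1) codeTerm) (.le codeTerm (.lit 2)))))

/-- Position `e` may be given to job `8`. -/
def allowedTerm (e : Tm) : Tm :=
  impT fixedTerm (andT
    (ltT (.op .mul (.read 3 (.var 8)) (.op .div size (.lit 4))) e)
    (.le e (.op .mul (.op .add (.read 3 (.var 8)) (.lit 1)) (.op .div size (.lit 4)))))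

/-- The position `e`, counted from the other end. -/
def mirrorTerm (e : Tm) : Tm := .op .sub (.op .add size (.lit 1)) e

def forwardCoding : Coding where
  prec := precTerm (.var 8) (.var 9)
  allowed := allowedTerm (.var 9)
  inP := inPTerm
  h := reachTerm
  out := .var 8

def backwardCoding : Coding where
  prec := precTerm (.var 9) (.var 8)
  allowed := allowedTerm (mirrorTerm (.var 9))
  inP := inPTerm
  h := reachTerm
  out := mirrorTerm (.var 8)

/-- The integer arrays of the input. -/
structure Reads {S : Type} (I : Remaining R n) (Γ : Quarter) (p : ℕ) (s : State S) : Prop where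
  size : s.nat 0 0 = n
  first : s.nat 0 1 = I.first
  last : s.nat 0 2 = I.last
  code : s.nat 0 3 = Γ.code
  goal : s.nat 0 4 = p
  prec : ∀ u v : Fin n, s.nat 1 (u * n + v) ≠ 0 ↔ I.prec₀ u v
  mem : ∀ v : Fin n, s.nat 2 v ≠ 0 ↔ v ∈ I.M
  quarter : ∀ v : Fin n, s.nat 3 v = (I.quarter v).code

variable {I : Remaining R n} {Γ : Quarter} {p : ℕ}

lemma index_injective {u v u' v' : Fin n} (h : (u * n + v : ℕ) = u' * n + v') :
    u = u' ∧ v = v' := by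
  have hn : 0 < n := Fin.pos u
  have h₁ := congrArg (· / n) h
  have h₂ := congrArg (· % n) h
  simp only [Nat.mul_add_mod', Nat.mod_eq_of_lt v.2, Nat.mod_eq_of_lt v'.2] at h₂
  rw [h₂] at h
  have h₃ : (u : ℕ) * n = u' * n := by omega
  exact ⟨Fin.ext (Nat.eq_of_mul_eq_mul_right hn h₃), Fin.ext h₂⟩

lemma reads_input : I.Reads Γ p (I.input Γ p) where
  size := by simp [input]
  first := by simp [input]
  last := by simp [input]
  code := by simp [input]
  goal := by simp [input]
  prec u v := by
    have : (∃ u' v' : Fin n, (u * n + v : ℕ) = u' * n + v' ∧ I.prec₀ u' v') ↔ I.prec₀ u v := by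
      constructor
      · rintro ⟨u', v', h, h'⟩
        obtain ⟨rfl, rfl⟩ := index_injective h
        exact h'
      · exact fun h => ⟨u, v, rfl, h⟩
    simp [input, this]
  mem v := by
    have : (∃ w ∈ I.M, (v : ℕ) = w) ↔ v ∈ I.M := by
      constructor
      · rintro ⟨w, h, h'⟩
        rwa [Fin.ext h']
      · exact fun h => ⟨v, h, rfl⟩
    simp [input, this]
  quarter v := by simp [input]

section

variable {S : Type} {s : State S}

lemma Reads.of_nat_eq {T : Type} {t : State T} (h : I.Reads Γ p s)
    (he : ∀ a ≤ 3, t.nat a = s.nat a) : I.Reads Γ p t := by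
  have h0 := he 0 (by omega)
  have h1 := he 1 (by omega)
  have h2 := he 2 (by omega)
  have h3 := he 3 (by omega)
  constructor
  · rw [h0, h.size]
  · rw [h0, h.first]
  · rw [h0, h.last]
  · rw [h0, h.code]
  · rw [h0, h.goal]
  · rw [h1]; exact h.prec
  · rw [h2]; exact h.mem
  · rw [h3]; exact h.quarter

variable [LinearOrder S] (hs : I.Reads Γ p s) (ρ : ℕ → ℕ)

include hs

lemma Reads.tr_prec {e₁ e₂ : Tm} {u v : Fin n} (h₁ : e₁.eval s ρ = u) (h₂ : e₂.eval s ρ = v) :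
    Tr s ρ (precTerm e₁ e₂) ↔ I.prec u v := by
  have h : Tr s ρ (.read 1 (.op .add (.op .mul e₁ Tm.size) e₂)) ↔ I.prec₀ u v := by
    rw [Tr, Tm.eval, Tm.eval, Tm.eval, h₁, h₂, eval_size, hs.size]; exact hs.prec u v
  rw [precTerm, tr_or, tr_or, tr_and, tr_and, tr_not, tr_not, tr_eq, tr_eq, tr_eq, tr_eq, h, h₁, h₂]
  simp only [Tm.eval, hs.first, hs.last, Fin.val_inj]
  rfl

lemma Reads.tr_mem {k : ℕ} {v : Fin n} (h : ρ k = v) : Tr s ρ (.read 2 (.var k)) ↔ v ∈ I.M := by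
  rw [Tr, Tm.eval, Tm.eval, h]; exact hs.mem v

variable {ρ} {v : Fin n} (hv : ρ 8 = v)

include hv

lemma Reads.tr_fixed : Tr s ρ fixedTerm ↔ v ∈ I.fixed := by
  rw [fixedTerm, tr_or, hs.tr_mem ρ hv, tr_ex ρ hs.size, mem_fixed]
  refine or_congr_right (exists_congr fun w => ?_)
  have h10 : (Tm.var 10).eval s (update ρ 10 w) = w := by simp [Tm.eval]
  have h8 : (Tm.var 8).eval s (update ρ 10 w) = v := by simp [Tm.eval, hv]
  rw [tr_and, hs.tr_mem _ (v := w) (by simp), tr_or, tr_and, tr_and, tr_le, tr_le,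
    hs.tr_prec _ h8 h10, hs.tr_prec _ h10 h8]
  simp [Tm.eval, hs.quarter]

lemma Reads.tr_afterB : Tr s ρ afterBTerm ↔ I.AfterB v := by
  rw [afterBTerm, tr_ex ρ hs.size, AfterB]
  refine exists_congr fun w => ?_
  have h10 : (Tm.var 10).eval s (update ρ 10 w) = w := by simp [Tm.eval]
  have h8 : (Tm.var 8).eval s (update ρ 10 w) = v := by simp [Tm.eval, hv]
  rw [tr_and, hs.tr_mem _ (v := w) (by simp), tr_and, tr_eq, hs.tr_prec _ h10 h8]
  simp [Tm.eval, hs.quarter]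

lemma Reads.tr_beforeC : Tr s ρ beforeCTerm ↔ I.BeforeC v := by
  rw [beforeCTerm, tr_ex ρ hs.size, BeforeC]
  refine exists_congr fun w => ?_
  have h10 : (Tm.var 10).eval s (update ρ 10 w) = w := by simp [Tm.eval]
  have h8 : (Tm.var 8).eval s (update ρ 10 w) = v := by simp [Tm.eval, hv]
  rw [tr_and, hs.tr_mem _ (v := w) (by simp), tr_and, tr_eq, hs.tr_prec _ h8 h10]
  simp [Tm.eval, hs.quarter]

lemma Reads.tr_inP : Tr s ρ inPTerm ↔ v ∈ I.P Γ := by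
  have hc : codeTerm.eval s ρ = Γ.code := hs.code
  simp only [inPTerm, tr_and, tr_or, tr_not, tr_eq, hc, hs.tr_fixed hv, hs.tr_afterB hv,
    hs.tr_beforeC hv, mem_P, Tm.eval]

lemma Reads.tr_allowed {e : Tm} {i : ℕ} (he : e.eval s ρ = i) :
    Tr s ρ (allowedTerm e) ↔ (v ∈ I.fixed → i ∈ (I.quarter v).segment n) := by
  rw [allowedTerm, tr_imp, tr_and, tr_lt, tr_le, hs.tr_fixed hv, he,
    Quarter.mem_segment I.four_dvd]
  simp only [Tm.eval, Op.app, Tm.size, hs.size, hv, hs.quarter]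

omit hv in
lemma Reads.eval_reach (ρ : ℕ → ℕ) : reachTerm.eval s ρ = reach n Γ := by
  simp only [reachTerm, codeTerm, Tm.eval, Op.app, Tm.size, hs.size, hs.code]
  cases Γ <;> simp [Quarter.code, reach]

omit hv in
lemma Reads.eval_mirror (ρ : ℕ → ℕ) (e : Tm) :
    (mirrorTerm e).eval s ρ = n + 1 - e.eval s ρ := by
  simp only [mirrorTerm, Tm.eval, Op.app, Tm.size, hs.size]

end

/-- The renumbering `enc` moves only arrays from `6` on, so terms see the input arrays under their
own names. -/
lemma input_view_nat : ∀ a ≤ 3, (I.input Γ p).view.nat a = (I.input Γ p).nat a := fun a ha => by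
  rw [State.view_nat, enc, if_pos (by omega)]

lemma reads_input_view : I.Reads Γ p (I.input Γ p).view := reads_input.of_nat_eq input_view_nat

lemma forward_describes :
    forwardCoding.Describes (I.forward Γ p) (I.input Γ p).view id where
  size := reads_input_view.size
  goal := reads_input_view.goal
  time v := by simp [input, forward]
  prec s hs ρ u v hu hv := (reads_input_view.of_nat_eq hs.1).tr_prec ρ hu hv
  allowed s hs ρ v i hv hi _ _ := (reads_input_view.of_nat_eq hs.1).tr_allowed hv hi
  inP s hs ρ v hv := (reads_input_view.of_nat_eq hs.1).tr_inP hv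
  h s hs ρ := (reads_input_view.of_nat_eq hs.1).eval_reach ρ
  out _ _ _ _ h := h

lemma reads_input_dual : I.Reads Γ p (I.input Γ p).dual.view :=
  (reads_input_view (I := I)).of_nat_eq fun _ _ => rfl

lemma backward_describes : backwardCoding.Describes (I.backward Γ p) (I.input Γ p).dual.view
    (fun i => n + 1 - i) where
  size := reads_input_dual.size
  goal := reads_input_dual.goal
  time v := by simp [input, backward, State.dual]; rfl
  prec s hs ρ u v hu hv := (reads_input_dual.of_nat_eq hs.1).tr_prec ρ hv hu
  allowed s hs ρ v i hv hi _ _ := by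
    have h := reads_input_dual.of_nat_eq hs.1
    exact h.tr_allowed hv (by rw [h.eval_mirror]; exact congrArg (n + 1 - ·) hi)
  inP s hs ρ v hv := (reads_input_dual.of_nat_eq hs.1).tr_inP hv
  h s hs ρ := (reads_input_dual.of_nat_eq hs.1).eval_reach ρ
  out s hs ρ i h := by
    exact ((reads_input_dual.of_nat_eq hs.1).eval_mirror ρ _).trans (congrArg (n + 1 - ·) h)

lemma fresh_input : Coding.Fresh (I.input Γ p) where
  nat a ha := by
    funext i
    simp [input, show a ≠ 0 by omega, show a ≠ 1 by omega, show a ≠ 2 by omega,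
      show a ≠ 3 by omega]
  grp a ha := by
    funext i
    simp [input, show a ≠ 0 by omega]

lemma input_bounded (hp : p ≤ n) : (I.input Γ p).view.Bounded (3 * n + 2) := by
  have h₂ : 2 ^ 2 ≤ 2 ^ (3 * n + 2) := Nat.pow_le_pow_right (by omega) (by omega)
  have h₁ : ∀ x ≤ n, x < 2 ^ (3 * n + 2) := fun x hx => hx.trans_lt
    (Nat.lt_two_pow_self.trans_le (Nat.pow_le_pow_right (by omega) (by omega)))
  have hc : ∀ q : Quarter, q.code < 2 ^ (3 * n + 2) := fun q =>
    lt_of_lt_of_le (by cases q <;> simp [Quarter.code]) h₂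
  have h0 : 0 < 2 ^ (3 * n + 2) := by positivity
  refine ⟨by rw [reads_input_view.size]; omega, fun a i => ?_⟩
  rw [State.view_nat]
  simp only [input]
  split
  · rcases i with _ | _ | _ | _ | _ | i
    · exact h₁ _ le_rfl
    · exact h₁ _ I.first.2.le
    · exact h₁ _ I.last.2.le
    · exact hc Γ
    · exact h₁ _ hp
    · simp
  · repeat' split
    all_goals first | exact hc _ | omega

/-- The program for all quarters. -/
def solver : Prog :=
  .ite (.le (.read 0 (.lit 3)) (.lit 1)) forwardCoding.program backwardCoding.program.flip

end Remaining

end Sched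

/-! ### The program for all four quarters and the conclusion -/

namespace Sched.Remaining

open Coding

/-- The program finds a best ordering of the branch with the given count. -/
theorem solver_runs : ∃ k, ∀ {R : Type} [AddCommGroup R] [LinearOrder R] [IsOrderedAddMonoid R]
    {n : ℕ} (I : Remaining R n) (Γ : Quarter) (p : ℕ), 2 * p < (I.P Γ).card →
    ∃ s x, Runs solver (I.input Γ p) s x ∧
      x ≤ 2 ^ (n - (I.P Γ).card) * (I.P Γ).card.choose p * n.choose I.M.card * n ^ k ∧
      ((s.nat 4 0 = 0 ∧ {τ ∈ I.branch | I.count Γ τ = p} = ∅) ∨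
        (s.nat 4 0 = 1 ∧ ∃ σ, I.IsOptimal {τ ∈ I.branch | I.count Γ τ = p} σ ∧
          ∀ v : Fin n, s.nat 5 v = pos σ v)) := by
  obtain ⟨k₁, h₁⟩ := forwardCoding.program_runs
  obtain ⟨k₂, h₂⟩ := backwardCoding.program_runs
  refine ⟨k₁ + k₂ + 3, fun {R} _ _ _ {n} I Γ p hp => ?_⟩
  have hn := I.four_le
  have hPn : (I.P Γ).card ≤ n := by simpa using Finset.card_le_univ (I.P Γ)
  have hMn : I.M.card ≤ n := by simpa using Finset.card_le_univ I.M
  set X := 2 ^ (n - (I.P Γ).card) * (I.P Γ).card.choose p * n.choose I.M.card with hX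
  have hX1 : 1 ≤ X := Nat.mul_pos (Nat.mul_pos (by positivity) (Nat.choose_pos (by omega)))
    (Nat.choose_pos hMn)
  have hcost : (Test.le (.read 0 (.lit 3)) (.lit 1)).cost (I.input Γ p) ≤ 15 := by
    have hc : (I.input Γ p).nat 0 3 = Γ.code := reads_input.code
    have hs : Nat.size Γ.code ≤ 2 := Nat.size_le.2 (by cases Γ <;> simp [Quarter.code])
    have h3 : Nat.size 3 ≤ 2 := Nat.size_le.2 (by norm_num)
    simp only [Test.cost, Exp.cost, Exp.eval, hc, Nat.size_one]
    omega
  have htotal : ∀ x k, k ≤ k₁ + k₂ → x ≤ X * n ^ k →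
      (Test.le (.read 0 (.lit 3)) (.lit 1)).cost (I.input Γ p) + x + 1 ≤
        X * n ^ (k₁ + k₂ + 3) := by
    intro x k hk hx
    have e₁ : n ^ k ≤ n ^ (k₁ + k₂) := Nat.pow_le_pow_right (by omega) hk
    have e₂ : 1 ≤ X * n ^ (k₁ + k₂) := Nat.mul_pos hX1 (by positivity)
    have e₃ : x ≤ X * n ^ (k₁ + k₂) := hx.trans (Nat.mul_le_mul_left _ e₁)
    -- Since `n ≥ 4`, three further powers of `n` absorb the cost of the test that selects the
    -- direction.
    have e₄ : 4 ^ 3 ≤ n ^ 3 := Nat.pow_le_pow_left hn 3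
    calc _ ≤ X * n ^ (k₁ + k₂) * 4 ^ 3 := by omega
      _ ≤ X * n ^ (k₁ + k₂) * n ^ 3 := Nat.mul_le_mul_left _ e₄
      _ = _ := by rw [pow_add]; ring
  have htest : (Test.le (.read 0 (.lit 3)) (.lit 1)).Holds (I.input Γ p) ↔ Γ.code ≤ 1 := by
    have hc : (I.input Γ p).nat 0 3 = Γ.code := reads_input.code
    simp only [Test.Holds, Exp.eval, hc]
  by_cases hΓ : Γ.code ≤ 1
  · obtain ⟨s, x, hrun, hx, hres⟩ := h₁ (by omega) I.forward_describes
      (I.forward_separated (p := p) hΓ) hp (fun i _ h => h) fresh_input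
      (input_bounded (by omega))
    refine ⟨s, _, .iteTrue (htest.2 hΓ) hrun, htotal x k₁ (by omega) hx, ?_⟩
    rw [I.forward_good hΓ] at hres
    exact hres.imp_right fun ⟨h, σ, hσ, hmin, hout⟩ => ⟨h, σ, ⟨hσ, hmin⟩, hout⟩
  · have hΓ' : 2 ≤ Γ.code := by omega
    have hfresh : Coding.Fresh (I.input Γ p).dual :=
      ⟨(fresh_input (I := I)).nat, (fresh_input (I := I)).grp⟩
    have hbounded : (I.input Γ p).dual.view.Bounded (3 * n + 2) :=
      input_bounded (I := I) (Γ := Γ) (p := p) (by omega)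
    obtain ⟨s, x, hrun, hx, hres⟩ := h₂ (by omega) backward_describes
      (I.backward_separated (p := p) hΓ') hp (fun i h₁ h₂ => by omega) hfresh hbounded
    refine ⟨s.undual, _, .iteFalse (mt htest.1 hΓ) hrun.flip, htotal x k₂ (by omega) hx, ?_⟩
    rcases hres with ⟨h, hgood⟩ | ⟨h, σ, hσ, hmin, hout⟩
    -- Reversal is an involution, so every ordering of the branch is the reversal of a candidate for
    -- the reversed problem.
    · refine .inl ⟨h, Set.eq_empty_of_forall_notMem fun τ hτ => ?_⟩
      have := (I.backward_good hΓ' (p := p) (reverse τ)).2 (by rwa [reverse_reverse])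
      rw [hgood] at this
      exact this
    · refine .inr ⟨h, reverse σ, ⟨(I.backward_good hΓ' σ).1 hσ, fun τ hτ => ?_⟩, fun v => ?_⟩
      · have := hmin (reverse τ) ((I.backward_good hΓ' _).2 (by rwa [reverse_reverse]))
        rwa [I.backward_cost_le_iff, reverse_reverse] at this
      · rw [pos_reverse]; exact hout v

end Sched.Remaining

theorem mainTheorem5 :
    ∃ (prog : Sched.Prog) (k : ℕ),
      ∀ (R : Type) [AddCommGroup R] [LinearOrder R] [IsOrderedAddMonoid R]
        (n : ℕ) (I : Sched.Remaining R n) (ε₁ : ℝ),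
        ε₁ ≤ 1 / 4 →
        (I.matching.edgeSet.ncard : ℝ) < ε₁ * n →
        ∀ (Γ : Sched.Quarter) (p : ℕ),
          (p : ℝ) < ((I.P Γ).card : ℝ) / 2 →
          ∃ (s : Sched.State R) (c : ℕ) (out : Option (Equiv.Perm (Fin n))),
            Sched.Runs prog (I.input Γ p) s c ∧
            c ≤ 2 ^ (n - (I.P Γ).card) * (I.P Γ).card.choose p * n.choose I.M.card * n ^ k ∧
            Sched.Outputs s out ∧
            -- the output is best among the orderings of the branch with the given count
            (∀ σ, out = some σ → I.IsOptimal {τ ∈ I.branch | I.count Γ τ = p} σ) ∧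
            (out = none → ∀ τ ∈ I.branch, I.count Γ τ ≠ p) ∧
            -- if `p` is the count of an optimal ordering of the branch, then the output is optimal
            (∀ σopt, I.IsOptimal I.branch σopt → I.count Γ σopt = p →
              ∃ σ, out = some σ ∧ I.IsOptimal I.branch σ) := by
  obtain ⟨k, hk⟩ := Sched.Remaining.solver_runs
  refine ⟨Sched.Remaining.solver, k, fun R _ _ _ n I ε₁ _ _ Γ p hp => ?_⟩
  have hp' : 2 * p < (I.P Γ).card := by
    have : (2 * p : ℝ) < (I.P Γ).card := by linarith
    exact_mod_cast this
  obtain ⟨s, c, hrun, hc, hres⟩ := hk I Γ p hp'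
  rcases hres with ⟨h, hempty⟩ | ⟨h, σ, hσ, hout⟩
  · refine ⟨s, c, none, hrun, hc, h, by simp, fun _ τ hτ hp => ?_, fun τ hτ hp => ?_⟩
    · exact Set.eq_empty_iff_forall_notMem.1 hempty τ ⟨hτ, hp⟩
    · exact absurd ⟨hτ.1, hp⟩ (Set.eq_empty_iff_forall_notMem.1 hempty τ)
  · refine ⟨s, c, some σ, hrun, hc, ⟨h, hout⟩, ?_, by simp, fun τ hτ hp => ⟨σ, rfl, hσ.1.1, ?_⟩⟩
    · rintro _ ⟨⟩
      exact hσ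
    -- The optimal ordering `τ` of the branch competes with the output because its count is `p`.
    · exact fun τ' hτ' => (hσ.2 τ ⟨hτ.1, hp⟩).trans (hτ.2 τ' hτ')
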